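/- Let $n\ge 1$, let $\mathbb D$ be the open unit disc, and let $H^2(\mathbb D^n)$ be the Hardy space of the polydisc, that is, the Hilbert space of all holomorphic $f:\mathbb D^n\to\mathbb C$ with $$\|f\|^2=\sup_{0\le r<1}\int_{\mathbb T^n}|f(rz)|^2\,d\theta<\infty ,$$ where $d\theta$ is the normalized Lebesgue measure on the torus $\mathbb T^n$. Let $M_{z_i}$ be multiplication by the $i$-th coordinate function. A closed subspace $\mathcal S\subseteq H^2(\mathbb D^n)$ is a submodule if $M_{z_i}\mathcal S\subseteq\mathcal S$ for all $i=1,\dots,n$. A closed subspace $\mathcal Q$ is a quotient module if $\mathcal Q^\perp$ is a submodule; it is doubly commuting if the compressions $C_{z_i}=P_{\mathcal Q}M_{z_i}|_{\mathcal Q}$ satisfy $C_{z_i}C_{z_j}^*=C_{z_j}^*C_{z_i}$ for all $1\le i<j\le n$ (no condition when $n=1$). A closed subspace $\mathcal S$ is a co-doubly commuting submodule if $\mathcal S^\perp\cong H^2(\mathbb D^n)/\mathcal S$ is a doubly commuting quotient module. A function $\Theta\in H^\infty(\mathbb D)$ (bounded and holomorphic on $\mathbb D$) is inner if its radial limits exist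 and have modulus $1$ almost everywhere on $\mathbb T$. For $\Theta_{i_j}\in H^\infty(\mathbb D)$ put $\tilde\Theta_{i_j}(z)=\Theta_{i_j}(z_{i_j})$, $z\in\mathbb D^n$. (1) Let $\mathcal Q\ne H^2(\mathbb D^n)$ be a quotient module of $H^2(\mathbb D^n)$. Then $\mathcal Q$ is doubly commuting if and only if there are an integer $m\in\{1,\dots,n\}$, indices $1\le i_1<\dots<i_m\le n$ and inner functions $\Theta_{i_1},\dots,\Theta_{i_m}\in H^\infty(\mathbb D)$ such that $$\mathcal Q^\perp=\tilde\Theta_{i_1}H^2(\mathbb D^n)+\dots+\tilde\Theta_{i_m}H^2(\mathbb D^n).$$ (2) Equivalently, a closed subspace $\mathcal S\ne\{0\}$ of $H^2(\mathbb D^n)$ is a co-doubly commuting submodule if and only if $$\mathcal S=\tilde\Theta_{i_1}H^2(\mathbb D^n)+\dots+\tilde\Theta_{i_m}H^2(\mathbb D^n)$$ for some $m\in\{1,\dots,n\}$, indices $1\le i_1<\dots<i_m\le n$ and inner functions $\Theta_{i_1},\dots,\Theta_{i_m}\in H^\infty(\mathbb D)$. (3) For all indices $1\le i_1<\dots<i_m\le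 n$ and inner functions $\Theta_{i_1},\dots,\Theta_{i_m}\in H^\infty(\mathbb D)$, the algebraic sum $\tilde\Theta_{i_1}H^2(\mathbb D^n)+\dots+\tilde\Theta_{i_m}H^2(\mathbb D^n)$ is a closed subspace of $H^2(\mathbb D^n)$. -/

import Mathlib

open MeasureTheory Filter Topology

noncomputable section

namespace Polydisc

/-- The normalized Lebesgue measure `dθ` on the torus `𝕋ⁿ`, with `𝕋` parametrized by `ℝ / ℤ`. -/
def torusMeasure (n : ℕ) : Measure (Fin n → UnitAddCircle) :=
  Measure.pi fun _ => AddCircle.haarAddCircle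

instance (n : ℕ) : IsProbabilityMeasure (torusMeasure n) := by
  unfold torusMeasure; infer_instance

instance (n : ℕ) : (torusMeasure n).IsAddHaarMeasure := by
  unfold torusMeasure; infer_instance

/-- The point `(ρ₁ e^{2πi x₁}, …, ρₙ e^{2πi xₙ})`. -/
def torusPoint {n : ℕ} (ρ : Fin n → ℝ) (x : Fin n → UnitAddCircle) : Fin n → ℂ :=
  fun i => ρ i * (AddCircle.toCircle (x i) : ℂ)

/-- The open unit polydisc `𝔻ⁿ`. -/
def polydisc (n : ℕ) : Set (Fin n → ℂ) := {z | ∀ i, ‖z i‖ < 1}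

lemma polydisc_eq_ball (n : ℕ) : polydisc n = Metric.ball 0 1 := by
  ext z; simp [polydisc, pi_norm_lt_iff]

lemma isOpen_polydisc (n : ℕ) : IsOpen (polydisc n) := by
  rw [polydisc_eq_ball]; exact Metric.isOpen_ball

lemma continuous_torusPoint {n : ℕ} (ρ : Fin n → ℝ) : Continuous (torusPoint ρ) := by
  unfold torusPoint
  refine continuous_pi fun i => continuous_const.mul ?_
  exact continuous_subtype_val.comp (AddCircle.continuous_toCircle.comp (continuous_apply i))

lemma norm_toCircle (t : UnitAddCircle) : ‖(AddCircle.toCircle t : ℂ)‖ = 1 := Circle.norm_coe _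

lemma torusPoint_mem {n : ℕ} {ρ : Fin n → ℝ} (h0 : ∀ i, 0 ≤ ρ i) (h1 : ∀ i, ρ i < 1)
    (x : Fin n → UnitAddCircle) : torusPoint ρ x ∈ polydisc n := by
  intro i
  simpa [torusPoint, abs_of_nonneg (h0 i), norm_toCircle] using h1 i

lemma continuous_comp_torusPoint {n : ℕ} {f : (Fin n → ℂ) → ℂ}
    (hf : ContinuousOn f (polydisc n)) {ρ : Fin n → ℝ} (h0 : ∀ i, 0 ≤ ρ i) (h1 : ∀ i, ρ i < 1) :
    Continuous fun x => f (torusPoint ρ x) :=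
  hf.comp_continuous (continuous_torusPoint ρ) (torusPoint_mem h0 h1)

lemma integrable_of_continuous {n : ℕ} {E : Type*} [NormedAddCommGroup E]
    {g : (Fin n → UnitAddCircle) → E} (hg : Continuous g) : Integrable g (torusMeasure n) := by
  exact hg.integrable_of_hasCompactSupport (HasCompactSupport.of_compactSpace g)

/-- Termwise integration of a one-variable Taylor series against `e^{-2πikt}`. -/
lemma integral_circle {g : ℂ → ℂ} (hg : DifferentiableOn ℂ g (Metric.ball 0 1)) {s : ℝ}
    (h0 : 0 ≤ s) (h1 : s < 1) (k : ℤ) :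
    ∫ t : UnitAddCircle, fourier (-k) t * g (s * (AddCircle.toCircle t : ℂ))
        ∂AddCircle.haarAddCircle =
      if 0 ≤ k then (s : ℂ) ^ k.toNat * ((k.toNat.factorial : ℂ)⁻¹ * iteratedDeriv k.toNat g 0)
      else 0 := by
  set a : ℕ → ℂ := fun m => (m.factorial : ℂ)⁻¹ * iteratedDeriv m g 0 with ha
  have hsum : ∀ z ∈ Metric.ball (0 : ℂ) 1, HasSum (fun m => z ^ m * a m) (g z) := by
    intro z hz
    have h := Complex.hasSum_taylorSeries_on_ball hg hz
    simp only [sub_zero, smul_eq_mul] at h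
    refine h.congr_fun fun m => ?_
    simp only [ha]; ring
  have hnorm : Summable fun m => s ^ m * ‖a m‖ := by
    have := (hsum s (by simpa [abs_of_nonneg h0] using h1)).summable.norm
    simpa [abs_of_nonneg h0] using this
  have hF : ∀ t : UnitAddCircle, fourier (-k) t * g (s * (AddCircle.toCircle t : ℂ)) =
      ∑' m : ℕ, ((s : ℂ) ^ m * a m) * fourier (m - k : ℤ) t := by
    intro t
    have h := (hsum (s * (AddCircle.toCircle t : ℂ))
      (by simpa [abs_of_nonneg h0, norm_toCircle] using h1)).mul_left (fourier (-k) t)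
    rw [← h.tsum_eq]
    congr 1
    ext m
    rw [sub_eq_add_neg, fourier_add, mul_pow]
    have : (fourier (m : ℤ) t : ℂ) = (AddCircle.toCircle t : ℂ) ^ m := by
      simp [fourier_apply, AddCircle.toCircle_nsmul]
    rw [this]; ring
  simp_rw [hF]
  have hint := hasSum_integral_of_summable_integral_norm (μ := AddCircle.haarAddCircle)
    (F := fun (m : ℕ) (t : UnitAddCircle) => ((s : ℂ) ^ m * a m) * fourier (m - k : ℤ) t)
    (fun m => Continuous.integrable_of_hasCompactSupport (by fun_prop)
      (HasCompactSupport.of_compactSpace _))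
    (by simpa [fourier_apply, abs_of_nonneg h0, Circle.norm_coe] using hnorm)
  rw [← hint.tsum_eq]
  have hI : ∀ j : ℤ, ∫ t : UnitAddCircle, fourier j t ∂AddCircle.haarAddCircle =
      if j = 0 then 1 else 0 := by
    intro j
    have := (orthonormal_iff_ite.mp (orthonormal_fourier (T := 1))) 0 j
    rw [ContinuousMap.inner_toLp] at this
    simpa [eq_comm] using this
  simp_rw [integral_const_mul, hI]
  split_ifs with hk
  · rw [tsum_eq_single k.toNat]
    · simp [Int.toNat_of_nonneg hk, ha]
    · intro m hm
      rw [if_neg (by omega), mul_zero]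
  · refine (tsum_congr fun m => ?_).trans tsum_zero
    rw [if_neg (by omega), mul_zero]

/-- The Fourier coefficients of the restriction of `f` to the torus of polyradius `ρ`. -/
def torusCoeff {n : ℕ} (f : (Fin n → ℂ) → ℂ) (ρ : Fin n → ℝ) (k : Fin n → ℤ) : ℂ :=
  ∫ x, UnitAddTorus.mFourier (-k) x * f (torusPoint ρ x) ∂torusMeasure n

lemma torusCoeff_eq {n : ℕ} {f : (Fin n → ℂ) → ℂ} (hf : DifferentiableOn ℂ f (polydisc n))
    {ρ : Fin n → ℝ} (h0 : ∀ i, 0 ≤ ρ i) (h1 : ∀ i, ρ i < 1) (k : Fin n → ℤ) (i : Fin n) :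
    ∃ A : ℂ, ∀ s : ℝ, 0 ≤ s → s < 1 → torusCoeff f (Function.update ρ i s) k =
      if 0 ≤ k i then (s : ℂ) ^ (k i).toNat * A else 0 := by
  set g : (Fin n → UnitAddCircle) → ℂ → ℂ := fun x w =>
    f (Function.update (torusPoint ρ x) i (w * (AddCircle.toCircle (x i) : ℂ))) with hg
  refine ⟨∫ x, UnitAddTorus.mFourier (-k) x *
    (((k i).toNat.factorial : ℂ)⁻¹ * iteratedDeriv (k i).toNat (g x) 0) ∂torusMeasure n, ?_⟩
  intro s hs0 hs1
  have hgd : ∀ x, DifferentiableOn ℂ (g x) (Metric.ball 0 1) := by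
    intro x
    refine hf.comp (t := polydisc n) ?_ ?_
    · apply Differentiable.differentiableOn
      rw [differentiable_pi]
      intro j
      by_cases hj : j = i
      · subst hj; simp
      · simp [Function.update_of_ne hj]
    · intro w hw j
      by_cases hj : j = i
      · subst hj; simpa [norm_toCircle] using hw
      · simpa [Function.update_of_ne hj] using torusPoint_mem h0 h1 x j
  have hr0 : ∀ j, 0 ≤ Function.update ρ i s j := by
    intro j; by_cases hj : j = i
    · subst hj; simpa using hs0
    · simpa [Function.update_of_ne hj] using h0 j
  have hr1 : ∀ j, Function.update ρ i s j < 1 := by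
    intro j; by_cases hj : j = i
    · subst hj; simpa using hs1
    · simpa [Function.update_of_ne hj] using h1 j
  set G : (Fin n → UnitAddCircle) → ℂ := fun x =>
    UnitAddTorus.mFourier (-k) x * f (torusPoint (Function.update ρ i s) x) with hG
  have hGc : Continuous G :=
    (UnitAddTorus.mFourier (-k)).continuous.mul (continuous_comp_torusPoint hf.continuousOn hr0 hr1)
  have hshift : ∀ (x : Fin n → UnitAddCircle) (t : UnitAddCircle), G (x + Pi.single i t) =
      UnitAddTorus.mFourier (-k) x * (fourier (-(k i)) t * g x (s * (AddCircle.toCircle t : ℂ))) := by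
    intro x t
    have e1 : UnitAddTorus.mFourier (-k) (x + Pi.single i t) =
        UnitAddTorus.mFourier (-k) x * fourier (-(k i)) t := by
      simp only [UnitAddTorus.mFourier, ContinuousMap.coe_mk]
      rw [← Finset.mul_prod_erase _ _ (Finset.mem_univ i), ← Finset.mul_prod_erase Finset.univ
        (fun j => (fourier ((-k) j) (x j) : ℂ)) (Finset.mem_univ i)]
      have : ∀ j ∈ Finset.univ.erase i,
          (fourier ((-k) j) ((x + Pi.single i t : Fin n → UnitAddCircle) j) : ℂ) =
          fourier ((-k) j) (x j) := by
        intro j hj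
        simp [Pi.single_eq_of_ne (Finset.ne_of_mem_erase hj)]
      rw [Finset.prod_congr rfl this]
      simp [fourier_apply, smul_add, AddCircle.toCircle_add]
      ring
    have e2 : torusPoint (Function.update ρ i s) (x + Pi.single i t) =
        Function.update (torusPoint ρ x) i
          (s * (AddCircle.toCircle t : ℂ) * (AddCircle.toCircle (x i) : ℂ)) := by
      ext j
      by_cases hj : j = i
      · subst hj; simp [torusPoint, AddCircle.toCircle_add]; ring
      · simp [torusPoint, Function.update_of_ne hj, Pi.single_eq_of_ne hj]
    simp only [hG, hg]
    rw [e1, e2]; ring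
  have key : torusCoeff f (Function.update ρ i s) k =
      ∫ x, ∫ t, G (x + Pi.single i t) ∂AddCircle.haarAddCircle ∂torusMeasure n := by
    have hswap : ∫ x, ∫ t : UnitAddCircle, G (x + Pi.single i t) ∂AddCircle.haarAddCircle
          ∂torusMeasure n =
        ∫ t : UnitAddCircle, ∫ x, G (x + Pi.single i t) ∂torusMeasure n
          ∂AddCircle.haarAddCircle := by
      apply integral_integral_swap
      apply Continuous.integrable_of_hasCompactSupport
      · apply hGc.comp
        apply continuous_fst.add
        exact (continuous_single i).comp continuous_snd
      · exact HasCompactSupport.of_compactSpace _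
    rw [hswap]
    simp_rw [integral_add_right_eq_self (μ := torusMeasure n) G]
    simp [torusCoeff, hG]
  rw [key]
  simp_rw [hshift, integral_const_mul, integral_circle (hgd _) hs0 hs1]
  split_ifs with hk
  · rw [← integral_const_mul]
    congr 1; ext x; ring
  · simp

lemma torusCoeff_eq_zero {n : ℕ} {f : (Fin n → ℂ) → ℂ} (hf : DifferentiableOn ℂ f (polydisc n))
    {ρ : Fin n → ℝ} (h0 : ∀ i, 0 ≤ ρ i) (h1 : ∀ i, ρ i < 1) {k : Fin n → ℤ} {i : Fin n}
    (hk : k i < 0) : torusCoeff f ρ k = 0 := by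
  obtain ⟨A, hA⟩ := torusCoeff_eq hf h0 h1 k i
  have := hA (ρ i) (h0 i) (h1 i)
  rwa [Function.update_eq_self, if_neg (by omega)] at this

lemma torusCoeff_scale {n : ℕ} {f : (Fin n → ℂ) → ℂ} (hf : DifferentiableOn ℂ f (polydisc n))
    {ρ σ : Fin n → ℝ} (h0 : ∀ i, 0 ≤ ρ i) (h1 : ∀ i, ρ i < 1) (h0' : ∀ i, 0 ≤ σ i)
    (h1' : ∀ i, σ i < 1) (k : Fin n → ℕ) :
    torusCoeff f σ (fun i => (k i : ℤ)) * ∏ i, (ρ i : ℂ) ^ k i =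
      torusCoeff f ρ (fun i => (k i : ℤ)) * ∏ i, (σ i : ℂ) ^ k i := by
  suffices H : ∀ S : Finset (Fin n),
      torusCoeff f (S.piecewise σ ρ) (fun i => (k i : ℤ)) * ∏ i ∈ S, (ρ i : ℂ) ^ k i =
      torusCoeff f ρ (fun i => (k i : ℤ)) * ∏ i ∈ S, (σ i : ℂ) ^ k i by
    simpa using H Finset.univ
  intro S
  induction S using Finset.induction_on with
  | empty => simp
  | insert i S hi ih =>
    have p0 : ∀ j, 0 ≤ S.piecewise σ ρ j := fun j => by
      by_cases hj : j ∈ S <;> simp [hj, h0, h0']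
    have p1 : ∀ j, S.piecewise σ ρ j < 1 := fun j => by
      by_cases hj : j ∈ S <;> simp [hj, h1, h1']
    obtain ⟨A, hA⟩ := torusCoeff_eq hf p0 p1 (fun i => (k i : ℤ)) i
    have e1 := hA (σ i) (h0' i) (h1' i)
    have e2 := hA (ρ i) (h0 i) (h1 i)
    rw [← Finset.piecewise_insert] at e1
    have : Function.update (S.piecewise σ ρ) i (ρ i) = S.piecewise σ ρ := by
      rw [Function.update_eq_self_iff]; simp [hi]
    rw [this] at e2
    simp only [Int.natCast_nonneg, if_true, Int.toNat_natCast] at e1 e2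
    rw [Finset.prod_insert hi, Finset.prod_insert hi, e1]
    rw [e2] at ih
    linear_combination (σ i : ℂ) ^ k i * ih

/-- The coefficient of `z ^ k` in the Taylor series of `f` at `0`. -/
def taylorCoeff {n : ℕ} (f : (Fin n → ℂ) → ℂ) (k : Fin n → ℕ) : ℂ :=
  torusCoeff f (fun _ => 1 / 2) (fun i => (k i : ℤ)) * ∏ i, (2 : ℂ) ^ k i

lemma torusCoeff_natCast {n : ℕ} {f : (Fin n → ℂ) → ℂ} (hf : DifferentiableOn ℂ f (polydisc n))
    {ρ : Fin n → ℝ} (h0 : ∀ i, 0 ≤ ρ i) (h1 : ∀ i, ρ i < 1) (k : Fin n → ℕ) :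
    torusCoeff f ρ (fun i => (k i : ℤ)) = taylorCoeff f k * ∏ i, (ρ i : ℂ) ^ k i := by
  have h := torusCoeff_scale hf (ρ := fun _ => 1 / 2) (σ := ρ) (fun _ => by norm_num)
    (fun _ => by norm_num) h0 h1 k
  have h2 : (∏ i, (((1 / 2 : ℝ) : ℂ)) ^ k i) * ∏ i, (2 : ℂ) ^ k i = 1 := by
    rw [← Finset.prod_mul_distrib]
    refine Finset.prod_eq_one fun i _ => ?_
    rw [← mul_pow]; norm_num
  rw [taylorCoeff]
  linear_combination (∏ i, (2 : ℂ) ^ k i) * h - torusCoeff f ρ (fun i => (k i : ℤ)) * h2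

lemma summable_monomial {n : ℕ} {x : Fin n → ℝ} (h0 : ∀ i, 0 ≤ x i) (h1 : ∀ i, x i < 1) :
    Summable fun k : Fin n → ℕ => ∏ i, x i ^ k i := by
  induction n with
  | zero => exact Summable.of_finite
  | succ n ih =>
    rw [← (Fin.consEquiv fun _ : Fin (n + 1) => ℕ).summable_iff]
    have := (summable_geometric_of_lt_one (h0 0) (h1 0)).mul_of_nonneg
      (ih (fun i => h0 i.succ) (fun i => h1 i.succ)) (fun m => pow_nonneg (h0 0) m)
      (fun k => Finset.prod_nonneg fun i _ => pow_nonneg (h0 _) _)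
    refine this.congr fun p => ?_
    simp [Fin.prod_univ_succ, Fin.consEquiv]

lemma norm_taylorCoeff_le {n : ℕ} {f : (Fin n → ℂ) → ℂ} (hf : DifferentiableOn ℂ f (polydisc n))
    {R : ℝ} (h0 : 0 ≤ R) (h1 : R < 1) :
    ∃ M, ∀ k, ‖taylorCoeff f k‖ * ∏ i, R ^ k i ≤ M := by
  refine ⟨∫ x, ‖f (torusPoint (fun _ => R) x)‖ ∂torusMeasure n, fun k => ?_⟩
  have h := torusCoeff_natCast hf (ρ := fun _ => R) (fun _ => h0) (fun _ => h1) k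
  have h' := congrArg norm h
  simp only [norm_mul, norm_prod, norm_pow, Complex.norm_real, Real.norm_eq_abs,
    abs_of_nonneg h0] at h'
  rw [← h', torusCoeff]
  refine (norm_integral_le_integral_norm _).trans (le_of_eq ?_)
  congr 1; ext x
  rw [norm_mul]
  simp [UnitAddTorus.mFourier, fourier_apply, Circle.norm_coe, norm_prod]

lemma exists_radius {n : ℕ} {ρ : Fin n → ℝ} (h1 : ∀ i, ρ i < 1) :
    ∃ R : ℝ, 0 < R ∧ R < 1 ∧ ∀ i, ρ i < R := by
  have : ∀ᶠ R in 𝓝[<] (1 : ℝ), 0 < R ∧ R < 1 ∧ ∀ i, ρ i < R := by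
    refine (eventually_nhdsWithin_of_eventually_nhds (lt_mem_nhds one_pos)).and
      (eventually_mem_nhdsWithin.and ?_)
    rw [eventually_all]
    exact fun i => eventually_nhdsWithin_of_eventually_nhds (lt_mem_nhds (h1 i))
  exact this.exists

lemma summable_of_bound {n : ℕ} {a : (Fin n → ℕ) → ℂ} {M R : ℝ} (hR : 0 < R)
    (ha : ∀ k, ‖a k‖ * ∏ i, R ^ k i ≤ M) {ρ : Fin n → ℝ} (h0 : ∀ i, 0 ≤ ρ i)
    (h1 : ∀ i, ρ i < R) : Summable fun k => ‖a k‖ * ∏ i, ρ i ^ k i := by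
  have hs := (summable_monomial (x := fun i => ρ i / R) (fun i => div_nonneg (h0 i) hR.le)
    (fun i => (div_lt_one hR).2 (h1 i))).mul_left M
  refine Summable.of_nonneg_of_le (fun k => mul_nonneg (norm_nonneg _)
    (Finset.prod_nonneg fun i _ => pow_nonneg (h0 _) _)) (fun k => ?_) hs
  have : ∏ i, ρ i ^ k i = (∏ i, R ^ k i) * ∏ i, (ρ i / R) ^ k i := by
    rw [← Finset.prod_mul_distrib]
    refine Finset.prod_congr rfl fun i _ => ?_
    rw [← mul_pow, mul_div_cancel₀ _ hR.ne']
  rw [this, ← mul_assoc]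
  exact mul_le_mul_of_nonneg_right (ha k)
    (Finset.prod_nonneg fun i _ => pow_nonneg (div_nonneg (h0 i) hR.le) _)

lemma mFourier_natCast {n : ℕ} (k : Fin n → ℕ) (x : Fin n → UnitAddCircle) :
    UnitAddTorus.mFourier (fun i => (k i : ℤ)) x = ∏ i, (AddCircle.toCircle (x i) : ℂ) ^ k i := by
  simp [UnitAddTorus.mFourier, fourier_apply, AddCircle.toCircle_nsmul]

lemma prod_torusPoint {n : ℕ} (ρ : Fin n → ℝ) (x : Fin n → UnitAddCircle) (k : Fin n → ℕ) :
    ∏ i, torusPoint ρ x i ^ k i =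
      (∏ i, (ρ i : ℂ) ^ k i) * UnitAddTorus.mFourier (fun i => (k i : ℤ)) x := by
  rw [mFourier_natCast, ← Finset.prod_mul_distrib]
  simp [torusPoint, mul_pow]

lemma exists_torusPoint {n : ℕ} (z : Fin n → ℂ) :
    ∃ x, torusPoint (fun i => ‖z i‖) x = z := by
  refine ⟨fun i => ((Complex.arg (z i) / (2 * Real.pi) : ℝ) : UnitAddCircle), ?_⟩
  funext i
  simp only [torusPoint, AddCircle.toCircle_apply_mk, Circle.coe_exp]
  have : ((2 * Real.pi / 1 * (Complex.arg (z i) / (2 * Real.pi)) : ℝ) : ℂ) = Complex.arg (z i) := by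
    congr 1; field_simp
  rw [this, Complex.norm_mul_exp_arg_mul_I]

lemma natCast_injective (n : ℕ) :
    Function.Injective fun (k : Fin n → ℕ) (i : Fin n) => (k i : ℤ) := fun k l h => by
  funext i; simpa using congrFun h i

lemma not_mem_range_natCast {n : ℕ} {k : Fin n → ℤ}
    (hk : k ∉ Set.range fun (k : Fin n → ℕ) (i : Fin n) => (k i : ℤ)) : ∃ i, k i < 0 := by
  by_contra! h
  exact hk ⟨fun i => (k i).toNat, by funext i; simp [h i]⟩

/-- The restriction of `f` to a torus inside the polydisc, as a continuous function. -/
def torusRestrict {n : ℕ} {f : (Fin n → ℂ) → ℂ} (hf : DifferentiableOn ℂ f (polydisc n))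
    {ρ : Fin n → ℝ} (h0 : ∀ i, 0 ≤ ρ i) (h1 : ∀ i, ρ i < 1) : C(UnitAddTorus (Fin n), ℂ) :=
  ⟨fun x => f (torusPoint ρ x), continuous_comp_torusPoint hf.continuousOn h0 h1⟩

lemma mFourierCoeff_torusRestrict {n : ℕ} {f : (Fin n → ℂ) → ℂ}
    (hf : DifferentiableOn ℂ f (polydisc n)) {ρ : Fin n → ℝ} (h0 : ∀ i, 0 ≤ ρ i)
    (h1 : ∀ i, ρ i < 1) (k : Fin n → ℤ) :
    UnitAddTorus.mFourierCoeff (torusRestrict hf h0 h1) k = torusCoeff f ρ k := rfl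

lemma hasSum_taylor {n : ℕ} {f : (Fin n → ℂ) → ℂ} (hf : DifferentiableOn ℂ f (polydisc n))
    {z : Fin n → ℂ} (hz : z ∈ polydisc n) :
    HasSum (fun k : Fin n → ℕ => taylorCoeff f k * ∏ i, z i ^ k i) (f z) := by
  obtain ⟨x, hx⟩ := exists_torusPoint z
  set ρ : Fin n → ℝ := fun i => ‖z i‖ with hρ
  have h0 : ∀ i, 0 ≤ ρ i := fun i => norm_nonneg _
  have h1 : ∀ i, ρ i < 1 := hz
  have hzero : ∀ k ∉ Set.range fun (k : Fin n → ℕ) (i : Fin n) => (k i : ℤ),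
      torusCoeff f ρ k = 0 := fun k hk => by
    obtain ⟨i, hi⟩ := not_mem_range_natCast hk
    exact torusCoeff_eq_zero hf h0 h1 hi
  have hs : Summable (UnitAddTorus.mFourierCoeff (torusRestrict hf h0 h1)) := by
    have e : UnitAddTorus.mFourierCoeff (torusRestrict hf h0 h1) = torusCoeff f ρ := rfl
    rw [e, ← (natCast_injective n).summable_iff hzero]
    obtain ⟨R, hR0, hR1, hρR⟩ := exists_radius h1
    obtain ⟨M, hM⟩ := norm_taylorCoeff_le hf hR0.le hR1
    refine Summable.of_norm ((summable_of_bound hR0 hM h0 hρR).congr fun k => ?_)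
    simp only [Function.comp, torusCoeff_natCast hf h0 h1, norm_mul, norm_prod, norm_pow,
      Complex.norm_real, Real.norm_eq_abs, abs_of_nonneg (h0 _)]
  have h := UnitAddTorus.hasSum_mFourier_series_apply_of_summable hs x
  have hfz : torusRestrict hf h0 h1 x = f z := congrArg f hx
  rw [hfz, ← (natCast_injective n).hasSum_iff] at h
  · refine h.congr_fun fun k => ?_
    simp only [Function.comp, mFourierCoeff_torusRestrict, torusCoeff_natCast hf h0 h1, smul_eq_mul]
    rw [← hx, prod_torusPoint, mul_assoc]
  · intro k hk
    rw [mFourierCoeff_torusRestrict, hzero k hk, zero_smul]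

lemma parseval {n : ℕ} {f : (Fin n → ℂ) → ℂ} (hf : DifferentiableOn ℂ f (polydisc n))
    {ρ : Fin n → ℝ} (h0 : ∀ i, 0 ≤ ρ i) (h1 : ∀ i, ρ i < 1) :
    HasSum (fun k : Fin n → ℕ => (‖taylorCoeff f k‖ * ∏ i, ρ i ^ k i) ^ 2)
      (∫ x, ‖f (torusPoint ρ x)‖ ^ 2 ∂torusMeasure n) := by
  have e : ∀ k, UnitAddTorus.mFourierCoeff
      (ContinuousMap.toLp 2 (torusMeasure n) ℂ (torusRestrict hf h0 h1)) k = torusCoeff f ρ k :=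
    fun k => UnitAddTorus.mFourierCoeff_toLp (torusRestrict hf h0 h1) k
  have h : HasSum (fun k => ‖torusCoeff f ρ k‖ ^ 2)
      (∫ x, ‖ContinuousMap.toLp 2 (torusMeasure n) ℂ (torusRestrict hf h0 h1) x‖ ^ 2
        ∂torusMeasure n) :=
    (UnitAddTorus.hasSum_sq_mFourierCoeff
      (ContinuousMap.toLp 2 (torusMeasure n) ℂ (torusRestrict hf h0 h1))).congr_fun
      fun k => congrArg (fun c : ℂ => ‖c‖ ^ 2) (e k).symm
  have e2 : ∫ x, ‖f (torusPoint ρ x)‖ ^ 2 ∂torusMeasure n =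
      ∫ x, ‖ContinuousMap.toLp 2 (torusMeasure n) ℂ (torusRestrict hf h0 h1) x‖ ^ 2
        ∂torusMeasure n := by
    apply integral_congr_ae
    filter_upwards [ContinuousMap.coeFn_toLp (p := 2) (𝕜 := ℂ) (torusMeasure n)
      (torusRestrict hf h0 h1)] with x hx
    rw [hx]; rfl
  rw [e2]
  replace h := (natCast_injective n).hasSum_iff (f := fun k => ‖torusCoeff f ρ k‖ ^ 2) (fun k hk => by
    obtain ⟨i, hi⟩ := not_mem_range_natCast hk
    simp [torusCoeff_eq_zero hf h0 h1 hi]) |>.2 h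
  refine h.congr_fun fun k => ?_
  simp only [Function.comp, torusCoeff_natCast hf h0 h1, norm_mul, norm_prod, norm_pow,
    Complex.norm_real, Real.norm_eq_abs, abs_of_nonneg (h0 _)]

/-- The function `z ↦ ∑ a_k z^k`. -/
def powerSum {n : ℕ} (a : (Fin n → ℕ) → ℂ) (z : Fin n → ℂ) : ℂ := ∑' k, a k * ∏ i, z i ^ k i

lemma differentiableOn_powerSum {n : ℕ} {a : (Fin n → ℕ) → ℂ} {M : ℝ} (ha : ∀ k, ‖a k‖ ≤ M) :
    DifferentiableOn ℂ (powerSum a) (polydisc n) := by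
  intro z hz
  obtain ⟨R, hR0, hR1, hzR⟩ := exists_radius (ρ := fun i => ‖z i‖) hz
  obtain ⟨R', hR'0, hR'1⟩ := exists_between hR1
  have hM : 0 ≤ M := (norm_nonneg _).trans (ha 0)
  have hd : ∀ k, Differentiable ℂ fun w : Fin n → ℂ => a k * ∏ i, w i ^ k i := by
    intro k; fun_prop
  have hbd : ∀ k : Fin n → ℕ, ∀ w ∈ Metric.ball (0 : Fin n → ℂ) R',
      ‖a k * ∏ i, w i ^ k i‖ ≤ M * ∏ i, R' ^ k i := by
    intro k w hw
    rw [norm_mul, norm_prod]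
    refine mul_le_mul (ha k) ?_ (Finset.prod_nonneg fun _ _ => norm_nonneg _) hM
    refine Finset.prod_le_prod (fun _ _ => norm_nonneg _) fun i _ => ?_
    rw [norm_pow]
    refine pow_le_pow_left₀ (norm_nonneg _) ?_ _
    exact (norm_le_pi_norm w i).trans (mem_ball_zero_iff.1 hw).le
  have hsum : Summable fun k : Fin n → ℕ => ∏ i, R' ^ k i :=
    summable_monomial (x := fun _ => R') (fun _ => (hR0.trans hR'0).le) (fun _ => hR'1)
  have hzb : z ∈ Metric.ball (0 : Fin n → ℂ) R := by
    rw [mem_ball_zero_iff, pi_norm_lt_iff hR0]; exact hzR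
  have hderiv := hasFDerivAt_tsum_of_isPreconnected (𝕜 := ℂ)
    (f := fun (k : Fin n → ℕ) (w : Fin n → ℂ) => a k * ∏ i, w i ^ k i)
    (f' := fun k w => fderiv ℂ (fun w : Fin n → ℂ => a k * ∏ i, w i ^ k i) w)
    (u := fun k => 2 * (M * ∏ i, R' ^ k i) / (R' - R)) (s := Metric.ball 0 R)
    (x₀ := z) (x := z)
    (((hsum.mul_left M).mul_left 2).div_const _) Metric.isOpen_ball
    (convex_ball 0 R).isPreconnected (fun k w _ => (hd k w).hasFDerivAt) ?_ hzb ?_ hzb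
  · exact hderiv.differentiableAt.differentiableWithinAt
  · intro k w hw
    have hsub : Metric.ball w (R' - R) ⊆ Metric.ball 0 R' :=
      Metric.ball_subset_ball' (by rw [mem_ball_iff_norm, sub_zero] at hw
                                   rw [dist_zero_right]; linarith)
    refine Complex.norm_fderiv_le_div_of_mapsTo_ball (hd k).differentiableOn ?_ (by linarith)
    intro v hv
    rw [mem_closedBall_iff_norm]
    refine (norm_sub_le _ _).trans ?_
    have := hbd k v (hsub hv)
    have := hbd k w (hsub (Metric.mem_ball_self (by linarith)))
    linarith
  · refine Summable.of_norm_bounded (hsum.mul_left M) fun k => ?_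
    exact hbd k z (Metric.ball_subset_ball hR'0.le hzb)

lemma taylorCoeff_powerSum {n : ℕ} {a : (Fin n → ℕ) → ℂ} {M : ℝ} (ha : ∀ k, ‖a k‖ ≤ M)
    (k : Fin n → ℕ) : taylorCoeff (powerSum a) k = a k := by
  have hI : ∀ j : Fin n → ℤ, ∫ x, UnitAddTorus.mFourier j x ∂torusMeasure n =
      if j = 0 then 1 else 0 := by
    intro j
    have := (orthonormal_iff_ite.mp (UnitAddTorus.orthonormal_mFourier (d := Fin n))) 0 j
    rw [ContinuousMap.inner_toLp] at this
    simp only [UnitAddTorus.mFourier_zero, ContinuousMap.one_apply, map_one, mul_one] at this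
    refine Eq.trans this ?_
    simp only [eq_comm]
  have hs : Summable fun l : Fin n → ℕ => ‖a l‖ * ∏ i, (1 / 2 : ℝ) ^ l i :=
    summable_of_bound (M := M) one_pos (by simpa using ha) (fun _ => by norm_num)
      (fun _ => by norm_num)
  have hF : ∀ x, UnitAddTorus.mFourier (-fun i => (k i : ℤ)) x *
      powerSum a (torusPoint (fun _ => 1 / 2) x) =
      ∑' l : Fin n → ℕ, (a l * ∏ i, ((1 / 2 : ℝ) : ℂ) ^ l i) *
        UnitAddTorus.mFourier ((fun i => (l i : ℤ)) + -fun i => (k i : ℤ)) x := by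
    intro x
    rw [powerSum, ← tsum_mul_left]
    refine tsum_congr fun l => ?_
    rw [prod_torusPoint, UnitAddTorus.mFourier_add]
    ring
  rw [taylorCoeff, torusCoeff]
  simp_rw [hF]
  have hint := hasSum_integral_of_summable_integral_norm (μ := torusMeasure n)
    (F := fun (l : Fin n → ℕ) x => (a l * ∏ i, ((1 / 2 : ℝ) : ℂ) ^ l i) *
        UnitAddTorus.mFourier ((fun i => (l i : ℤ)) + -fun i => (k i : ℤ)) x)
    (fun l => integrable_of_continuous
      (continuous_const.mul (UnitAddTorus.mFourier _).continuous)) (by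
      refine hs.congr fun l => ?_
      have : ∀ x, ‖(a l * ∏ i, ((1 / 2 : ℝ) : ℂ) ^ l i) *
        UnitAddTorus.mFourier ((fun i => (l i : ℤ)) + -fun i => (k i : ℤ)) x‖ =
          ‖a l‖ * ∏ i, (1 / 2 : ℝ) ^ l i := by
        intro x
        rw [norm_mul, norm_mul, norm_prod]
        simp [UnitAddTorus.mFourier, fourier_apply, Circle.norm_coe, norm_prod]
      simp_rw [this]
      simp)
  rw [← hint.tsum_eq]
  simp_rw [integral_const_mul, hI]
  rw [tsum_eq_single k]
  · rw [if_pos (by simp), mul_one, mul_assoc, ← Finset.prod_mul_distrib]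
    rw [Finset.prod_eq_one, mul_one]
    intro i _
    rw [← mul_pow]; norm_num
  · intro l hl
    rw [if_neg, mul_zero]
    intro h
    exact hl (natCast_injective n (by simpa [← sub_eq_add_neg, sub_eq_zero] using h))


open Classical in
/-- The extension by zero to the ambient space of a function on a set `U`. -/
def zeroExt {E : Type*} {U : Set E} (f : U → ℂ) (z : E) : ℂ := if h : z ∈ U then f ⟨z, h⟩ else 0

lemma zeroExt_of_mem {E : Type*} {U : Set E} (f : U → ℂ) {z : E} (h : z ∈ U) :
    zeroExt f z = f ⟨z, h⟩ := by simp [zeroExt, h]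

lemma zeroExt_add {E : Type*} {U : Set E} (f g : U → ℂ) : zeroExt (f + g) = zeroExt f + zeroExt g := by
  funext z; by_cases h : z ∈ U <;> simp [zeroExt, h]

lemma zeroExt_mul {E : Type*} {U : Set E} (f g : U → ℂ) : zeroExt (f * g) = zeroExt f * zeroExt g := by
  funext z; by_cases h : z ∈ U <;> simp [zeroExt, h]

lemma zeroExt_smul {E : Type*} {U : Set E} (c : ℂ) (f : U → ℂ) :
    zeroExt (c • f) = c • zeroExt f := by
  funext z; by_cases h : z ∈ U <;> simp [zeroExt, h]

lemma zeroExt_zero {E : Type*} {U : Set E} : zeroExt (0 : U → ℂ) = 0 := by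
  funext z; by_cases h : z ∈ U <;> simp [zeroExt, h]

/-- Holomorphy of a function on an open subset `U` of a complex normed space. -/
def IsHolomorphic {E : Type*} [NormedAddCommGroup E] [NormedSpace ℂ E] {U : Set E} (f : U → ℂ) :
    Prop :=
  DifferentiableOn ℂ (zeroExt f) U

/-- The integral mean `∫_{𝕋ⁿ} |f(r z)|² dθ`. -/
def integralMean {n : ℕ} (f : polydisc n → ℂ) (r : ℝ) : ℝ :=
  ∫ x, ‖zeroExt f (torusPoint (fun _ => r) x)‖ ^ 2 ∂torusMeasure n

lemma integrable_mean {n : ℕ} {f : polydisc n → ℂ} (hf : IsHolomorphic f) (r : Set.Ico (0 : ℝ) 1) :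
    Integrable (fun x => ‖zeroExt f (torusPoint (fun _ => (r : ℝ)) x)‖ ^ 2) (torusMeasure n) :=
  integrable_of_continuous
    ((continuous_comp_torusPoint hf.continuousOn (fun _ => r.2.1) (fun _ => r.2.2)).norm.pow 2)

/-- The vector space underlying `H²(𝔻ⁿ)`: holomorphic functions on the polydisc whose integral
means of order two over the tori of radius `0 ≤ r < 1` are bounded. -/
def hardySubmodule (n : ℕ) : Submodule ℂ (polydisc n → ℂ) where
  carrier := {f | IsHolomorphic f ∧
    BddAbove (Set.range fun r : Set.Ico (0 : ℝ) 1 => integralMean f r)}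
  zero_mem' := by
    refine ⟨?_, 0, ?_⟩
    · rw [IsHolomorphic, zeroExt_zero]; exact differentiableOn_const (0 : ℂ)
    · rintro _ ⟨r, rfl⟩
      simp [integralMean, zeroExt_zero]
  add_mem' := by
    rintro f g ⟨hf, A, hA⟩ ⟨hg, B, hB⟩
    refine ⟨?_, 2 * A + 2 * B, ?_⟩
    · simpa only [IsHolomorphic, zeroExt_add] using hf.add hg
    · rintro _ ⟨r, rfl⟩
      have h1 := hA ⟨r, rfl⟩
      have h2 := hB ⟨r, rfl⟩
      have h3 : integralMean (f + g) r ≤ 2 * integralMean f r + 2 * integralMean g r := by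
        simp only [integralMean, zeroExt_add]
        rw [← integral_const_mul, ← integral_const_mul, ← integral_add
          ((integrable_mean hf r).const_mul 2) ((integrable_mean hg r).const_mul 2)]
        refine integral_mono_of_nonneg (Eventually.of_forall fun x => by positivity)
          (((integrable_mean hf r).const_mul 2).add ((integrable_mean hg r).const_mul 2))
          (Eventually.of_forall fun x => ?_)
        have := norm_add_le (zeroExt f (torusPoint (fun _ => (r : ℝ)) x))
          (zeroExt g (torusPoint (fun _ => (r : ℝ)) x))
        simp only [Pi.add_apply]
        nlinarith [sq_nonneg (‖zeroExt f (torusPoint (fun _ => (r : ℝ)) x)‖ -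
          ‖zeroExt g (torusPoint (fun _ => (r : ℝ)) x)‖), norm_nonneg
          (zeroExt f (torusPoint (fun _ => (r : ℝ)) x) +
            zeroExt g (torusPoint (fun _ => (r : ℝ)) x))]
      simp only at h1 h2 ⊢
      linarith
  smul_mem' := by
    rintro c f ⟨hf, A, hA⟩
    refine ⟨?_, ‖c‖ ^ 2 * A, ?_⟩
    · simpa only [IsHolomorphic, zeroExt_smul] using hf.const_smul c
    · rintro _ ⟨r, rfl⟩
      have h1 := hA ⟨r, rfl⟩
      have h3 : integralMean (c • f) r = ‖c‖ ^ 2 * integralMean f r := by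
        simp only [integralMean, zeroExt_smul, Pi.smul_apply, norm_smul, mul_pow]
        rw [integral_const_mul]
      simp only at h1 ⊢
      rw [h3]
      exact mul_le_mul_of_nonneg_left h1 (by positivity)

lemma sum_sq_taylorCoeff_le {n : ℕ} {f : polydisc n → ℂ} (hf : IsHolomorphic f) {C : ℝ}
    (hC : ∀ r : Set.Ico (0 : ℝ) 1, integralMean f r ≤ C) (S : Finset (Fin n → ℕ)) :
    ∑ k ∈ S, ‖taylorCoeff (zeroExt f) k‖ ^ 2 ≤ C := by
  have hlim : Tendsto (fun r : ℝ => ∑ k ∈ S, (‖taylorCoeff (zeroExt f) k‖ * ∏ i, r ^ k i) ^ 2)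
      (𝓝[<] 1) (𝓝 (∑ k ∈ S, ‖taylorCoeff (zeroExt f) k‖ ^ 2)) := by
    have : Continuous fun r : ℝ =>
        ∑ k ∈ S, (‖taylorCoeff (zeroExt f) k‖ * ∏ i, r ^ k i) ^ 2 := by fun_prop
    simpa using (this.tendsto 1).mono_left nhdsWithin_le_nhds
  refine le_of_tendsto hlim ?_
  filter_upwards [Ico_mem_nhdsLT (zero_lt_one (α := ℝ))] with r hr
  exact (sum_le_hasSum S (fun k _ => sq_nonneg _)
    (parseval hf (fun _ => hr.1) (fun _ => hr.2))).trans (hC ⟨r, hr⟩)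

lemma integralMean_le_tsum {n : ℕ} {f : polydisc n → ℂ} (hf : IsHolomorphic f)
    (hs : Summable fun k => ‖taylorCoeff (zeroExt f) k‖ ^ 2) (r : Set.Ico (0 : ℝ) 1) :
    integralMean f r ≤ ∑' k, ‖taylorCoeff (zeroExt f) k‖ ^ 2 := by
  refine hasSum_le (fun k => ?_) (parseval hf (fun _ => r.2.1) (fun _ => r.2.2)) hs.hasSum
  refine pow_le_pow_left₀ (mul_nonneg (norm_nonneg _)
    (Finset.prod_nonneg fun i _ => pow_nonneg r.2.1 _)) ?_ 2
  exact mul_le_of_le_one_right (norm_nonneg _)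
    (Finset.prod_le_one (fun i _ => pow_nonneg r.2.1 _) fun i _ => pow_le_one₀ r.2.1 r.2.2.le)

/-- The Hardy space `H²(𝔻ⁿ)`. -/
def HardySpace (n : ℕ) : Type := hardySubmodule n

namespace HardySpace

variable {n : ℕ}

instance : AddCommGroup (HardySpace n) := inferInstanceAs (AddCommGroup (hardySubmodule n))

instance : Module ℂ (HardySpace n) := inferInstanceAs (Module ℂ (hardySubmodule n))

/-- An element of `H²(𝔻ⁿ)` as a function on the polydisc. -/
def toFun : HardySpace n →ₗ[ℂ] polydisc n → ℂ := (hardySubmodule n).subtype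

instance : CoeFun (HardySpace n) fun _ => polydisc n → ℂ := ⟨fun f => toFun f⟩

lemma isHolomorphic (f : HardySpace n) : IsHolomorphic f := f.2.1

lemma bddAbove (f : HardySpace n) :
    BddAbove (Set.range fun r : Set.Ico (0 : ℝ) 1 => integralMean f r) := f.2.2

/-- The norm `‖f‖ = (sup_{0 ≤ r < 1} ∫_{𝕋ⁿ} |f(r z)|² dθ)^{1/2}`. -/
instance : Norm (HardySpace n) := ⟨fun f => √(⨆ r : Set.Ico (0 : ℝ) 1, integralMean f r)⟩

lemma norm_def (f : HardySpace n) : ‖f‖ = √(⨆ r : Set.Ico (0 : ℝ) 1, integralMean f r) := rfl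

lemma summable_coeff (f : HardySpace n) : Summable fun k => ‖taylorCoeff (zeroExt f) k‖ ^ 2 := by
  obtain ⟨C, hC⟩ := f.bddAbove
  exact summable_of_sum_le (fun k => sq_nonneg _)
    (sum_sq_taylorCoeff_le f.isHolomorphic fun r => hC ⟨r, rfl⟩)

lemma iSup_integralMean (f : HardySpace n) :
    ⨆ r : Set.Ico (0 : ℝ) 1, integralMean f r = ∑' k, ‖taylorCoeff (zeroExt f) k‖ ^ 2 := by
  have : Nonempty (Set.Ico (0 : ℝ) 1) := ⟨⟨0, by simp⟩⟩
  refine le_antisymm (ciSup_le (integralMean_le_tsum f.isHolomorphic f.summable_coeff)) ?_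
  exact Real.tsum_le_of_sum_le (fun k => sq_nonneg _)
    (sum_sq_taylorCoeff_le f.isHolomorphic fun r => le_ciSup f.bddAbove r)

/-- The Taylor coefficients of an element of `H²(𝔻ⁿ)`, as a square summable family. -/
def coeff : HardySpace n →ₗ[ℂ] lp (fun _ : Fin n → ℕ => ℂ) 2 where
  toFun f := ⟨fun k => taylorCoeff (zeroExt f) k, memℓp_gen (by simpa using f.summable_coeff)⟩
  map_add' f g := by
    ext k
    have hi : ∀ f : HardySpace n, Integrable (fun x => UnitAddTorus.mFourier
        (-fun i => (k i : ℤ)) x * zeroExt f (torusPoint (fun _ => 1 / 2) x)) (torusMeasure n) :=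
      fun f => integrable_of_continuous ((UnitAddTorus.mFourier _).continuous.mul
        (continuous_comp_torusPoint f.isHolomorphic.continuousOn (fun _ => by norm_num)
          (fun _ => by norm_num)))
    change taylorCoeff (zeroExt (toFun (f + g))) k =
      taylorCoeff (zeroExt f) k + taylorCoeff (zeroExt g) k
    simp only [map_add, zeroExt_add, taylorCoeff, torusCoeff, Pi.add_apply, mul_add]
    rw [integral_add (hi f) (hi g), add_mul]
  map_smul' c f := by
    ext k
    change taylorCoeff (zeroExt (toFun (c • f))) k = c * taylorCoeff (zeroExt f) k
    simp only [map_smul, zeroExt_smul, taylorCoeff, torusCoeff, Pi.smul_apply, smul_eq_mul,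
      mul_left_comm _ c]
    rw [integral_const_mul, mul_assoc]

lemma coeff_apply (f : HardySpace n) (k : Fin n → ℕ) : coeff f k = taylorCoeff (zeroExt f) k := rfl

lemma norm_coeff (f : HardySpace n) : ‖coeff f‖ = ‖f‖ := by
  rw [norm_def, iSup_integralMean]
  rw [lp.norm_eq_tsum_rpow (by simp), Real.sqrt_eq_rpow]
  simp [coeff_apply]

lemma hasSum_coeff (f : HardySpace n) (z : polydisc n) :
    HasSum (fun k => coeff f k * ∏ i, z.1 i ^ k i) (f z) := by
  have := hasSum_taylor f.isHolomorphic z.2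
  rwa [zeroExt_of_mem _ z.2] at this

lemma coeff_injective : Function.Injective (coeff (n := n)) := by
  intro f g h
  apply Subtype.ext
  funext z
  have h1 := f.hasSum_coeff z
  rw [h] at h1
  exact h1.unique (g.hasSum_coeff z)

lemma coeff_surjective : Function.Surjective (coeff (n := n)) := by
  intro a
  have hs : Summable fun k => ‖a k‖ ^ 2 := by
    simpa using (lp.memℓp a).summable (by simp)
  have hM : ∀ k, ‖a k‖ ≤ ‖a‖ := fun k => lp.norm_apply_le_norm (by simp) a k
  set f : polydisc n → ℂ := fun z => powerSum a z with hf
  have hext : Set.EqOn (zeroExt f) (powerSum a) (polydisc n) := fun z hz => zeroExt_of_mem f hz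
  have hhol : IsHolomorphic f := (differentiableOn_powerSum hM).congr hext
  have hcoeff : ∀ k, taylorCoeff (zeroExt f) k = a k := by
    intro k
    rw [← taylorCoeff_powerSum hM k, taylorCoeff, taylorCoeff]
    refine congrArg (· * _) (integral_congr_ae (Eventually.of_forall fun x => ?_))
    exact congrArg (_ * ·)
      (hext (torusPoint_mem (fun _ => by norm_num) (fun _ => by norm_num) x))
  have hmem : f ∈ hardySubmodule n := by
    refine ⟨hhol, ∑' k, ‖taylorCoeff (zeroExt f) k‖ ^ 2, ?_⟩
    rintro _ ⟨r, rfl⟩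
    exact integralMean_le_tsum hhol (by simpa only [hcoeff] using hs) r
  refine ⟨⟨f, hmem⟩, ?_⟩
  ext k
  exact hcoeff k

instance : NormedAddCommGroup (HardySpace n) :=
  NormedAddCommGroup.ofCore (𝕜 := ℂ)
    { norm_nonneg := fun f => Real.sqrt_nonneg _
      norm_smul := fun c f => by simp only [← norm_coeff, map_smul, norm_smul]
      norm_triangle := fun f g => by
        simp only [← norm_coeff, map_add]; exact norm_add_le _ _
      norm_eq_zero_iff := fun f => by
        rw [← norm_coeff, norm_eq_zero, map_eq_zero_iff _ coeff_injective] }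

instance : InnerProductSpace ℂ (HardySpace n) where
  inner f g := inner ℂ (coeff f) (coeff g)
  norm_smul_le c f := by simp only [← norm_coeff, map_smul, norm_smul, le_refl]
  norm_sq_eq_re_inner f := by rw [← norm_coeff]; exact norm_sq_eq_re_inner (coeff f)
  conj_inner_symm f g := inner_conj_symm _ _
  add_left f g h := by rw [map_add]; exact inner_add_left _ _ _
  smul_left f g c := by rw [map_smul]; exact inner_smul_left _ _ _

/-- `H²(𝔻ⁿ)` is isometrically isomorphic to `ℓ²(ℕⁿ)` through the Taylor coefficients. -/
def coeffEquiv : HardySpace n ≃ₗᵢ[ℂ] lp (fun _ : Fin n → ℕ => ℂ) 2 :=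
  LinearIsometryEquiv.ofSurjective ⟨coeff, norm_coeff⟩ coeff_surjective

instance : CompleteSpace (HardySpace n) :=
  coeffEquiv.toIsometryEquiv.completeSpace

end HardySpace

/-- `H^∞(U)`: the bounded holomorphic functions on `U`. -/
structure HInfty {E : Type*} [NormedAddCommGroup E] [NormedSpace ℂ E] (U : Set E) where
  toFun : U → ℂ
  holomorphic : IsHolomorphic toFun
  bounded : ∃ C : ℝ, ∀ z, ‖toFun z‖ ≤ C

/-- The multiplication operator `M_φ f = φ f` on `H²(𝔻ⁿ)`, for `φ ∈ H^∞(𝔻ⁿ)`. -/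
def mulOp {n : ℕ} (φ : HInfty (polydisc n)) : HardySpace n →L[ℂ] HardySpace n :=
  have key : ∀ C : ℝ, (∀ z, ‖φ.toFun z‖ ≤ C) → ∀ (f : HardySpace n) (r : Set.Ico (0 : ℝ) 1),
      integralMean (φ.toFun * HardySpace.toFun f) r ≤ C ^ 2 * integralMean f r := by
    intro C hC f r
    rw [integralMean, integralMean, ← integral_const_mul]
    refine integral_mono_of_nonneg (Eventually.of_forall fun x => by positivity)
      ((integrable_mean f.isHolomorphic r).const_mul _) (Eventually.of_forall fun x => ?_)
    have hx := torusPoint_mem (n := n) (ρ := fun _ => (r : ℝ)) (fun _ => r.2.1) (fun _ => r.2.2) x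
    simp only [zeroExt_of_mem _ hx, Pi.mul_apply, norm_mul, mul_pow]
    gcongr
    exact hC _
  LinearMap.mkContinuousOfExistsBound
    { toFun := fun f => ⟨φ.toFun * HardySpace.toFun f, by
        obtain ⟨C, hC⟩ := φ.bounded
        obtain ⟨B, hB⟩ := f.bddAbove
        refine ⟨?_, C ^ 2 * B, ?_⟩
        · simpa only [IsHolomorphic, zeroExt_mul] using φ.holomorphic.mul f.isHolomorphic
        · rintro _ ⟨r, rfl⟩
          exact (key C hC f r).trans (mul_le_mul_of_nonneg_left (hB ⟨r, rfl⟩) (sq_nonneg C))⟩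
      map_add' := fun f g => Subtype.ext (by
        change φ.toFun * HardySpace.toFun (f + g) =
          φ.toFun * HardySpace.toFun f + φ.toFun * HardySpace.toFun g
        rw [map_add, mul_add])
      map_smul' := fun c f => Subtype.ext (by
        change φ.toFun * HardySpace.toFun (c • f) = c • (φ.toFun * HardySpace.toFun f)
        rw [map_smul, mul_smul_comm]) }
    (by
      obtain ⟨C, hC⟩ := φ.bounded
      refine ⟨|C|, fun f => ?_⟩
      rw [HardySpace.norm_def, HardySpace.norm_def, ← Real.sqrt_sq_eq_abs,
        ← Real.sqrt_mul (sq_nonneg C)]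
      have : Nonempty (Set.Ico (0 : ℝ) 1) := ⟨⟨0, by simp⟩⟩
      refine Real.sqrt_le_sqrt (ciSup_le fun r => (key C hC f r).trans ?_)
      exact mul_le_mul_of_nonneg_left (le_ciSup f.bddAbove r) (sq_nonneg C))

lemma mulOp_apply {n : ℕ} (φ : HInfty (polydisc n)) (f : HardySpace n) (z : polydisc n) :
    mulOp φ f z = φ.toFun z * f z := rfl

/-- The open unit disc `𝔻`. -/
abbrev disc : Set ℂ := Metric.ball 0 1

/-- The extension `Θ̃(z) = Θ(z_i)` to the polydisc of a one-variable function `Θ ∈ H^∞(𝔻)`. -/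
def HInfty.extend {n : ℕ} (Θ : HInfty disc) (i : Fin n) : HInfty (polydisc n) where
  toFun z := Θ.toFun ⟨z.1 i, by simpa using z.2 i⟩
  holomorphic := by
    have h : DifferentiableOn ℂ (fun z : Fin n → ℂ => zeroExt Θ.toFun (z i)) (polydisc n) :=
      Θ.holomorphic.comp (differentiable_apply i).differentiableOn fun z hz => by
        simpa using hz i
    refine h.congr fun z hz => ?_
    rw [zeroExt_of_mem _ hz, zeroExt_of_mem]
  bounded := by
    obtain ⟨C, hC⟩ := Θ.bounded
    exact ⟨C, fun z => hC _⟩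

/-- The coordinate function of `𝔻`. -/
def HInfty.coord : HInfty disc where
  toFun w := w
  holomorphic := by
    refine differentiableOn_id.congr fun w hw => ?_
    rw [zeroExt_of_mem _ hw]; rfl
  bounded := ⟨1, fun w => by simpa using (mem_ball_zero_iff.1 w.2).le⟩

/-- Multiplication `M_{z_i}` by the `i`-th coordinate function. -/
def coordMul {n : ℕ} (i : Fin n) : HardySpace n →L[ℂ] HardySpace n :=
  mulOp (HInfty.coord.extend i)

lemma coordMul_apply {n : ℕ} (i : Fin n) (f : HardySpace n) (z : polydisc n) :
    coordMul i f z = z.1 i * f z := rfl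

/-- `Θ ∈ H^∞(𝔻)` is inner: its radial limits exist and are unimodular almost everywhere on the
unit circle. -/
def IsInner (Θ : HInfty disc) : Prop :=
  ∀ᵐ t : UnitAddCircle ∂AddCircle.haarAddCircle, ∃ w : ℂ, ‖w‖ = 1 ∧
    Tendsto (fun r : ℝ => zeroExt Θ.toFun (r * (AddCircle.toCircle t : ℂ))) (𝓝[<] 1) (𝓝 w)

/-- A closed subspace is a submodule of `H²(𝔻ⁿ)` if it is invariant under all `M_{z_i}`. -/
def IsHardySubmodule {n : ℕ} (S : ClosedSubmodule ℂ (HardySpace n)) : Prop :=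
  ∀ i, ∀ f ∈ S, coordMul i f ∈ S

/-- A closed subspace is a quotient module of `H²(𝔻ⁿ)` if its orthogonal complement is a
submodule. -/
def IsQuotientModule {n : ℕ} (Q : ClosedSubmodule ℂ (HardySpace n)) : Prop :=
  IsHardySubmodule Qᗮ

instance {n : ℕ} (Q : ClosedSubmodule ℂ (HardySpace n)) : CompleteSpace Q.toSubmodule :=
  Q.isClosed'.completeSpace_coe

/-- The compression `C_{z_i} = P_Q M_{z_i}|_Q`. -/
def compression {n : ℕ} (Q : ClosedSubmodule ℂ (HardySpace n)) (i : Fin n) :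
    Q.toSubmodule →L[ℂ] Q.toSubmodule :=
  Q.toSubmodule.orthogonalProjectionOnto ∘L coordMul i ∘L Q.toSubmodule.subtypeL

/-- `C_{z_i} C_{z_j}^* = C_{z_j}^* C_{z_i}` for all `i < j`. -/
def IsDoublyCommuting {n : ℕ} (Q : ClosedSubmodule ℂ (HardySpace n)) : Prop :=
  ∀ i j : Fin n, i < j →
    compression Q i ∘L ContinuousLinearMap.adjoint (compression Q j) =
      ContinuousLinearMap.adjoint (compression Q j) ∘L compression Q i

/-- A closed subspace `S` is a co-doubly commuting submodule if `H²(𝔻ⁿ) / S`, that is `Sᗮ`, is a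
doubly commuting quotient module. -/
def IsCoDoublyCommuting {n : ℕ} (S : ClosedSubmodule ℂ (HardySpace n)) : Prop :=
  IsQuotientModule Sᗮ ∧ IsDoublyCommuting Sᗮ

/-- The linear subspace `Θ̃₁ H²(𝔻ⁿ) + ⋯ + Θ̃ₘ H²(𝔻ⁿ)` (algebraic sum, no closure), where
`Θ̃_j(z) = Θ_j(z_{i_j})`. -/
def innerSum {n m : ℕ} (i : Fin m → Fin n) (Θ : Fin m → HInfty disc) :
    Submodule ℂ (HardySpace n) :=
  ∑ j, (mulOp ((Θ j).extend (i j))).range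

end Polydisc

end

open Polydisc

noncomputable section

namespace Polydisc

/-! Write M_i for multiplication by z_i, C_i for its compression to Q, and E_i for the functions of
z_i alone, which is `coordKer (Finset.univ.erase i)`. Allowing the zero function next to inner
functions turns every sum in the theorem into a sum over all n coordinates (`axisSum`).

From inner functions to double commutation: multiplication by Ψ_l(z_l) is an isometry or zero, so
R_l = M M^* is the projection onto its range. Operators attached to different variables doubly
commute, hence the R_l commute, the sum of their ranges is closed
(`isClosed_iSup_range_of_commute`), and Q is the common kernel of the R_l. For f in Q only R_i can
fail to kill z_i f, so C_i f = (1 - R_i) M_i f, while C_j^* is the restriction of M_j^*, which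
commutes with M_i and R_i when j ≠ i.

Conversely, let Q be doubly commuting. By Beurling's theorem (`exists_inner_generator`) each nonzero
Qᗮ ∩ E_l is generated by one inner function of z_l. The ranges of these inner functions sum to a
subspace of Qᗮ whose complement Q' is doubly commuting by the first half and satisfies Q'ᗮ ∩ E_l =
Qᗮ ∩ E_l. It remains to see that a nonzero doubly commuting quotient module is determined by these
intersections (`IsDoublyCommuting.eq_of_inf_coordKer_eq`).

The reason is that P_Q is essentially a tensor product. Put φ = P_Q 1. The compression D of the
projection onto E_i is the product of the 1 - C_j C_j^* over j ≠ i. It commutes with C_i and C_i^*,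
and D (1 - C_i C_i^*) is the compression of the projection onto the constants, that is, the rank one
operator φ ⊗ φ. Hence φ is an eigenvector of D and its vector state factors over the variables
(`inner_mul_of_rankOne`). Up to constants, ⟨z^k, P_Q z^l⟩ is therefore the product of the numbers
⟨z_i^{k_i}, P_Q z_i^{l_i}⟩, and for each i these are, up to a scalar, the matrix of the projection
of E_i onto E_i ⊖ (Qᗮ ∩ E_i). So P_{Q'} is a nonzero multiple of P_Q, and Q' = Q.

Inner functions are defined by radial limits, so producing one in Beurling's theorem needs Fatou's
theorem. It is obtained by differentiating a Lipschitz primitive at the boundary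
(`ae_exists_tendsto_radial`). -/

lemma HardySpace.ext {n : ℕ} {f g : HardySpace n} (h : ∀ z : polydisc n, f z = g z) : f = g :=
  Subtype.ext (funext h)

/-! ### Monomials, reproducing kernels and coordinate shifts -/

/-- The monomials form an orthonormal basis of `H²(𝔻ⁿ)`. -/
def monomialBasis (n : ℕ) : HilbertBasis (Fin n → ℕ) ℂ (HardySpace n) :=
  HilbertBasis.ofRepr HardySpace.coeffEquiv

lemma monomialBasis_repr {n : ℕ} (f : HardySpace n) (k : Fin n → ℕ) :
    (monomialBasis n).repr f k = HardySpace.coeff f k := rfl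

lemma coeff_eq_inner {n : ℕ} (f : HardySpace n) (k : Fin n → ℕ) :
    HardySpace.coeff f k = inner ℂ (monomialBasis n k) f := by
  rw [← monomialBasis_repr, HilbertBasis.repr_apply_apply]

lemma monomialBasis_apply {n : ℕ} (k : Fin n → ℕ) (z : polydisc n) :
    monomialBasis n k z = ∏ i, z.1 i ^ k i := by
  have h := (monomialBasis n k).hasSum_coeff z
  have h2 : HasSum (fun l => HardySpace.coeff (monomialBasis n k) l * ∏ i, z.1 i ^ l i)
      (∏ i, z.1 i ^ k i) := by
    have : (∏ i, z.1 i ^ k i) = HardySpace.coeff (monomialBasis n k) k * ∏ i, z.1 i ^ k i := by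
      rw [coeff_eq_inner, orthonormal_iff_ite.1 (monomialBasis n).orthonormal, if_pos rfl, one_mul]
    rw [this]
    refine hasSum_single _ fun l hl => ?_
    rw [coeff_eq_inner, orthonormal_iff_ite.1 (monomialBasis n).orthonormal, if_neg hl, zero_mul]
  exact h.unique h2

/-- The reproducing kernel of `H²(𝔻ⁿ)` at a point of the polydisc. -/
def kernelFun {n : ℕ} (z : polydisc n) : HardySpace n :=
  have hmem : Memℓp (fun k : Fin n → ℕ => starRingEnd ℂ (∏ i, z.1 i ^ k i)) 2 := by
    refine memℓp_gen ?_
    have := summable_monomial (x := fun i => ‖z.1 i‖ ^ 2) (fun i => by positivity)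
      (fun i => by have := z.2 i; have := norm_nonneg (z.1 i); nlinarith)
    refine this.congr fun k => ?_
    simp only [RCLike.norm_conj, norm_prod, norm_pow, ENNReal.toReal_ofNat, Real.rpow_ofNat,
      ← Finset.prod_pow]
    exact Finset.prod_congr rfl fun i _ => by rw [← pow_mul, ← pow_mul, mul_comm]
  HardySpace.coeffEquiv.symm ⟨_, hmem⟩

lemma inner_kernelFun {n : ℕ} (z : polydisc n) (f : HardySpace n) :
    inner ℂ (kernelFun z) f = f z := by
  rw [← (f.hasSum_coeff z).tsum_eq]
  have : inner ℂ (kernelFun z) f =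
      inner ℂ (HardySpace.coeffEquiv (kernelFun z)) (HardySpace.coeffEquiv f) := rfl
  rw [this, kernelFun, LinearIsometryEquiv.apply_symm_apply]
  refine (lp.inner_eq_tsum _ _).trans (tsum_congr fun k => ?_)
  simp only [RCLike.inner_apply, Complex.conj_conj]
  rfl

/-- Evaluation at a point of the polydisc. -/
def evalCLM {n : ℕ} (z : polydisc n) : HardySpace n →L[ℂ] ℂ := innerSL ℂ (kernelFun z)

lemma evalCLM_apply {n : ℕ} (z : polydisc n) (f : HardySpace n) : evalCLM z f = f z :=
  inner_kernelFun z f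

lemma clm_ext_monomial {n : ℕ} {E : Type*} [NormedAddCommGroup E] [NormedSpace ℂ E]
    {A B : HardySpace n →L[ℂ] E} (h : ∀ k, A (monomialBasis n k) = B (monomialBasis n k)) :
    A = B := by
  refine ContinuousLinearMap.ext_on (s := Set.range (monomialBasis n)) ?_ ?_
  · exact Submodule.dense_iff_topologicalClosure_eq_top.2 (monomialBasis n).dense_span
  · rintro _ ⟨k, rfl⟩; exact h k

lemma coordMul_monomialBasis {n : ℕ} (i : Fin n) (k : Fin n → ℕ) :
    coordMul i (monomialBasis n k) = monomialBasis n (k + Pi.single i 1) := by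
  refine HardySpace.ext fun z => ?_
  rw [coordMul_apply, monomialBasis_apply, monomialBasis_apply]
  simp only [Pi.add_apply, pow_add, Finset.prod_mul_distrib]
  rw [mul_comm]
  congr 1
  rw [Finset.prod_eq_single i] <;> simp +contextual

lemma commute_mulOp {n : ℕ} (φ ψ : HInfty (polydisc n)) : Commute (mulOp φ) (mulOp ψ) := by
  ext f : 1
  refine HardySpace.ext fun z => ?_
  change mulOp φ (mulOp ψ f) z = mulOp ψ (mulOp φ f) z
  simp only [mulOp_apply]; ring

lemma commute_coordMul {n : ℕ} (i j : Fin n) : Commute (coordMul i) (coordMul j) :=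
  commute_mulOp _ _

open ContinuousLinearMap (adjoint)

lemma inner_monomialBasis {n : ℕ} (k l : Fin n → ℕ) :
    inner ℂ (monomialBasis n k) (monomialBasis n l) = if k = l then (1 : ℂ) else 0 := by
  classical
  exact orthonormal_iff_ite.1 (monomialBasis n).orthonormal k l

lemma ext_inner_monomialBasis {n : ℕ} {f g : HardySpace n}
    (h : ∀ k, inner ℂ (monomialBasis n k) f = inner ℂ (monomialBasis n k) g) : f = g := by
  apply HardySpace.coeff_injective
  ext k
  rw [coeff_eq_inner, coeff_eq_inner, h]

lemma star_coordMul_mul_coordMul {n : ℕ} (i : Fin n) :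
    star (coordMul i) * coordMul i = (1 : HardySpace n →L[ℂ] HardySpace n) := by
  refine clm_ext_monomial fun k => ext_inner_monomialBasis fun l => ?_
  rw [ContinuousLinearMap.star_eq_adjoint, mul_apply_eq_comp,
    ContinuousLinearMap.adjoint_inner_right, coordMul_monomialBasis, coordMul_monomialBasis,
    inner_monomialBasis, one_apply_eq_self, inner_monomialBasis]
  simp

lemma inner_coordMul_coordMul {n : ℕ} (i : Fin n) (f g : HardySpace n) :
    inner ℂ (coordMul i f) (coordMul i g) = inner ℂ f g := by
  rw [← ContinuousLinearMap.adjoint_inner_right, ← ContinuousLinearMap.star_eq_adjoint,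
    ← mul_apply_eq_comp, star_coordMul_mul_coordMul, one_apply_eq_self]

lemma adjoint_coordMul_monomialBasis {n : ℕ} (i : Fin n) (k : Fin n → ℕ) :
    adjoint (coordMul i) (monomialBasis n k) =
      if k i = 0 then 0 else monomialBasis n (k - Pi.single i 1) := by
  refine ext_inner_monomialBasis fun l => ?_
  rw [ContinuousLinearMap.adjoint_inner_right, coordMul_monomialBasis, inner_monomialBasis]
  split_ifs with h1 h2 h2
  · simp [← h1] at h2
  · rw [← h1, add_tsub_cancel_right, inner_monomialBasis, if_pos rfl]
  · rw [inner_zero_right]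
  · rw [inner_monomialBasis, if_neg]
    rintro rfl
    refine h1 (tsub_add_cancel_of_le fun j => ?_)
    by_cases hj : j = i
    · subst hj; simp; omega
    · simp [hj]

/-- On monomials the two operators change different exponents. This is the case Q = H² of double
commutation, and the commutation relations between operators in different variables all rest on it.
-/
lemma commute_star_coordMul {n : ℕ} {i j : Fin n} (hij : i ≠ j) :
    Commute (star (coordMul i)) (coordMul j : HardySpace n →L[ℂ] HardySpace n) := by
  refine clm_ext_monomial fun k => ?_
  simp only [ContinuousLinearMap.star_eq_adjoint, mul_apply_eq_comp,
    coordMul_monomialBasis, adjoint_coordMul_monomialBasis, Pi.add_apply,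
    Pi.single_eq_of_ne hij, add_zero]
  split_ifs with h
  · simp
  · rw [coordMul_monomialBasis]
    congr 1
    ext l
    by_cases hl : l = i
    · subst hl; simp [hij]
    · simp [hl]

/-- The backward shift is locally nilpotent on monomials. This replaces polynomial approximation of
bounded functions, and also shows that no nonzero function is divisible by every power of z_i. -/
lemma adjoint_coordMul_pow_monomialBasis {n : ℕ} (i : Fin n) (N : ℕ) (k : Fin n → ℕ)
    (hk : k i < N) : (star (coordMul i) ^ N) (monomialBasis n k) = 0 := by
  induction N generalizing k with
  | zero => omega
  | succ N ih =>
    rw [pow_succ, mul_apply_eq_comp, ContinuousLinearMap.star_eq_adjoint,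
      adjoint_coordMul_monomialBasis]
    split_ifs with h
    · simp
    · exact ih _ (by simp; omega)

/-! ### Multipliers depending on one variable -/

/-- A bounded holomorphic function on the disc is `Θ(0) + z Θ₁` with `Θ₁` bounded holomorphic. -/
lemma exists_eq_const_add_coord_mul (Θ : HInfty disc) :
    ∃ (c : ℂ) (Θ₁ : HInfty disc), ∀ w, Θ.toFun w = c + w * Θ₁.toFun w := by
  set F := zeroExt Θ.toFun with hF
  obtain ⟨C, hC⟩ := Θ.bounded
  have hd : DifferentiableOn ℂ (dslope F 0) disc :=
    (Complex.differentiableOn_dslope (Metric.ball_mem_nhds 0 one_pos)).2 Θ.holomorphic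
  refine ⟨F 0, ⟨fun w => dslope F 0 w, ?_, 2 * C / 1, ?_⟩, ?_⟩
  · exact hd.congr fun w hw => zeroExt_of_mem _ hw
  -- Schwarz lemma for a map of the disc into the closed ball of radius 2C about its value at 0.
  · intro w
    refine Complex.norm_dslope_le_div_of_mapsTo_ball Θ.holomorphic (fun v hv => ?_) w.2
    rw [mem_closedBall_iff_norm, hF, zeroExt_of_mem _ hv, zeroExt_of_mem _ (by simp)]
    refine (norm_sub_le _ _).trans ?_
    linarith [hC ⟨v, hv⟩, hC ⟨0, by simp⟩]
  · intro w
    have h := sub_smul_dslope F 0 (w : ℂ)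
    rw [sub_zero, smul_eq_mul, hF, zeroExt_of_mem _ w.2, ← hF] at h
    simp only [h]; ring

lemma mulOp_extend_eq {n : ℕ} (i : Fin n) {Θ Θ₁ : HInfty disc} {c : ℂ}
    (h : ∀ w, Θ.toFun w = c + w * Θ₁.toFun w) :
    mulOp (Θ.extend i) = c • (1 : HardySpace n →L[ℂ] HardySpace n) +
      coordMul i * mulOp (Θ₁.extend i) := by
  ext f : 1
  refine HardySpace.ext fun z => ?_
  have : (c • (1 : HardySpace n →L[ℂ] HardySpace n) + coordMul i * mulOp (Θ₁.extend i)) f =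
    c • f + coordMul i (mulOp (Θ₁.extend i) f) := rfl
  rw [this, map_add, map_smul, Pi.add_apply, Pi.smul_apply, mulOp_apply, coordMul_apply,
    mulOp_apply]
  change Θ.toFun ⟨z.1 i, _⟩ * _ = c • _ + z.1 i * (Θ₁.toFun ⟨z.1 i, _⟩ * _)
  rw [h, smul_eq_mul]; ring

/-- An operator commuting with `M_{z_i}` commutes with the multiplication by every bounded
function of `z_i`. -/
lemma commute_mulOp_extend {n : ℕ} {i : Fin n} {A : HardySpace n →L[ℂ] HardySpace n}
    (hA : Commute A (coordMul i)) (Θ : HInfty disc) : Commute A (mulOp (Θ.extend i)) := by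
  have hA' : Commute (star A) (star (coordMul i)) := hA.star_star
  -- The adjoint of Θ̃ = c + z_i Θ̃₁ is c̄ + Θ̃₁^* M_i^*, so each step of the induction trades Θ for
  -- its quotient Θ₁ and f for M_i^* f, which one power fewer annihilates. The relation is proved
  -- for adjoints because only M_i^* is locally nilpotent.
  have key : ∀ (N : ℕ) (Θ : HInfty disc) (f : HardySpace n), (star (coordMul i) ^ N) f = 0 →
      star A (star (mulOp (Θ.extend i)) f) = star (mulOp (Θ.extend i)) (star A f) := by
    intro N
    induction N with
    | zero => intro Θ f hf; simp only [pow_zero, one_apply_eq_self] at hf; simp [hf]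
    | succ N ih =>
      intro Θ f hf
      obtain ⟨c, Θ₁, h⟩ := exists_eq_const_add_coord_mul Θ
      rw [mulOp_extend_eq i h]
      have e : ∀ g, star (c • (1 : HardySpace n →L[ℂ] HardySpace n) +
          coordMul i * mulOp (Θ₁.extend i)) g =
          star c • g + star (mulOp (Θ₁.extend i)) (star (coordMul i) g) := by
        intro g
        rw [star_add, star_smul, star_one, star_mul]; rfl
      rw [e, e, map_add, map_smul, ih Θ₁ _ (by rwa [pow_succ] at hf)]
      congr 2
      exact congrArg (fun B : HardySpace n →L[ℂ] HardySpace n => B f) hA'.eq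
  rw [← commute_star_star]
  refine clm_ext_monomial fun k => ?_
  exact key (k i + 1) Θ _ (adjoint_coordMul_pow_monomialBasis i _ k (Nat.lt_succ_self _))

lemma commute_star_coordMul_mulOp_extend {n : ℕ} {i j : Fin n} (hij : i ≠ j) (Θ : HInfty disc) :
    Commute (star (coordMul i)) (mulOp (Θ.extend j) : HardySpace n →L[ℂ] HardySpace n) :=
  commute_mulOp_extend (commute_star_coordMul hij) Θ

lemma commute_star_mulOp_extend {n : ℕ} {i j : Fin n} (hij : i ≠ j) (Θ Ψ : HInfty disc) :
    Commute (star (mulOp (Θ.extend i))) (mulOp (Ψ.extend j) : HardySpace n →L[ℂ] HardySpace n) := by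
  refine commute_mulOp_extend ?_ Ψ
  have := commute_star_coordMul_mulOp_extend hij.symm Θ
  simpa using this.star_star.symm

/-! ### Fatou's theorem on radial limits -/

section Fatou

open Complex Metric

/-- The point ζ₀ / r is the reflection of r ζ₀ in the unit circle, so distances to it from points of
the circle are those to r ζ₀ divided by r. Factoring the difference of squares then produces the
gain 1 - r^2. -/
lemma norm_cauchyKernel_sub_reflection_le {ζ ζ₀ : ℂ} (hζ : ‖ζ‖ = 1) (hζ₀ : ‖ζ₀‖ = 1) {r : ℝ}
    (hr0 : 0 < r) (hr1 : r < 1) :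
    ‖((ζ - r * ζ₀) ^ 2)⁻¹ - ((ζ - ζ₀ / r) ^ 2)⁻¹‖ ≤ 4 * (1 - r) / ‖ζ - r * ζ₀‖ ^ 3 := by
  have hrC : (r : ℂ) ≠ 0 := by exact_mod_cast hr0.ne'
  have hz : ζ - r * ζ₀ ≠ 0 := by
    intro h
    have := congrArg norm (sub_eq_zero.1 h)
    rw [norm_mul, hζ, hζ₀, norm_real, Real.norm_eq_abs, abs_of_pos hr0] at this
    linarith
  have hrefl : ‖ζ - ζ₀ / r‖ = ‖ζ - r * ζ₀‖ / r := by
    have h1 : ζ - ζ₀ / r = -(ζ * ζ₀) * starRingEnd ℂ (ζ - r * ζ₀) / r := by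
      have e1 : ζ * starRingEnd ℂ ζ = 1 := by rw [mul_conj, normSq_eq_norm_sq, hζ]; simp
      have e2 : ζ₀ * starRingEnd ℂ ζ₀ = 1 := by rw [mul_conj, normSq_eq_norm_sq, hζ₀]; simp
      rw [map_sub, map_mul, conj_ofReal, eq_div_iff hrC, sub_mul, div_mul_cancel₀ _ hrC]
      linear_combination (ζ₀ : ℂ) * e1 - (r : ℂ) * ζ * e2
    rw [h1, norm_div, norm_mul, norm_neg, norm_mul, hζ, hζ₀, RCLike.norm_conj, norm_real,
      Real.norm_eq_abs, abs_of_pos hr0]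
    ring
  have hpos : 0 < ‖ζ - r * ζ₀‖ := norm_pos_iff.2 hz
  have hz' : ζ - ζ₀ / r ≠ 0 := by
    rw [← norm_pos_iff, hrefl]; positivity
  have hk : ((ζ - r * ζ₀) ^ 2)⁻¹ - ((ζ - ζ₀ / r) ^ 2)⁻¹ =
      ((r * ζ₀ - ζ₀ / r) * ((ζ - r * ζ₀) + (ζ - ζ₀ / r))) /
        ((ζ - r * ζ₀) ^ 2 * (ζ - ζ₀ / r) ^ 2) := by
    rw [inv_sub_inv (pow_ne_zero 2 hz) (pow_ne_zero 2 hz')]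
    congr 1; ring
  have hd : ‖r * ζ₀ - ζ₀ / r‖ = (1 - r ^ 2) / r := by
    have : r * ζ₀ - ζ₀ / r = -(((1 - r ^ 2) / r : ℝ) : ℂ) * ζ₀ := by
      push_cast; field_simp; ring
    rw [this, norm_mul, hζ₀, norm_neg, norm_real, Real.norm_eq_abs, abs_of_nonneg, mul_one]
    apply div_nonneg _ hr0.le
    nlinarith
  rw [hk, norm_div, norm_mul, norm_mul, norm_pow, norm_pow, hd, hrefl]
  have hsum : ‖(ζ - r * ζ₀) + (ζ - ζ₀ / r)‖ ≤ ‖ζ - r * ζ₀‖ * (1 + r) / r := by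
    refine (norm_add_le _ _).trans (le_of_eq ?_)
    rw [hrefl]; field_simp; ring
  set d := ‖ζ - r * ζ₀‖ with hd'
  have hnum : (1 - r ^ 2) / r * ‖(ζ - r * ζ₀) + (ζ - ζ₀ / r)‖ ≤
      (1 - r ^ 2) / r * (d * (1 + r) / r) :=
    mul_le_mul_of_nonneg_left hsum (div_nonneg (by nlinarith) hr0.le)
  refine (div_le_div_of_nonneg_right hnum (by positivity)).trans ?_
  have : (1 - r ^ 2) / r * (d * (1 + r) / r) / (d ^ 2 * (d / r) ^ 2) =
      (1 - r) * (1 + r) ^ 2 / d ^ 3 := by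
    field_simp; ring
  rw [this]
  refine div_le_div_of_nonneg_right ?_ (by positivity)
  nlinarith [mul_nonneg (sq_nonneg (1 - r)) (by linarith : 0 ≤ 3 + r)]

/-- The Poisson kernel has mean one: this is the Poisson formula for the constant function 1. -/
lemma integral_inv_norm_sq_circleMap {z : ℂ} (hz : ‖z‖ < 1) :
    ∫ θ in (0 : ℝ)..2 * Real.pi, (‖circleMap 0 1 θ - z‖ ^ 2)⁻¹ =
      2 * Real.pi / (1 - ‖z‖ ^ 2) := by
  have h := DiffContOnCl.circleAverage_poissonKernel_smul' (f := fun _ => (1 : ℂ)) (c := 0) (R := 1)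
    (w := z) diffContOnCl_const (by simpa using hz)
  have h1 : (1 - ‖z‖ ^ 2) ≠ 0 := by nlinarith [norm_nonneg z]
  rw [Real.circleAverage_def] at h
  simp only [sub_zero, norm_circleMap_zero, abs_one, one_pow, real_smul, mul_one] at h
  rw [intervalIntegral.integral_ofReal, ← ofReal_mul, ofReal_eq_one] at h
  simp only [div_eq_mul_inv] at h ⊢
  rw [intervalIntegral.integral_const_mul] at h
  field_simp at h ⊢
  linarith

/-- Cauchy's formula for the derivative at z = r ζ₀ keeps its value when the kernel with the pole
reflected to ζ₀ / r is subtracted, and the new kernel is at most 4 (1 - r) / |ζ - z|^3. Since |ζ -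
ζ₀| ≤ 2 |ζ - z|, the linear part of the bound on H is integrated against a Poisson kernel and the
cubic part cancels the singularity. -/
lemma norm_deriv_le_of_norm_circle_le {H : ℂ → ℂ} (hH : DiffContOnCl ℂ H (ball 0 1)) {ζ₀ : ℂ}
    (hζ₀ : ‖ζ₀‖ = 1) {ε B : ℝ} (hε : 0 ≤ ε) (hB : 0 ≤ B)
    (hb : ∀ ζ, ‖ζ‖ = 1 → ‖H ζ‖ ≤ ε * ‖ζ - ζ₀‖ + B * ‖ζ - ζ₀‖ ^ 3) {r : ℝ} (hr0 : 0 < r)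
    (hr1 : r < 1) : ‖deriv H (r * ζ₀)‖ ≤ 8 * ε + 32 * B * (1 - r) := by
  set z : ℂ := r * ζ₀ with hz
  have hznorm : ‖z‖ = r := by
    rw [hz, norm_mul, hζ₀, norm_real, Real.norm_eq_abs, abs_of_pos hr0, mul_one]
  have hzb : z ∈ ball (0 : ℂ) 1 := by rw [mem_ball_zero_iff, hznorm]; exact hr1
  have hnhds : ball (0 : ℂ) 1 ∈ 𝓝 z := isOpen_ball.mem_nhds hzb
  have hz'norm : 1 < ‖ζ₀ / (r : ℂ)‖ := by
    rw [norm_div, hζ₀, norm_real, Real.norm_eq_abs, abs_of_pos hr0, one_lt_div hr0]; exact hr1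
  have hne : ∀ ζ ∈ sphere (0 : ℂ) 1, ζ - z ≠ 0 := by
    intro ζ hζ h
    rw [mem_sphere_zero_iff_norm, sub_eq_zero.1 h, hznorm] at hζ
    linarith
  have hne' : ∀ ζ ∈ closedBall (0 : ℂ) 1, ζ - ζ₀ / r ≠ 0 := by
    intro ζ hζ h
    rw [mem_closedBall_zero_iff, sub_eq_zero.1 h] at hζ
    linarith
  have hcont : ContinuousOn H (sphere 0 1) := hH.continuousOn_ball.mono sphere_subset_closedBall
  -- Cauchy's formula for the difference quotient gives the derivative from boundary values of H
  -- alone, with no regularity beyond continuity on the circle.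
  have hds : DiffContOnCl ℂ (dslope H z) (ball 0 1) := by
    refine ⟨(differentiableOn_dslope hnhds).2 hH.differentiableOn, ?_⟩
    exact (continuousOn_dslope (mem_of_superset hnhds subset_closure)).2
      ⟨hH.continuousOn, hH.differentiableAt isOpen_ball hzb⟩
  have h1 := hds.circleIntegral_sub_inv_smul hzb
  rw [dslope_same] at h1
  have hrefl : DiffContOnCl ℂ (fun ζ => ((ζ - ζ₀ / r) ^ 2)⁻¹ * H ζ) (ball 0 1) := by
    refine DiffContOnCl.smul (𝕜 := ℂ) (c := fun ζ => ((ζ - ζ₀ / r) ^ 2)⁻¹) (f := H) ?_ hH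
    refine DifferentiableOn.diffContOnCl (𝕜 := ℂ) ?_
    rw [closure_ball _ one_ne_zero]
    intro ζ hζ
    refine DifferentiableAt.differentiableWithinAt ?_
    exact DifferentiableAt.inv (by fun_prop) (pow_ne_zero 2 (hne' ζ hζ))
  have h2 := hrefl.circleIntegral_eq_zero zero_le_one
  have h3 : (∮ ζ in C(0, 1), ((ζ - z) ^ 2)⁻¹) = 0 := by
    have := circleIntegral.integral_sub_zpow_of_ne (n := -2) (by norm_num) (0 : ℂ) z 1
    simpa [zpow_neg] using this
  have hker : ContinuousOn (fun ζ => ((ζ - z) ^ 2)⁻¹) (sphere (0 : ℂ) 1) :=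
    ContinuousOn.inv₀ (by fun_prop) fun ζ hζ => pow_ne_zero 2 (hne ζ hζ)
  have hker' : ContinuousOn (fun ζ => ((ζ - ζ₀ / r) ^ 2)⁻¹) (sphere (0 : ℂ) 1) :=
    ContinuousOn.inv₀ (by fun_prop) fun ζ hζ =>
      pow_ne_zero 2 (hne' ζ (sphere_subset_closedBall hζ))
  have key : (2 * Real.pi * I : ℂ) * deriv H z =
      ∮ ζ in C(0, 1), (((ζ - z) ^ 2)⁻¹ - ((ζ - ζ₀ / r) ^ 2)⁻¹) * H ζ := by
    rw [smul_eq_mul] at h1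
    rw [← h1]
    have e1 : (∮ ζ in C(0, 1), (ζ - z)⁻¹ • dslope H z ζ) =
        ∮ ζ in C(0, 1), (((ζ - z) ^ 2)⁻¹ * H ζ - H z * ((ζ - z) ^ 2)⁻¹) := by
      refine circleIntegral.integral_congr zero_le_one fun ζ hζ => ?_
      have := hne ζ hζ
      simp only [smul_eq_mul]
      rw [dslope_of_ne _ (sub_ne_zero.1 this), slope_def_field]
      field_simp
    have i1 : CircleIntegrable (fun ζ => ((ζ - z) ^ 2)⁻¹ * H ζ) 0 1 :=
      (hker.mul hcont).circleIntegrable zero_le_one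
    have i2 : CircleIntegrable (fun ζ => H z * ((ζ - z) ^ 2)⁻¹) 0 1 :=
      (continuousOn_const.mul hker).circleIntegrable zero_le_one
    have i3 : CircleIntegrable (fun ζ => ((ζ - ζ₀ / r) ^ 2)⁻¹ * H ζ) 0 1 :=
      (hker'.mul hcont).circleIntegrable zero_le_one
    rw [e1, circleIntegral.integral_sub i1 i2, circleIntegral.integral_const_mul, h3, mul_zero,
      sub_zero]
    simp only [sub_mul]
    rw [circleIntegral.integral_sub i1 i3, h2, sub_zero]
  have hbound : ∀ θ : ℝ, ‖deriv (circleMap 0 1) θ •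
      ((((circleMap 0 1 θ - z) ^ 2)⁻¹ - ((circleMap 0 1 θ - ζ₀ / r) ^ 2)⁻¹) *
        H (circleMap 0 1 θ))‖ ≤
      8 * ε * (1 - r) * (‖circleMap 0 1 θ - z‖ ^ 2)⁻¹ + 32 * B * (1 - r) := by
    intro θ
    set ζ := circleMap 0 1 θ with hζ
    have hζ1 : ‖ζ‖ = 1 := by simp [hζ]
    have hpos : 0 < ‖ζ - z‖ := norm_pos_iff.2 (hne ζ (by simp [hζ1]))
    have hdist : ‖ζ - ζ₀‖ ≤ 2 * ‖ζ - z‖ := by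
      have e1 : ‖z - ζ₀‖ = 1 - r := by
        have : z - ζ₀ = -((1 - r : ℝ) : ℂ) * ζ₀ := by rw [hz]; push_cast; ring
        rw [this, norm_mul, norm_neg, hζ₀, norm_real, Real.norm_eq_abs,
          abs_of_nonneg (by linarith), mul_one]
      have e2 : 1 - r ≤ ‖ζ - z‖ := by
        have := norm_sub_norm_le ζ z
        rw [hζ1, hznorm] at this; exact this
      have e3 : ‖ζ - ζ₀‖ ≤ ‖ζ - z‖ + ‖z - ζ₀‖ := by
        simpa using norm_add_le (ζ - z) (z - ζ₀)
      linarith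
    rw [norm_smul, norm_mul]
    have hdm : ‖deriv (circleMap 0 1) θ‖ = 1 := by simp [deriv_circleMap]
    rw [hdm, one_mul]
    have hH1 : ‖H ζ‖ ≤ ε * (2 * ‖ζ - z‖) + B * (2 * ‖ζ - z‖) ^ 3 :=
      (hb ζ hζ1).trans (by gcongr)
    calc _ ≤ 4 * (1 - r) / ‖ζ - z‖ ^ 3 * (ε * (2 * ‖ζ - z‖) + B * (2 * ‖ζ - z‖) ^ 3) :=
          mul_le_mul (norm_cauchyKernel_sub_reflection_le hζ1 hζ₀ hr0 hr1) hH1 (norm_nonneg _)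
            (div_nonneg (by linarith) (by positivity))
      _ = _ := by field_simp; ring
  have hcontθ : Continuous fun θ : ℝ => (‖circleMap 0 1 θ - z‖ ^ 2)⁻¹ := by
    refine Continuous.inv₀ (by fun_prop) fun θ => ?_
    exact pow_ne_zero 2 (norm_ne_zero_iff.2 (hne _ (by simp)))
  have hI1 : IntervalIntegrable (fun θ : ℝ => 8 * ε * (1 - r) * (‖circleMap 0 1 θ - z‖ ^ 2)⁻¹)
      volume 0 (2 * Real.pi) := (continuous_const.mul hcontθ).intervalIntegrable _ _
  have hI2 : IntervalIntegrable (fun _ : ℝ => 32 * B * (1 - r)) volume 0 (2 * Real.pi) :=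
    continuous_const.intervalIntegrable _ _
  have hint := intervalIntegral.norm_integral_le_of_norm_le Real.two_pi_pos.le
    (Eventually.of_forall fun θ _ => hbound θ) (hI1.add hI2)
  have hlhs : ‖(2 * Real.pi * I : ℂ) * deriv H z‖ = 2 * Real.pi * ‖deriv H z‖ := by
    simp [abs_of_pos Real.pi_pos]
  rw [key, circleIntegral] at hlhs
  rw [hlhs, intervalIntegral.integral_add hI1 hI2, intervalIntegral.integral_const_mul,
    integral_inv_norm_sq_circleMap (by rw [hznorm]; exact hr1), hznorm,
    intervalIntegral.integral_const, sub_zero, smul_eq_mul] at hint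
  -- The factor 1 - r gained from the reflection cancels the one in the total mass of the Poisson
  -- integral, which makes the bound uniform in r.
  have e : 8 * ε * (1 - r) * (2 * Real.pi / (1 - r ^ 2)) = 2 * Real.pi * (8 * ε / (1 + r)) := by
    have h1 : 1 - r ^ 2 = (1 - r) * (1 + r) := by ring
    have h2 : 1 - r ≠ 0 := by linarith
    rw [h1]; field_simp
  rw [e, ← mul_add] at hint
  refine (le_of_mul_le_mul_left hint Real.two_pi_pos).trans ?_
  gcongr
  rw [div_le_iff₀ (by linarith)]
  nlinarith

/-- First order expansion, along the unit circle, of a Lipschitz function at a point where it is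
differentiable along the circle; far from that point the error is absorbed by a cubic term. -/
lemma exists_norm_sub_linear_le {G : ℂ → ℂ} {K : NNReal} (hG : LipschitzWith K G) {t₀ : ℝ}
    (hd : DifferentiableAt ℝ (fun t : ℝ => G (exp (2 * Real.pi * t * I))) t₀) :
    ∃ L : ℂ, ∀ ε > 0, ∃ B, 0 ≤ B ∧ ∀ ζ, ‖ζ‖ = 1 →
      ‖G ζ - G (exp (2 * Real.pi * t₀ * I)) - L * (ζ - exp (2 * Real.pi * t₀ * I))‖ ≤
        ε * ‖ζ - exp (2 * Real.pi * t₀ * I)‖ + B * ‖ζ - exp (2 * Real.pi * t₀ * I)‖ ^ 3 := by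
  set γ : ℝ → ℂ := fun t => exp (2 * Real.pi * t * I) with hγ
  have hγd : ∀ t, HasDerivAt γ (γ t * (2 * Real.pi * I)) t := by
    intro t
    have h1 : HasDerivAt (fun t : ℝ => (2 * Real.pi * t * I : ℂ)) (2 * Real.pi * I) t := by
      have := ((HasDerivAt.ofReal_comp (hasDerivAt_id t)).const_mul (2 * Real.pi : ℂ)).mul_const I
      simpa using this
    exact h1.cexp
  have hγn : ∀ t, ‖γ t‖ = 1 := fun t => by
    have : γ t = exp ((2 * Real.pi * t : ℝ) * I) := by simp [hγ]
    rw [this, norm_exp_ofReal_mul_I]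
  set D := deriv (fun t => G (γ t)) t₀
  have hne : γ t₀ * (2 * Real.pi * I) ≠ 0 := by
    simp [Real.pi_ne_zero, hγ, exp_ne_zero]
  -- Chosen so that the remainder h has zero derivative along the circle at t₀.
  set L := D / (γ t₀ * (2 * Real.pi * I)) with hL
  set h : ℂ → ℂ := fun ζ => G ζ - G (γ t₀) - L * (ζ - γ t₀) with hh
  have hhd : HasDerivAt (fun t => h (γ t)) 0 t₀ := by
    have h1 := (hd.hasDerivAt.sub_const (G (γ t₀))).sub
      (((hγd t₀).sub_const (γ t₀)).const_mul L)
    have h2 : deriv (fun t => G (γ t)) t₀ - L * (γ t₀ * (2 * Real.pi * I)) = 0 := by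
      rw [hL, div_mul_cancel₀ _ hne, sub_self]
    rwa [h2] at h1
  have ho : (fun t => h (γ t)) =o[𝓝 t₀] fun t => γ t - γ t₀ := by
    have h1 := hasDerivAt_iff_isLittleO.1 hhd
    have h2 : ∀ t, h (γ t) - h (γ t₀) - (t - t₀) • (0 : ℂ) = h (γ t) := by
      intro t; simp [hh]
    simp only [h2] at h1
    exact h1.trans_isBigO
      ((HasDerivAtFilter.isTheta_sub (hγd t₀) hne).isBigO_symm.comp_tendsto
        (k := fun t => (t, t₀)) (tendsto_id.prodMk (tendsto_pure.2 (.of_forall fun _ => rfl))))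
  -- A right inverse of the parametrization on the circle, continuous at γ t₀; it turns the little-o
  -- estimate in t into one in ζ.
  set τ : ℂ → ℝ := fun ζ => t₀ + arg (ζ / γ t₀) / (2 * Real.pi) with hτ
  have hγ0 : γ t₀ ≠ 0 := exp_ne_zero _
  have hτt : Tendsto τ (𝓝 (γ t₀)) (𝓝 t₀) := by
    have hc : ContinuousAt τ (γ t₀) := by
      refine continuousAt_const.add (ContinuousAt.div_const ?_ _)
      refine ContinuousAt.comp (g := arg) (f := fun ζ => ζ / γ t₀) (x := γ t₀) ?_ (by fun_prop)
      rw [div_self hγ0]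
      exact continuousAt_arg one_mem_slitPlane
    have : τ (γ t₀) = t₀ := by simp [hτ, div_self hγ0]
    simpa [ContinuousAt, this] using hc
  have hγτ : ∀ ζ, ‖ζ‖ = 1 → γ (τ ζ) = ζ := by
    intro ζ hζ
    have e1 : γ (τ ζ) = γ t₀ * exp (arg (ζ / γ t₀) * I) := by
      simp only [hγ, hτ]
      rw [← Complex.exp_add]
      congr 1
      have : (Real.pi : ℂ) ≠ 0 := by exact_mod_cast Real.pi_ne_zero
      push_cast
      field_simp
    have e2 := norm_mul_exp_arg_mul_I (ζ / γ t₀)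
    rw [norm_div, hζ, hγn, div_one, ofReal_one, one_mul] at e2
    rw [e1, e2, mul_div_cancel₀ _ hγ0]
  refine ⟨L, fun ε hε => ?_⟩
  have hev := hτt.eventually (ho.bound hε)
  obtain ⟨η, hη, hball⟩ := Metric.eventually_nhds_iff.1 hev
  -- At distance at least η from γ t₀ the Lipschitz bound gives |h| ≤ 2 (K + ‖L‖), and the cubic
  -- term is at least B η^3.
  refine ⟨(K + ‖L‖) * 2 / η ^ 3, by positivity, fun ζ hζ => ?_⟩
  change ‖h ζ‖ ≤ ε * ‖ζ - γ t₀‖ + _ * ‖ζ - γ t₀‖ ^ 3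
  by_cases hd : dist ζ (γ t₀) < η
  · have := hball hd
    rw [hγτ ζ hζ] at this
    exact this.trans (le_add_of_nonneg_right (by positivity))
  · rw [not_lt, dist_eq_norm] at hd
    have h1 : ‖h ζ‖ ≤ (K + ‖L‖) * ‖ζ - γ t₀‖ := by
      refine (norm_sub_le _ _).trans ?_
      rw [norm_mul, add_mul]
      gcongr
      simpa [dist_eq_norm] using hG.dist_le_mul ζ (γ t₀)
    have h2 : ‖ζ - γ t₀‖ ≤ 2 := by
      refine (norm_sub_le _ _).trans ?_
      rw [hζ, hγn]; norm_num
    refine le_add_of_nonneg_of_le (by positivity) ?_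
    refine h1.trans ((mul_le_mul_of_nonneg_left h2 (by positivity)).trans ?_)
    rw [div_mul_eq_mul_div, le_div_iff₀ (by positivity)]
    gcongr

/-- **Fatou's theorem**: a bounded holomorphic function on the unit disc has radial limits almost
everywhere. -/
theorem ae_exists_tendsto_radial {F : ℂ → ℂ} (hF : DifferentiableOn ℂ F (ball 0 1)) {C : ℝ}
    (hC : ∀ z ∈ ball (0 : ℂ) 1, ‖F z‖ ≤ C) :
    ∀ᵐ t : ℝ, ∃ w, Tendsto (fun r : ℝ => F (r * exp (2 * Real.pi * t * I))) (𝓝[<] 1) (𝓝 w) := by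
  -- A primitive of the bounded function F is Lipschitz, so it extends to the whole plane. Along the
  -- circle the extension is a Lipschitz function of t, hence differentiable almost everywhere, and
  -- its slope there will be the radial limit of F.
  obtain ⟨g, hg⟩ := hF.isExactOn_ball
  have hlip : LipschitzOnWith C.toNNReal g (ball 0 1) := by
    refine (convex_ball (0 : ℂ) 1).lipschitzOnWith_of_nnnorm_hasDerivWithin_le
      (fun z hz => (hg z hz).hasDerivWithinAt) fun z hz => ?_
    rw [← NNReal.coe_le_coe, coe_nnnorm]
    exact (hC z hz).trans (Real.le_coe_toNNReal C)
  obtain ⟨G, hG, hgG⟩ := hlip.extend_finite_dimension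
  have hGd : ∀ z ∈ ball (0 : ℂ) 1, HasDerivAt G (F z) z := fun z hz =>
    (hg z hz).congr_of_eventuallyEq
      (Filter.eventuallyEq_of_mem (isOpen_ball.mem_nhds hz) fun w hw => (hgG hw).symm)
  have hlipγ : ∃ K : NNReal, LipschitzWith K fun t : ℝ => exp (2 * Real.pi * t * I) := by
    refine ⟨(2 * Real.pi).toNNReal, lipschitzWith_of_nnnorm_deriv_le (fun t => by fun_prop) ?_⟩
    intro t
    have h1 : HasDerivAt (fun t : ℝ => (2 * Real.pi * t * I : ℂ)) (2 * Real.pi * I) t := by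
      have := ((HasDerivAt.ofReal_comp (hasDerivAt_id t)).const_mul (2 * Real.pi : ℂ)).mul_const I
      simpa using this
    rw [h1.cexp.deriv, ← NNReal.coe_le_coe, coe_nnnorm, norm_mul]
    have : (2 * Real.pi * t * I : ℂ) = (2 * Real.pi * t : ℝ) * I := by push_cast; ring
    rw [this, norm_exp_ofReal_mul_I, Real.coe_toNNReal _ Real.two_pi_pos.le]
    simp [abs_of_pos Real.pi_pos]
  obtain ⟨K, hK⟩ := hlipγ
  filter_upwards [(hG.comp hK).ae_differentiableAt_real] with t ht
  obtain ⟨L, hL⟩ := exists_norm_sub_linear_le hG ht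
  set ζ₀ := exp (2 * Real.pi * t * I) with hζ₀
  have hζn : ‖ζ₀‖ = 1 := by
    have : (2 * Real.pi * t * I : ℂ) = (2 * Real.pi * t : ℝ) * I := by push_cast; ring
    rw [hζ₀, this, norm_exp_ofReal_mul_I]
  refine ⟨L, Metric.tendsto_nhds.2 fun ε hε => ?_⟩
  -- The derivative estimate multiplies this by 8, leaving ε / 2 for the term that vanishes as r →
  -- 1.
  obtain ⟨B, hB0, hB⟩ := hL (ε / 16) (by positivity)
  have hH : DiffContOnCl ℂ (fun z => G z - G ζ₀ - L * (z - ζ₀)) (ball 0 1) := by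
    refine ⟨fun z hz => ?_, ?_⟩
    · have := (hGd z hz).differentiableAt
      exact DifferentiableAt.differentiableWithinAt (by fun_prop)
    · have := hG.continuous
      exact Continuous.continuousOn (by fun_prop)
  have hsmall : ∀ᶠ r : ℝ in 𝓝[<] 1, 8 * (ε / 16) + 32 * B * (1 - r) < ε := by
    refine eventually_nhdsWithin_of_eventually_nhds ?_
    have : ContinuousAt (fun r : ℝ => 8 * (ε / 16) + 32 * B * (1 - r)) 1 := by fun_prop
    refine this.eventually_lt continuousAt_const ?_
    simp; linarith
  filter_upwards [hsmall, Ioo_mem_nhdsLT (zero_lt_one (α := ℝ))] with r hr hr01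
  have hz : (r : ℂ) * ζ₀ ∈ ball (0 : ℂ) 1 := by
    rw [mem_ball_zero_iff, norm_mul, hζn, norm_real, Real.norm_eq_abs, abs_of_pos hr01.1, mul_one]
    exact hr01.2
  have hderiv : deriv (fun z => G z - G ζ₀ - L * (z - ζ₀)) (r * ζ₀) = F (r * ζ₀) - L := by
    have h1 := ((hGd _ hz).sub_const (G ζ₀)).sub
      (((hasDerivAt_id ((r : ℂ) * ζ₀)).sub_const ζ₀).const_mul L)
    rw [mul_one] at h1
    exact h1.deriv
  rw [dist_eq_norm, ← hderiv]
  exact (norm_deriv_le_of_norm_circle_le hH hζn (by positivity) hB0 hB hr01.1 hr01.2).trans_lt hr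

end Fatou

/-! ### Boundary values: inner functions are the isometric multipliers -/

lemma haarAddCircle_eq_volume : (AddCircle.haarAddCircle : Measure UnitAddCircle) = volume := by
  rw [AddCircle.volume_eq_smul_haarAddCircle, ENNReal.ofReal_one, one_smul]

lemma ae_unitAddCircle_of_ae_real {p : UnitAddCircle → Prop} (h : ∀ᵐ t : ℝ, p t) :
    ∀ᵐ t ∂(AddCircle.haarAddCircle : Measure UnitAddCircle), p t := by
  rw [haarAddCircle_eq_volume]
  have hmp := (measurePreserving_subtype_coe (μa := (volume : Measure ℝ))
    (measurableSet_Ioc (a := (0 : ℝ)) (b := 0 + 1))).comp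
      (AddCircle.measurePreserving_equivIoc (1 : ℝ) (a := 0))
  have := hmp.quasiMeasurePreserving.ae (ae_restrict_of_ae h)
  filter_upwards [this] with t ht
  have e : ((AddCircle.equivIoc (1 : ℝ) 0 t : ℝ) : UnitAddCircle) = t :=
    (AddCircle.equivIoc (1 : ℝ) 0).symm_apply_apply t
  simpa [e] using ht

/-- Bounded holomorphic functions on the disc have radial limits almost everywhere. -/
lemma HInfty.exists_radialLimit (Θ : HInfty disc) : ∃ W : UnitAddCircle → ℂ,
    ∀ᵐ t ∂AddCircle.haarAddCircle,
      Tendsto (fun r : ℝ => zeroExt Θ.toFun (r * (AddCircle.toCircle t : ℂ))) (𝓝[<] 1)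
        (𝓝 (W t)) := by
  obtain ⟨C, hC⟩ := Θ.bounded
  have h := ae_exists_tendsto_radial Θ.holomorphic (C := C) fun z hz => by
    rw [zeroExt_of_mem _ hz]; exact hC _
  have h2 : ∀ᵐ t : UnitAddCircle ∂AddCircle.haarAddCircle, ∃ w, Tendsto (fun r : ℝ =>
      zeroExt Θ.toFun (r * (AddCircle.toCircle t : ℂ))) (𝓝[<] 1) (𝓝 w) := by
    refine ae_unitAddCircle_of_ae_real ?_
    filter_upwards [h] with t ht
    have : ((AddCircle.toCircle (t : UnitAddCircle) : Circle) : ℂ) =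
        Complex.exp (2 * Real.pi * t * Complex.I) := by
      rw [AddCircle.toCircle_apply_mk, Circle.coe_exp]
      push_cast; congr 1; ring
    simpa only [this] using ht
  classical
  refine ⟨fun t => if h : ∃ w, Tendsto (fun r : ℝ =>
      zeroExt Θ.toFun (r * (AddCircle.toCircle t : ℂ))) (𝓝[<] 1) (𝓝 w) then h.choose else 0, ?_⟩
  filter_upwards [h2] with t ht
  rw [dif_pos ht]
  exact ht.choose_spec

/-- By Parseval the means are sums of |a_k|^2 r^{2|k|}, dominated by the square summable
coefficients; hence the supremum defining the norm is a limit as r → 1. -/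
lemma tendsto_integralMean {n : ℕ} (f : HardySpace n) :
    Tendsto (fun r : ℝ => integralMean f r) (𝓝[<] 1) (𝓝 (‖f‖ ^ 2)) := by
  have hn : ‖f‖ ^ 2 = ∑' k, ‖taylorCoeff (zeroExt f) k‖ ^ 2 := by
    rw [HardySpace.norm_def, HardySpace.iSup_integralMean, Real.sq_sqrt]
    exact tsum_nonneg fun k => sq_nonneg _
  have hlim : Tendsto (fun r : ℝ => ∑' k : Fin n → ℕ,
      (‖taylorCoeff (zeroExt f) k‖ * ∏ i, r ^ k i) ^ 2) (𝓝[<] 1)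
      (𝓝 (∑' k, ‖taylorCoeff (zeroExt f) k‖ ^ 2)) := by
    refine tendsto_tsum_of_dominated_convergence f.summable_coeff (fun k => ?_) ?_
    · have : Continuous fun r : ℝ => (‖taylorCoeff (zeroExt f) k‖ * ∏ i, r ^ k i) ^ 2 := by
        fun_prop
      simpa using (this.tendsto 1).mono_left nhdsWithin_le_nhds
    · filter_upwards [Ico_mem_nhdsLT (zero_lt_one (α := ℝ))] with r hr k
      rw [Real.norm_eq_abs, abs_of_nonneg (sq_nonneg _)]
      have : 0 ≤ ∏ i, r ^ k i := Finset.prod_nonneg fun i _ => pow_nonneg hr.1 _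
      gcongr
      exact mul_le_of_le_one_right (norm_nonneg _)
        (Finset.prod_le_one (fun i _ => pow_nonneg hr.1 _) fun i _ => pow_le_one₀ hr.1 hr.2.le)
  rw [hn]
  refine hlim.congr' ?_
  filter_upwards [Ico_mem_nhdsLT (zero_lt_one (α := ℝ))] with r hr
  exact (parseval f.isHolomorphic (fun _ => hr.1) (fun _ => hr.2)).tsum_eq

lemma measurePreserving_eval_torus {n : ℕ} (i : Fin n) :
    MeasurePreserving (Function.eval i) (torusMeasure n) AddCircle.haarAddCircle :=
  measurePreserving_eval (fun _ => (AddCircle.haarAddCircle : Measure UnitAddCircle)) i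

/-- The norm of `Θ̃ p`, for `p` continuous up to the boundary, is computed on the torus. -/
lemma norm_mulOp_extend_sq {n : ℕ} (i : Fin n) {Θ : HInfty disc} {W : UnitAddCircle → ℂ}
    (hW : ∀ᵐ t ∂AddCircle.haarAddCircle,
      Tendsto (fun r : ℝ => zeroExt Θ.toFun (r * (AddCircle.toCircle t : ℂ))) (𝓝[<] 1)
        (𝓝 (W t))) {f : HardySpace n} {p : (Fin n → ℂ) → ℂ} (hp : Continuous p)
    (hf : ∀ z : polydisc n, f z = p z) :
    ‖mulOp (Θ.extend i) f‖ ^ 2 =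
      ∫ x, ‖W (x i)‖ ^ 2 * ‖p (torusPoint (fun _ => 1) x)‖ ^ 2 ∂torusMeasure n := by
  obtain ⟨C, hC⟩ := Θ.bounded
  obtain ⟨D, hD⟩ := (isCompact_closedBall (0 : Fin n → ℂ) 1).exists_bound_of_continuousOn
    hp.continuousOn
  have hval : ∀ (r : ℝ), r ∈ Set.Ico (0 : ℝ) 1 → ∀ x : Fin n → UnitAddCircle,
      zeroExt (mulOp (Θ.extend i) f : polydisc n → ℂ) (torusPoint (fun _ => r) x) =
        zeroExt Θ.toFun (r * (AddCircle.toCircle (x i) : ℂ)) * p (torusPoint (fun _ => r) x) := by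
    intro r hr x
    have hx := torusPoint_mem (ρ := fun _ : Fin n => r) (fun _ => hr.1) (fun _ => hr.2) x
    have hxi : (r * (AddCircle.toCircle (x i) : ℂ)) ∈ disc := by
      rw [mem_ball_zero_iff]; exact hx i
    rw [zeroExt_of_mem _ hx, mulOp_apply, hf, zeroExt_of_mem _ hxi]
    rfl
  refine tendsto_nhds_unique (tendsto_integralMean _) ?_
  have hev : ∀ᶠ r : ℝ in 𝓝[<] 1, r ∈ Set.Ico (0 : ℝ) 1 := Ico_mem_nhdsLT zero_lt_one
  -- Θ is bounded by C on the disc and p by D on the closed polydisc, so a constant dominates.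
  refine tendsto_integral_filter_of_dominated_convergence (fun _ => (C * D) ^ 2) ?_ ?_ ?_ ?_
  · filter_upwards [hev] with r hr
    exact (integrable_mean (mulOp (Θ.extend i) f).isHolomorphic ⟨r, hr⟩).aestronglyMeasurable
  · filter_upwards [hev] with r hr
    refine Eventually.of_forall fun x => ?_
    have hx := torusPoint_mem (ρ := fun _ : Fin n => r) (fun _ => hr.1) (fun _ => hr.2) x
    have hxi : (r * (AddCircle.toCircle (x i) : ℂ)) ∈ disc := by
      rw [mem_ball_zero_iff]; exact hx i
    rw [hval r hr, norm_mul, Real.norm_eq_abs, abs_of_nonneg (sq_nonneg _)]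
    refine pow_le_pow_left₀ (by positivity) (mul_le_mul ?_ ?_ (norm_nonneg _) ?_) 2
    · rw [zeroExt_of_mem _ hxi]; exact hC _
    · refine hD _ (Metric.ball_subset_closedBall ?_)
      rw [← polydisc_eq_ball]; exact hx
    · exact (norm_nonneg _).trans (hC ⟨0, by simp⟩)
  · exact integrable_const _
  · have hWt := (measurePreserving_eval_torus i).quasiMeasurePreserving.ae hW
    filter_upwards [hWt] with x hx
    have h2 : Tendsto (fun r : ℝ => p (torusPoint (fun _ => r) x)) (𝓝[<] 1)
        (𝓝 (p (torusPoint (fun _ => 1) x))) := by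
      have : Continuous fun r : ℝ => p (torusPoint (fun _ => r) x) := by
        refine hp.comp (continuous_pi fun j => ?_)
        exact (Complex.continuous_ofReal).mul continuous_const
      exact (this.tendsto 1).mono_left nhdsWithin_le_nhds
    rw [← mul_pow, ← norm_mul]
    refine ((hx.mul h2).norm.pow 2).congr' ?_
    filter_upwards [hev] with r hr
    rw [hval r hr]

/-- Finite linear combinations of monomials are continuous up to the boundary. -/
lemma exists_continuous_of_mem_span {n : ℕ} {f : HardySpace n}
    (hf : f ∈ Submodule.span ℂ (Set.range (monomialBasis n))) :
    ∃ p : (Fin n → ℂ) → ℂ, Continuous p ∧ ∀ z : polydisc n, f z = p z := by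
  induction hf using Submodule.span_induction with
  | mem f hf =>
    obtain ⟨k, rfl⟩ := hf
    exact ⟨fun z => ∏ i, z i ^ k i, by fun_prop, monomialBasis_apply k⟩
  | zero => exact ⟨0, continuous_const, fun z => by rw [map_zero]; rfl⟩
  | add f g _ _ hf hg =>
    obtain ⟨p, hp, hfp⟩ := hf
    obtain ⟨q, hq, hgq⟩ := hg
    exact ⟨p + q, hp.add hq, fun z => by rw [map_add, Pi.add_apply, hfp, hgq]; rfl⟩
  | smul c f _ hf =>
    obtain ⟨p, hp, hfp⟩ := hf
    exact ⟨c • p, hp.const_smul c, fun z => by rw [map_smul, Pi.smul_apply, hfp]; rfl⟩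

/-- The constant function `1` on the disc. -/
def HInfty.one : HInfty disc where
  toFun _ := 1
  holomorphic := by
    refine (differentiableOn_const (1 : ℂ)).congr fun w hw => ?_
    rw [zeroExt_of_mem _ hw]
  bounded := ⟨1, fun w => by simp⟩

lemma HInfty.tendsto_one (t : UnitAddCircle) :
    Tendsto (fun r : ℝ => zeroExt HInfty.one.toFun (r * (AddCircle.toCircle t : ℂ))) (𝓝[<] 1)
      (𝓝 1) := by
  refine tendsto_const_nhds.congr' ?_
  filter_upwards [Ico_mem_nhdsLT (zero_lt_one (α := ℝ))] with r hr
  have : (r * (AddCircle.toCircle t : ℂ)) ∈ disc := by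
    simpa [norm_toCircle, abs_of_nonneg hr.1] using hr.2
  rw [zeroExt_of_mem _ this]; rfl

lemma HInfty.isInner_one : IsInner HInfty.one :=
  Eventually.of_forall fun t => ⟨1, norm_one, HInfty.tendsto_one t⟩

lemma mulOp_one_extend {n : ℕ} (i : Fin n) :
    mulOp (HInfty.one.extend i) = (1 : HardySpace n →L[ℂ] HardySpace n) := by
  ext f : 1
  exact HardySpace.ext fun z => one_mul _

/-- Multiplication by an inner function is isometric. -/
lemma IsInner.norm_mulOp_extend {n : ℕ} {Θ : HInfty disc} (hΘ : IsInner Θ) (i : Fin n)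
    (f : HardySpace n) : ‖mulOp (Θ.extend i) f‖ = ‖f‖ := by
  obtain ⟨W, hW⟩ := Θ.exists_radialLimit
  have hW1 : ∀ᵐ t ∂AddCircle.haarAddCircle, ‖W t‖ = 1 := by
    filter_upwards [hW, hΘ] with t h1 ⟨w, hw, h2⟩
    rw [tendsto_nhds_unique h1 h2, hw]
  have hW1t := (measurePreserving_eval_torus i).quasiMeasurePreserving.ae hW1
  have hdense : Dense (Submodule.span ℂ (Set.range (monomialBasis n)) : Set (HardySpace n)) :=
    Submodule.dense_iff_topologicalClosure_eq_top.2 (monomialBasis n).dense_span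
  have hclosed : IsClosed {f : HardySpace n | ‖mulOp (Θ.extend i) f‖ = ‖f‖} :=
    isClosed_eq (by fun_prop) (by fun_prop)
  refine hclosed.closure_subset_iff.2 (fun f hf => ?_) (hdense f)
  obtain ⟨p, hp, hfp⟩ := exists_continuous_of_mem_span hf
  have h1 := norm_mulOp_extend_sq i hW hp hfp
  -- The same boundary formula with Θ = 1 expresses the norm of f itself.
  have h2 := norm_mulOp_extend_sq i (Eventually.of_forall HInfty.tendsto_one) hp hfp
  rw [mulOp_one_extend, one_apply_eq_self] at h2
  have h3 : ‖mulOp (Θ.extend i) f‖ ^ 2 = ‖f‖ ^ 2 := by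
    rw [h1, h2]
    refine integral_congr_ae ?_
    filter_upwards [hW1t] with x hx
    simp only [Function.eval] at hx
    rw [hx, norm_one]
  exact (sq_eq_sq₀ (norm_nonneg _) (norm_nonneg _)).1 h3

/-- A function bounded by one whose norm in the Hardy space is one is inner. -/
lemma isInner_of_norm_eq_one {n : ℕ} {Θ : HInfty disc} (hb : ∀ w, ‖Θ.toFun w‖ ≤ 1) (i : Fin n)
    (hn : ‖mulOp (Θ.extend i) (monomialBasis n 0)‖ = 1) : IsInner Θ := by
  obtain ⟨W, hW⟩ := Θ.exists_radialLimit
  have hle : ∀ᵐ t ∂AddCircle.haarAddCircle, ‖W t‖ ≤ 1 := by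
    filter_upwards [hW] with t ht
    refine le_of_tendsto ht.norm (Eventually.of_forall fun r => ?_)
    by_cases h : (r * (AddCircle.toCircle t : ℂ)) ∈ disc
    · rw [zeroExt_of_mem _ h]; exact hb _
    · simp [zeroExt, h]
  have h1 := norm_mulOp_extend_sq i hW (continuous_const (y := (1 : ℂ)))
    (f := monomialBasis n 0) fun z => by simp [monomialBasis_apply]
  -- W was chosen pointwise; it is measurable as the almost everywhere limit of the continuous
  -- functions along the radii 1 - 1/(m+1).
  have hmeas : AEStronglyMeasurable W AddCircle.haarAddCircle := by
    have hu : Tendsto (fun m : ℕ => (1 : ℝ) - 1 / ((m : ℝ) + 1)) atTop (𝓝[<] 1) := by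
      refine tendsto_nhdsWithin_iff.2 ⟨?_, Eventually.of_forall fun m => ?_⟩
      · simpa using (tendsto_one_div_add_atTop_nhds_zero_nat (𝕜 := ℝ)).const_sub 1
      · have : (0 : ℝ) < 1 / ((m : ℝ) + 1) := by positivity
        simp only [Set.mem_Iio]; linarith
    refine aestronglyMeasurable_of_tendsto_ae atTop
      (f := fun (m : ℕ) t => zeroExt Θ.toFun (((1 - 1 / ((m : ℝ) + 1) : ℝ) : ℂ) *
        (AddCircle.toCircle t : ℂ))) (fun m => ?_) ?_
    · refine Continuous.aestronglyMeasurable ?_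
      refine Θ.holomorphic.continuousOn.comp_continuous ?_ fun t => ?_
      · exact continuous_const.mul (continuous_subtype_val.comp AddCircle.continuous_toCircle)
      · have h1 : (0 : ℝ) < 1 / ((m : ℝ) + 1) := by positivity
        have h2 : 1 / ((m : ℝ) + 1) ≤ 1 := by
          rw [div_le_one (by positivity)]; linarith [Nat.cast_nonneg (α := ℝ) m]
        rw [mem_ball_zero_iff, norm_mul, norm_toCircle, Complex.norm_real, Real.norm_eq_abs,
          abs_of_nonneg (by linarith), mul_one]
        linarith
    · filter_upwards [hW] with t ht
      exact ht.comp hu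
  have hmeas2 : AEStronglyMeasurable (fun t => ‖W t‖ ^ 2) AddCircle.haarAddCircle :=
    hmeas.norm.pow 2
  have hint : ∫ t, ‖W t‖ ^ 2 ∂AddCircle.haarAddCircle = 1 := by
    rw [hn, norm_one] at h1
    simp only [one_pow, mul_one] at h1
    have hmp := measurePreserving_eval_torus i
    have hmeas' : AEStronglyMeasurable (fun t => ‖W t‖ ^ 2)
        (Measure.map (Function.eval i) (torusMeasure n)) := by rwa [hmp.map_eq]
    have := integral_map hmp.measurable.aemeasurable hmeas'
    rw [hmp.map_eq] at this
    exact this.trans h1.symm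
  have hI : Integrable (fun t => ‖W t‖ ^ 2) AddCircle.haarAddCircle := by
    refine Integrable.of_bound hmeas2 1 ?_
    filter_upwards [hle] with t ht
    rw [Real.norm_eq_abs, abs_of_nonneg (sq_nonneg _)]
    exact pow_le_one₀ (norm_nonneg _) ht
  -- A nonnegative function with zero integral vanishes almost everywhere.
  have h0 : ∫ t, (1 - ‖W t‖ ^ 2) ∂AddCircle.haarAddCircle = 0 := by
    rw [integral_sub (integrable_const _) hI, hint]; simp
  have hz := (integral_eq_zero_iff_of_nonneg_ae (by
    filter_upwards [hle] with t ht
    exact sub_nonneg.2 (pow_le_one₀ (norm_nonneg _) ht)) ((integrable_const _).sub hI)).1 h0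
  filter_upwards [hW, hz] with t h1 h2
  refine ⟨W t, ?_, h1⟩
  have : ‖W t‖ ^ 2 = 1 := by simp only [Pi.zero_apply, Pi.sub_apply] at h2; linarith
  exact (pow_eq_one_iff_of_nonneg (norm_nonneg _) two_ne_zero).1 this

/-! ### Monomial multipliers and functions of one coordinate -/

/-- The monomial `z ^ k` as a bounded holomorphic function on the polydisc. -/
def HInfty.monomial {n : ℕ} (k : Fin n → ℕ) : HInfty (polydisc n) where
  toFun z := ∏ i, z.1 i ^ k i
  holomorphic := by
    have h : DifferentiableOn ℂ (fun z : Fin n → ℂ => ∏ i, z i ^ k i) (polydisc n) :=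
      Differentiable.differentiableOn (by fun_prop)
    exact h.congr fun z hz => zeroExt_of_mem _ hz
  bounded := ⟨1, fun z => by
    rw [norm_prod]
    refine Finset.prod_le_one (fun _ _ => norm_nonneg _) fun i _ => ?_
    rw [norm_pow]
    exact pow_le_one₀ (norm_nonneg _) (z.2 i).le⟩

/-- Multiplication by the monomial `z ^ k`. -/
def monoMul {n : ℕ} (k : Fin n → ℕ) : HardySpace n →L[ℂ] HardySpace n := mulOp (HInfty.monomial k)

lemma monoMul_apply {n : ℕ} (k : Fin n → ℕ) (f : HardySpace n) (z : polydisc n) :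
    monoMul k f z = (∏ i, z.1 i ^ k i) * f z := rfl

lemma monoMul_zero {n : ℕ} : monoMul (0 : Fin n → ℕ) = 1 := by
  ext f : 1
  exact HardySpace.ext fun z => by rw [monoMul_apply, one_apply_eq_self]; simp

lemma monoMul_add {n : ℕ} (k l : Fin n → ℕ) : monoMul (k + l) = monoMul k * monoMul l := by
  ext f : 1
  refine HardySpace.ext fun z => ?_
  rw [mul_apply_eq_comp, monoMul_apply, monoMul_apply, monoMul_apply]
  simp only [Pi.add_apply, pow_add, Finset.prod_mul_distrib]; ring

lemma monoMul_single {n : ℕ} (i : Fin n) (m : ℕ) : monoMul (Pi.single i m) = coordMul i ^ m := by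
  have h1 : monoMul (Pi.single i 1) = coordMul i := by
    ext f : 1
    refine HardySpace.ext fun z => ?_
    rw [monoMul_apply, coordMul_apply, Finset.prod_eq_single i] <;> simp +contextual
  induction m with
  | zero => rw [Pi.single_zero, monoMul_zero, pow_zero]
  | succ m ih => rw [Pi.single_add, monoMul_add, ih, h1, pow_succ]

lemma monoMul_monomialBasis {n : ℕ} (k l : Fin n → ℕ) :
    monoMul k (monomialBasis n l) = monomialBasis n (k + l) := by
  refine HardySpace.ext fun z => ?_
  rw [monoMul_apply, monomialBasis_apply, monomialBasis_apply]
  simp only [Pi.add_apply, pow_add, Finset.prod_mul_distrib]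

lemma star_monoMul_mul_monoMul {n : ℕ} (k : Fin n → ℕ) :
    star (monoMul k) * monoMul k = (1 : HardySpace n →L[ℂ] HardySpace n) := by
  refine clm_ext_monomial fun l => ext_inner_monomialBasis fun m => ?_
  rw [ContinuousLinearMap.star_eq_adjoint, mul_apply_eq_comp,
    ContinuousLinearMap.adjoint_inner_right, monoMul_monomialBasis, monoMul_monomialBasis,
    inner_monomialBasis, one_apply_eq_self, inner_monomialBasis]
  simp

lemma inner_monoMul_monoMul {n : ℕ} (k : Fin n → ℕ) (f g : HardySpace n) :
    inner ℂ (monoMul k f) (monoMul k g) = inner ℂ f g := by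
  rw [← ContinuousLinearMap.adjoint_inner_right, ← ContinuousLinearMap.star_eq_adjoint,
    ← mul_apply_eq_comp, star_monoMul_mul_monoMul, one_apply_eq_self]

lemma commute_star_coordMul_monoMul {n : ℕ} {j : Fin n} {k : Fin n → ℕ} (hk : k j = 0) :
    Commute (star (coordMul j)) (monoMul k : HardySpace n →L[ℂ] HardySpace n) := by
  refine clm_ext_monomial fun l => ?_
  simp only [ContinuousLinearMap.star_eq_adjoint, mul_apply_eq_comp, monoMul_monomialBasis,
    adjoint_coordMul_monomialBasis, Pi.add_apply, hk, zero_add]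
  split_ifs with h
  · simp
  · rw [monoMul_monomialBasis]
    congr 1
    ext m
    by_cases hm : m = j
    · subst hm; simp [hk]
    · simp [hm]

/-- The functions in `H²(𝔻ⁿ)` which do not depend on the variables in `s`. -/
def coordKer {n : ℕ} (s : Finset (Fin n)) : Submodule ℂ (HardySpace n) :=
  ⨅ j ∈ s, (star (coordMul j) : HardySpace n →L[ℂ] HardySpace n).ker

lemma mem_coordKer {n : ℕ} {s : Finset (Fin n)} {f : HardySpace n} :
    f ∈ coordKer s ↔ ∀ j ∈ s, star (coordMul j) f = 0 := by
  simp [coordKer, Submodule.mem_iInf]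

lemma isClosed_coordKer {n : ℕ} (s : Finset (Fin n)) : IsClosed (coordKer s : Set (HardySpace n)) := by
  have : (coordKer s : Set (HardySpace n)) =
      ⋂ j ∈ s, (fun f => star (coordMul j) f) ⁻¹' {(0 : HardySpace n)} := by
    ext f; simp [mem_coordKer]
  rw [this]
  exact isClosed_biInter fun j _ => isClosed_singleton.preimage (by fun_prop)

lemma coordMul_mem_coordKer {n : ℕ} {s : Finset (Fin n)} {i : Fin n} (hi : i ∉ s)
    {f : HardySpace n} (hf : f ∈ coordKer s) : coordMul i f ∈ coordKer s := by
  rw [mem_coordKer] at hf ⊢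
  intro j hj
  have h := commute_star_coordMul (n := n) (i := j) (j := i) (fun h => hi (h ▸ hj))
  rw [← mul_apply_eq_comp, h.eq, mul_apply_eq_comp, hf j hj, map_zero]

/-- Cancel the common part of the two monomials, so that the exponents left over have disjoint
supports. A leftover z_j with j ≠ i moves across the inner product as M_j^*, passes the other
monomial and kills a function of z_i alone. Otherwise only a positive power of z_i remains on one
side, and the hypotheses apply. -/
lemma inner_monoMul_eq_zero {n : ℕ} {i : Fin n} {g h : HardySpace n}
    (hg : g ∈ coordKer (Finset.univ.erase i)) (hh : h ∈ coordKer (Finset.univ.erase i))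
    (h1 : ∀ m, inner ℂ ((coordMul i ^ (m + 1)) g) h = 0)
    (h2 : ∀ m, inner ℂ g ((coordMul i ^ (m + 1)) h) = 0) {k l : Fin n → ℕ} (hkl : k ≠ l) :
    inner ℂ (monoMul k g) (monoMul l h) = 0 := by
  obtain ⟨c, k', l', rfl, rfl, hd⟩ : ∃ c k' l' : Fin n → ℕ, k = c + k' ∧ l = c + l' ∧
      ∀ j, k' j = 0 ∨ l' j = 0 := by
    refine ⟨k ⊓ l, k - k ⊓ l, l - k ⊓ l, ?_, ?_, fun j => ?_⟩
    · rw [add_tsub_cancel_of_le inf_le_left]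
    · rw [add_tsub_cancel_of_le inf_le_right]
    · simp only [Pi.sub_apply, Pi.inf_apply]; omega
  rw [monoMul_add, monoMul_add, mul_apply_eq_comp, mul_apply_eq_comp, inner_monoMul_monoMul]
  have aux : ∀ {u v : HardySpace n} {p q : Fin n → ℕ} {j : Fin n}, j ≠ i → p j ≠ 0 → q j = 0 →
      v ∈ coordKer (Finset.univ.erase i) → inner ℂ (monoMul p u) (monoMul q v) = 0 := by
    intro u v p q j hj hp hq hv
    have e : p = Pi.single j 1 + (p - Pi.single j 1) := by
      rw [add_tsub_cancel_of_le]
      intro m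
      by_cases hm : m = j
      · subst hm; simp; omega
      · simp [hm]
    rw [e, monoMul_add, monoMul_single, pow_one, mul_apply_eq_comp,
      ← ContinuousLinearMap.adjoint_inner_right, ← ContinuousLinearMap.star_eq_adjoint,
      ← mul_apply_eq_comp, (commute_star_coordMul_monoMul hq).eq, mul_apply_eq_comp,
      mem_coordKer.1 hv j (by simp [hj]), map_zero, inner_zero_right]
  by_cases hk : ∃ j, j ≠ i ∧ k' j ≠ 0
  · obtain ⟨j, hj, hkj⟩ := hk
    exact aux hj hkj ((hd j).resolve_left hkj) hh
  by_cases hl : ∃ j, j ≠ i ∧ l' j ≠ 0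
  · obtain ⟨j, hj, hlj⟩ := hl
    rw [← inner_conj_symm, aux hj hlj ((hd j).resolve_right hlj) hg, map_zero]
  push Not at hk hl
  have ek : k' = Pi.single i (k' i) := by
    ext j
    by_cases hj : j = i
    · subst hj; simp
    · simp [hj, hk j hj]
  have el : l' = Pi.single i (l' i) := by
    ext j
    by_cases hj : j = i
    · subst hj; simp
    · simp [hj, hl j hj]
  rw [ek, el, monoMul_single, monoMul_single]
  rcases hd i with h0 | h0
  · obtain ⟨m, hm⟩ := Nat.exists_eq_succ_of_ne_zero (n := l' i) fun h => hkl (by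
      rw [ek, el, h0, h])
    rw [h0, hm, pow_zero, one_apply_eq_self]; exact h2 m
  · obtain ⟨m, hm⟩ := Nat.exists_eq_succ_of_ne_zero (n := k' i) fun h => hkl (by
      rw [ek, el, h0, h])
    rw [h0, hm, pow_zero, one_apply_eq_self]; exact h1 m

/-! ### Wandering vectors and Beurling's theorem -/

/-- If the functions `z ^ k g` are orthonormal, then multiplication by `g` is an isometry of
`H²(𝔻ⁿ)`. -/
lemma exists_isometry_of_orthonormal {n : ℕ} {g : HardySpace n}
    (hg : Orthonormal ℂ fun k => monoMul k g) :
    ∃ V : HardySpace n →ₗᵢ[ℂ] HardySpace n, (∀ f z, V f z = g z * f z) ∧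
      ∀ f x, (∀ k, inner ℂ x (monoMul k g) = 0) → inner ℂ x (V f) = 0 := by
  -- V sends Σ a_k z^k to Σ a_k z^k g. Continuity of point evaluations identifies it with
  -- multiplication by g although g is not yet known to be bounded.
  set V := hg.orthogonalFamily.linearIsometry.comp
    (HardySpace.coeffEquiv (n := n)).toLinearIsometry with hV
  have hs : ∀ f, HasSum (fun k => HardySpace.coeff f k • monoMul k g) (V f) := by
    intro f
    exact hg.orthogonalFamily.hasSum_linearIsometry (HardySpace.coeff f)
  refine ⟨V, fun f z => ?_, fun f x hx => ?_⟩
  · have h1 := (hs f).mapL (evalCLM z)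
    simp only [map_smul, evalCLM_apply, monoMul_apply, smul_eq_mul] at h1
    have h2 := (f.hasSum_coeff z).mul_left (g z)
    refine h1.unique (h2.congr_fun fun k => ?_)
    ring
  · have h1 := (hs f).mapL (innerSL ℂ x)
    simp only [map_smul, innerSL_apply_apply, hx, smul_zero] at h1
    exact h1.unique hasSum_zero

lemma kernelFun_ne_zero {n : ℕ} (z : polydisc n) : kernelFun z ≠ 0 := by
  intro h
  have h1 := inner_kernelFun z (monomialBasis n 0)
  rw [h, monomialBasis_apply] at h1
  simp at h1

/-- An isometric multiplier is bounded by one. -/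
lemma norm_apply_le_one_of_isometry {n : ℕ} {g : HardySpace n}
    (V : HardySpace n →ₗᵢ[ℂ] HardySpace n) (hV : ∀ f z, V f z = g z * f z) (z : polydisc n) :
    ‖g z‖ ≤ 1 := by
  -- Evaluating V k_z at z shows that g(z) ‖k_z‖^2 is an inner product of two vectors of norm ‖k_z‖.
  have h1 : g z * inner ℂ (kernelFun z) (kernelFun z) =
      inner ℂ (kernelFun z) (V (kernelFun z)) := by
    rw [inner_kernelFun, inner_kernelFun, hV]
  have h2 : ‖g z‖ * ‖kernelFun z‖ ^ 2 ≤ 1 * ‖kernelFun z‖ ^ 2 := by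
    have h3 := norm_inner_le_norm (𝕜 := ℂ) (kernelFun z) (V (kernelFun z))
    rw [← h1, norm_mul, V.norm_map, inner_self_eq_norm_sq_to_K] at h3
    simp only [norm_pow, Complex.coe_algebraMap, Complex.norm_real, norm_norm] at h3
    rw [one_mul, sq (‖kernelFun z‖)]
    rwa [sq] at h3
  exact le_of_mul_le_mul_right h2 (pow_pos (norm_pos_iff.2 (kernelFun_ne_zero z)) 2)

/-- The shift is pure: every Taylor coefficient is killed by a high enough power of M_i^*. -/
lemma eq_zero_of_forall_exists_pow {n : ℕ} {i : Fin n} {f : HardySpace n}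
    (h : ∀ m : ℕ, ∃ u, f = (coordMul i ^ m) u) : f = 0 := by
  refine ext_inner_monomialBasis fun k => ?_
  obtain ⟨u, hu⟩ := h (k i + 1)
  rw [hu, inner_zero_right, ← ContinuousLinearMap.adjoint_inner_left,
    ← ContinuousLinearMap.star_eq_adjoint, star_pow,
    adjoint_coordMul_pow_monomialBasis i _ k (Nat.lt_succ_self _), inner_zero_left]

/-- An element of an invariant subspace `A` orthogonal to `A ⊖ z_i A` lies in `z_i A`. -/
lemma exists_eq_coordMul {n : ℕ} {i : Fin n} {A : Submodule ℂ (HardySpace n)}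
    (hA : IsClosed (A : Set (HardySpace n))) (hinv : ∀ f ∈ A, coordMul i f ∈ A) {f : HardySpace n}
    (hf : f ∈ A)
    (hw : ∀ h ∈ A, (∀ u ∈ A, inner ℂ (coordMul i u) h = 0) → inner ℂ h f = 0) :
    ∃ u ∈ A, f = coordMul i u := by
  have hiso : Isometry (coordMul i : HardySpace n →L[ℂ] HardySpace n) := by
    refine AddMonoidHomClass.isometry_of_norm _ fun u => ?_
    rw [← sq_eq_sq₀ (norm_nonneg _) (norm_nonneg _), ← inner_self_eq_norm_sq (𝕜 := ℂ),
      ← inner_self_eq_norm_sq (𝕜 := ℂ), inner_coordMul_coordMul]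
  set B := A.map (coordMul i : HardySpace n →L[ℂ] HardySpace n).toLinearMap with hB
  have hBc : IsClosed (B : Set (HardySpace n)) := by
    rw [hB, Submodule.map_coe]
    exact hiso.isClosedEmbedding.isClosedMap _ hA
  have : CompleteSpace B := hBc.completeSpace_coe
  have hBA : B ≤ A := by rintro _ ⟨u, hu, rfl⟩; exact hinv u hu
  set h := f - B.starProjection f with hh
  have hhB : ∀ u ∈ B, inner ℂ u h = 0 := fun u hu =>
    Submodule.inner_right_of_mem_orthogonal hu (Submodule.sub_starProjection_mem_orthogonal f)
  have hhA : h ∈ A := A.sub_mem hf (hBA (Submodule.starProjection_apply_mem _ _))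
  -- The part h of f orthogonal to z_i A is itself a wandering vector, so f is orthogonal to it, and
  -- ⟨h, h⟩ = ⟨h, f⟩ = 0.
  have h0 := hw h hhA fun u hu => hhB _ ⟨u, hu, rfl⟩
  have h1 : inner ℂ h h = 0 := by
    nth_rewrite 2 [hh]
    rw [inner_sub_right, h0, ← inner_conj_symm, hhB _ (Submodule.starProjection_apply_mem _ _)]
    simp
  have h2 : f = B.starProjection f := sub_eq_zero.1 (inner_self_eq_zero.1 h1)
  obtain ⟨u, hu, hfu⟩ := (h2 ▸ Submodule.starProjection_apply_mem B f : f ∈ B)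
  exact ⟨u, hu, hfu.symm⟩

lemma orthonormal_monoMul {n : ℕ} {i : Fin n} {g : HardySpace n}
    (hg : g ∈ coordKer (Finset.univ.erase i)) (hg1 : ‖g‖ = 1)
    (hw : ∀ m, inner ℂ ((coordMul i ^ (m + 1)) g) g = 0) :
    Orthonormal ℂ fun k => monoMul k g := by
  classical
  rw [orthonormal_iff_ite]
  intro k l
  split_ifs with hkl
  · rw [hkl, inner_monoMul_monoMul, inner_self_eq_norm_sq_to_K, hg1]; simp
  · exact inner_monoMul_eq_zero hg hg hw
      (fun m => by rw [← inner_conj_symm, hw, map_zero]) hkl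

/-- Two unit vectors in the wandering subspace cannot be orthogonal, because `g h` would lie in two
orthogonal ranges. -/
lemma not_orthogonal_wandering {n : ℕ} {i : Fin n} {g h : HardySpace n}
    (hg : g ∈ coordKer (Finset.univ.erase i)) (hh : h ∈ coordKer (Finset.univ.erase i))
    (hg1 : ‖g‖ = 1) (hh1 : ‖h‖ = 1) (hgw : ∀ m, inner ℂ ((coordMul i ^ (m + 1)) g) g = 0)
    (hhw : ∀ m, inner ℂ ((coordMul i ^ (m + 1)) h) h = 0)
    (h1 : ∀ m, inner ℂ ((coordMul i ^ (m + 1)) g) h = 0)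
    (h2 : ∀ m, inner ℂ g ((coordMul i ^ (m + 1)) h) = 0) : inner ℂ g h ≠ 0 := by
  intro h0
  obtain ⟨V, hV, hVo⟩ := exists_isometry_of_orthonormal (orthonormal_monoMul hg hg1 hgw)
  obtain ⟨U, hU, hUo⟩ := exists_isometry_of_orthonormal (orthonormal_monoMul hh hh1 hhw)
  have hort : ∀ k l, inner ℂ (monoMul k g) (monoMul l h) = 0 := by
    intro k l
    by_cases hkl : k = l
    · rw [hkl, inner_monoMul_monoMul, h0]
    · exact inner_monoMul_eq_zero hg hh h1 h2 hkl
  have e : U g = V h := HardySpace.ext fun z => by rw [hU, hV, mul_comm]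
  have h3 : inner ℂ (U g) (V h) = 0 := hVo _ _ fun k => by
    rw [← inner_conj_symm, hUo _ _ (hort k), map_zero]
  rw [e, inner_self_eq_zero, ← norm_eq_zero, V.norm_map, hh1] at h3
  exact one_ne_zero h3

/-- Every Taylor coefficient involving a variable other than z_i vanishes. -/
lemma apply_eq_of_mem_coordKer {n : ℕ} {i : Fin n} {g : HardySpace n}
    (hg : g ∈ coordKer (Finset.univ.erase i)) {z w : polydisc n} (hzw : z.1 i = w.1 i) :
    g z = g w := by
  refine (g.hasSum_coeff z).unique ((g.hasSum_coeff w).congr_fun fun k => ?_)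
  by_cases hk : ∃ j, j ≠ i ∧ k j ≠ 0
  · obtain ⟨j, hj, hkj⟩ := hk
    have e : Pi.single j 1 + (k - Pi.single j 1) = k := by
      rw [add_tsub_cancel_of_le]
      intro m
      by_cases hm : m = j
      · subst hm; simp; omega
      · simp [hm]
    have : HardySpace.coeff g k = 0 := by
      rw [coeff_eq_inner, ← e, add_comm, ← coordMul_monomialBasis,
        ← ContinuousLinearMap.adjoint_inner_right, ← ContinuousLinearMap.star_eq_adjoint,
        mem_coordKer.1 hg j (by simp [hj]), inner_zero_right]
    rw [this, zero_mul, zero_mul]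
  · push Not at hk
    congr 1
    refine Finset.prod_congr rfl fun j _ => ?_
    by_cases hj : j = i
    · rw [hj, hzw]
    · rw [hk j hj, pow_zero, pow_zero]

lemma single_mem_polydisc {n : ℕ} (i : Fin n) {w : ℂ} (hw : w ∈ disc) :
    (Pi.single i w : Fin n → ℂ) ∈ polydisc n := by
  intro j
  by_cases hj : j = i
  · subst hj; simpa using hw
  · simp [hj]

/-- The restriction to the `i`-th coordinate axis of a bounded function. -/
def HInfty.restrictAxis {n : ℕ} (i : Fin n) (g : HardySpace n) (hb : ∀ z, ‖g z‖ ≤ 1) :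
    HInfty disc where
  toFun w := g ⟨Pi.single i w.1, single_mem_polydisc i w.2⟩
  holomorphic := by
    have h : DifferentiableOn ℂ (fun w : ℂ => zeroExt g (Pi.single i w : Fin n → ℂ)) disc :=
      g.isHolomorphic.comp (t := polydisc n)
        (ContinuousLinearMap.single ℂ (fun _ : Fin n => ℂ) i).differentiable.differentiableOn
        fun w hw => single_mem_polydisc i hw
    refine h.congr fun w hw => ?_
    rw [zeroExt_of_mem _ hw, zeroExt_of_mem _ (single_mem_polydisc i hw)]
  bounded := ⟨1, fun w => hb _⟩

/-- **Beurling's theorem** on the functions of one coordinate: a `z_i`-invariant closed subspace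
`S` which contains nonzero functions of `z_i` contains an inner function which generates all
of them. -/
theorem exists_inner_generator {n : ℕ} {i : Fin n} {S : Submodule ℂ (HardySpace n)}
    (hS : IsClosed (S : Set (HardySpace n))) (hinv : ∀ f ∈ S, coordMul i f ∈ S)
    (hne : S ⊓ coordKer (Finset.univ.erase i) ≠ ⊥) :
    ∃ Θ : HInfty disc, IsInner Θ ∧ mulOp (Θ.extend i) (monomialBasis n 0) ∈ S ∧
      S ⊓ coordKer (Finset.univ.erase i) ≤ (mulOp (Θ.extend i)).range := by
  set A := S ⊓ coordKer (Finset.univ.erase i) with hAdef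
  have hAc : IsClosed (A : Set (HardySpace n)) := hS.inter (isClosed_coordKer _)
  have hAinv : ∀ f ∈ A, coordMul i f ∈ A := fun f hf =>
    ⟨hinv f hf.1, coordMul_mem_coordKer (by simp) hf.2⟩
  have hApow : ∀ (m : ℕ), ∀ f ∈ A, (coordMul i ^ m) f ∈ A := by
    intro m
    induction m with
    | zero => intro f hf; simpa using hf
    | succ m ih => intro f hf; rw [pow_succ', mul_apply_eq_comp]; exact hAinv _ (ih f hf)
  -- Infinite descent: if every f in A with property P is z_i times another such element, then f is
  -- divisible by all powers of z_i, hence zero.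
  have hdescend : ∀ P : HardySpace n → Prop,
      (∀ f ∈ A, P f → ∃ u ∈ A, P u ∧ f = coordMul i u) → ∀ f ∈ A, P f → f = 0 := by
    intro P hP f hf hPf
    refine eq_zero_of_forall_exists_pow (i := i) fun m => ?_
    obtain ⟨u, -, -, hu⟩ : ∃ u ∈ A, P u ∧ f = (coordMul i ^ m) u := by
      induction m with
      | zero => exact ⟨f, hf, hPf, by simp⟩
      | succ m ih =>
        obtain ⟨u, huA, hPu, hu⟩ := ih
        obtain ⟨v, hvA, hPv, hv⟩ := hP u huA hPu
        exact ⟨v, hvA, hPv, by rw [pow_succ, mul_apply_eq_comp, ← hv, hu]⟩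
    exact ⟨u, hu⟩
  -- If A ⊖ z_i A were zero, every element of A would be divisible by z_i within A, and descent
  -- would give A = 0.
  obtain ⟨g, hgA, hgw, hg1⟩ : ∃ g ∈ A, (∀ u ∈ A, inner ℂ (coordMul i u) g = 0) ∧ ‖g‖ = 1 := by
    by_contra! hcon
    have hz : ∀ h ∈ A, (∀ u ∈ A, inner ℂ (coordMul i u) h = 0) → h = 0 := by
      intro h hh hw
      by_contra h0
      refine hcon ((‖h‖ : ℂ)⁻¹ • h) (A.smul_mem _ hh) (fun u hu => ?_) (norm_smul_inv_norm h0)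
      rw [inner_smul_right, hw u hu, mul_zero]
    refine hne ((Submodule.eq_bot_iff _).2 fun f hf => ?_)
    refine hdescend (fun _ => True) (fun f hf _ => ?_) f hf trivial
    obtain ⟨u, hu, hfu⟩ := exists_eq_coordMul hAc hAinv hf fun h hh hw => by
      rw [hz h hh hw, inner_zero_left]
    exact ⟨u, hu, trivial, hfu⟩
  have hgself : ∀ m, inner ℂ ((coordMul i ^ (m + 1)) g) g = 0 := fun m => by
    rw [pow_succ', mul_apply_eq_comp]; exact hgw _ (hApow m g hgA)
  obtain ⟨V, hV, -⟩ := exists_isometry_of_orthonormal (orthonormal_monoMul hgA.2 hg1 hgself)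
  have hb := norm_apply_le_one_of_isometry V hV
  set Θ := HInfty.restrictAxis i g hb with hΘ
  -- The values of g depend on z_i only, so its restriction to the axis recovers g on the whole
  -- polydisc.
  have hMV : ∀ f, mulOp (Θ.extend i) f = V f := by
    intro f
    refine HardySpace.ext fun z => ?_
    rw [hV, mulOp_apply]
    congr 1
    exact apply_eq_of_mem_coordKer hgA.2 (by simp)
  have hg0 : mulOp (Θ.extend i) (monomialBasis n 0) = g := by
    refine HardySpace.ext fun z => ?_
    rw [hMV, hV, monomialBasis_apply]; simp
  refine ⟨Θ, isInner_of_norm_eq_one (fun w => hb _) i (by rw [hg0, hg1]), hg0 ▸ hgA.1, ?_⟩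
  -- The wandering subspace is one-dimensional: a wandering vector orthogonal to g, once normalized,
  -- would contradict `not_orthogonal_wandering`.
  have hwand : ∀ h ∈ A, (∀ u ∈ A, inner ℂ (coordMul i u) h = 0) → h = (inner ℂ g h : ℂ) • g := by
    intro h hh hw
    by_contra hne'
    set h' := h - (inner ℂ g h : ℂ) • g with hh'
    have hh'0 : h' ≠ 0 := sub_ne_zero.2 hne'
    have hh'A : h' ∈ A := A.sub_mem hh (A.smul_mem _ hgA)
    have hh'w : ∀ u ∈ A, inner ℂ (coordMul i u) h' = 0 := fun u hu => by
      rw [hh', inner_sub_right, inner_smul_right, hw u hu, hgw u hu]; simp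
    have hgh' : inner ℂ g h' = 0 := by
      rw [hh', inner_sub_right, inner_smul_right, inner_self_eq_norm_sq_to_K, hg1]; simp
    set e := (‖h'‖ : ℂ)⁻¹ • h' with he
    have heA : e ∈ A := A.smul_mem _ hh'A
    have hew : ∀ u ∈ A, inner ℂ (coordMul i u) e = 0 := fun u hu => by
      rw [he, inner_smul_right, hh'w u hu, mul_zero]
    refine not_orthogonal_wandering hgA.2 heA.2 hg1 (norm_smul_inv_norm hh'0) hgself
      (fun m => ?_) (fun m => ?_) (fun m => ?_) (by rw [inner_smul_right, hgh', mul_zero])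
    · rw [pow_succ', mul_apply_eq_comp]; exact hew _ (hApow m e heA)
    · rw [pow_succ', mul_apply_eq_comp]; exact hew _ (hApow m g hgA)
    · rw [← inner_conj_symm, pow_succ', mul_apply_eq_comp, hgw _ (hApow m e heA), map_zero]
  -- An f orthogonal to all z_i^m g is orthogonal to the wandering subspace, so f = z_i u with u in
  -- A; since M_i is isometric, u has the same orthogonality, and descent applies.
  have hzero : ∀ f ∈ A, (∀ m : ℕ, inner ℂ ((coordMul i ^ m) g) f = 0) → f = 0 := by
    refine hdescend _ fun f hf hfo => ?_
    obtain ⟨u, hu, hfu⟩ := exists_eq_coordMul hAc hAinv hf fun h hh hw => by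
      have h0 := hfo 0
      rw [pow_zero, one_apply_eq_self] at h0
      rw [hwand h hh hw, inner_smul_left, h0, mul_zero]
    refine ⟨u, hu, fun m => ?_, hfu⟩
    have := hfo (m + 1)
    rwa [hfu, pow_succ', mul_apply_eq_comp, inner_coordMul_coordMul] at this
  intro f hf
  have hRc : IsClosed ((mulOp (Θ.extend i)).range : Set (HardySpace n)) := by
    have : ((mulOp (Θ.extend i)).range : Set (HardySpace n)) = Set.range V := by
      ext x; simp [hMV]
    rw [this]
    exact V.isometry.isClosedEmbedding.isClosed_range
  -- The closed span of the z_i^m g lies both in A and in the closed range of Θ̃. The component of f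
  -- orthogonal to it stays in A, so it vanishes by `hzero`.
  set B := (Submodule.span ℂ (Set.range fun m : ℕ => (coordMul i ^ m) g)).topologicalClosure with hB
  have : CompleteSpace B := (Submodule.isClosed_topologicalClosure _).completeSpace_coe
  have hBA : B ≤ A := by
    refine Submodule.topologicalClosure_minimal _ (Submodule.span_le.2 ?_) hAc
    rintro _ ⟨m, rfl⟩; exact hApow m g hgA
  have hBR : B ≤ (mulOp (Θ.extend i)).range := by
    refine Submodule.topologicalClosure_minimal _ (Submodule.span_le.2 ?_) hRc
    rintro _ ⟨m, rfl⟩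
    refine ⟨(coordMul i ^ m) (monomialBasis n 0), ?_⟩
    have hc : Commute (mulOp (Θ.extend i)) (coordMul i ^ m) := (commute_mulOp _ _).pow_right m
    change mulOp (Θ.extend i) _ = _
    rw [← mul_apply_eq_comp, hc.eq, mul_apply_eq_comp, hg0]
  have hf0 : f - B.starProjection f = 0 := by
    refine hzero _ (A.sub_mem hf (hBA (Submodule.starProjection_apply_mem _ _))) fun m => ?_
    exact Submodule.inner_right_of_mem_orthogonal
      (Submodule.le_topologicalClosure _ (Submodule.subset_span (Set.mem_range_self m)))
      (Submodule.sub_starProjection_mem_orthogonal f)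
  rw [sub_eq_zero.1 hf0]
  exact hBR (Submodule.starProjection_apply_mem _ _)

/-! ### Commuting projections on a Hilbert space -/

section Hilbert

variable {H : Type*} [NormedAddCommGroup H] [InnerProductSpace ℂ H] [CompleteSpace H]

/-- Invariance of U under A^* says that A also preserves the orthogonal complement of U. -/
lemma starProjection_comm_of_reducing {U : Submodule ℂ H} [U.HasOrthogonalProjection]
    {A : H →L[ℂ] H} (h1 : ∀ f ∈ U, A f ∈ U) (h2 : ∀ f ∈ U, star A f ∈ U) (f : H) :
    U.starProjection (A f) = A (U.starProjection f) := by
  refine Submodule.eq_starProjection_of_mem_orthogonal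
    (h1 _ (Submodule.starProjection_apply_mem _ _)) ?_
  rw [← map_sub, Submodule.mem_orthogonal]
  intro u hu
  rw [← ContinuousLinearMap.adjoint_inner_left, ← ContinuousLinearMap.star_eq_adjoint]
  exact Submodule.inner_right_of_mem_orthogonal (h2 u hu)
    (Submodule.sub_starProjection_mem_orthogonal f)

/-- The sum of the ranges of finitely many commuting projections is closed. -/
lemma isClosed_iSup_range_of_commute {ι : Type*} {R : ι → H →L[ℂ] H}
    (hR : ∀ i, IsStarProjection (R i)) (hc : ∀ i j, Commute (R i) (R j)) (s : Finset ι) :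
    IsClosed ((⨆ i ∈ s, (R i).range : Submodule ℂ H) : Set H) := by
  classical
  induction s using Finset.induction_on with
  | empty => simp
  | insert a s ha ih =>
    rw [Finset.iSup_insert]
    set K : Submodule ℂ H := ⨆ i ∈ s, (R i).range with hK
    have : CompleteSpace K := ih.completeSpace_coe
    have hinv : ∀ f ∈ K, R a f ∈ K := by
      intro f hf
      have : K ≤ K.comap (R a).toLinearMap := by
        refine iSup₂_le fun i hi => ?_
        rintro _ ⟨u, rfl⟩
        refine Submodule.mem_iSup_of_mem i (Submodule.mem_iSup_of_mem hi ⟨R a u, ?_⟩)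
        exact congrArg (fun B : H →L[ℂ] H => B u) (hc i a).eq
      exact this hf
    have hidem : ∀ f, R a (R a f) = R a f := fun f =>
      congrArg (fun B : H →L[ℂ] H => B f) (hR a).isIdempotentElem.eq
    have hcomm : ∀ f, K.starProjection (R a f) = R a (K.starProjection f) :=
      starProjection_comm_of_reducing hinv (by rw [(hR a).isSelfAdjoint.star_eq]; exact hinv)
    -- R_a preserves K and is selfadjoint, so it commutes with P_K. Hence x lies in ran R_a + K
    -- exactly when R_a fixes (1 - P_K) x, which is a closed condition.
    have heq : (((R a).range ⊔ K : Submodule ℂ H) : Set H) =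
        {x | x - K.starProjection x = R a (x - K.starProjection x)} := by
      ext x
      simp only [SetLike.mem_coe, Submodule.mem_sup, Set.mem_ofPred_eq]
      constructor
      · rintro ⟨_, ⟨u, rfl⟩, k, hk, rfl⟩
        simp only [ContinuousLinearMap.coe_coe, map_add, map_sub, hcomm,
          Submodule.starProjection_eq_self_iff.2 hk, hidem]
        abel
      · intro hx
        refine ⟨x - K.starProjection x, ?_, K.starProjection x,
          Submodule.starProjection_apply_mem _ _, by abel⟩
        rw [hx]; exact ⟨_, rfl⟩
    rw [heq]
    exact isClosed_eq (by fun_prop) (by fun_prop)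

/-- A partial isometry and its range projection. -/
lemma isStarProjection_mul_star {M : H →L[ℂ] H} (h : star M * M = 1 ∨ M = 0) :
    IsStarProjection (M * star M) := by
  rcases h with h | h
  · refine ⟨?_, IsSelfAdjoint.mul_star_self M⟩
    change M * star M * (M * star M) = M * star M
    rw [mul_assoc, ← mul_assoc (star M), h, one_mul]
  · rw [h, zero_mul]; exact IsStarProjection.zero _

lemma range_mul_star {M : H →L[ℂ] H} (h : star M * M = 1 ∨ M = 0) :
    (M * star M).range = M.range := by
  apply le_antisymm
  · rintro _ ⟨u, rfl⟩; exact ⟨star M u, rfl⟩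
  · rintro _ ⟨u, rfl⟩
    rcases h with h | h
    · refine ⟨M u, ?_⟩
      change (M * star M * M) u = M u
      rw [mul_assoc, h, mul_one]
    · rw [h]; exact ⟨0, by simp⟩

end Hilbert

/-! ### Sums of one-variable Beurling subspaces -/

/-- The zero function on the disc. -/
def HInfty.zero : HInfty disc where
  toFun _ := 0
  holomorphic := by
    refine (differentiableOn_const (0 : ℂ)).congr fun w hw => ?_
    rw [zeroExt_of_mem _ hw]
  bounded := ⟨0, fun w => by simp⟩

lemma mulOp_zero_extend {n : ℕ} (i : Fin n) :
    mulOp (HInfty.zero.extend i) = (0 : HardySpace n →L[ℂ] HardySpace n) := by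
  ext f : 1
  refine HardySpace.ext fun z => ?_
  rw [mulOp_apply]
  exact zero_mul _

/-- Families of one-variable functions, one for each coordinate, which are inner or zero. -/
def IsInnerOrZero {n : ℕ} (Ψ : Fin n → HInfty disc) : Prop :=
  ∀ l, IsInner (Ψ l) ∨ Ψ l = HInfty.zero

/-- The sum over all coordinates of the subspaces `Ψ̃_l H²(𝔻ⁿ)`. -/
def axisSum {n : ℕ} (Ψ : Fin n → HInfty disc) : Submodule ℂ (HardySpace n) :=
  ⨆ l, (mulOp ((Ψ l).extend l)).range

lemma IsInner.star_mul_self {n : ℕ} {Θ : HInfty disc} (hΘ : IsInner Θ) (i : Fin n) :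
    star (mulOp (Θ.extend i)) * mulOp (Θ.extend i) = (1 : HardySpace n →L[ℂ] HardySpace n) := by
  rw [ContinuousLinearMap.star_eq_adjoint]
  exact (ContinuousLinearMap.norm_map_iff_adjoint_comp_self _).1 (hΘ.norm_mulOp_extend i)

section AxisSum

variable {n : ℕ} {Ψ : Fin n → HInfty disc}

lemma IsInnerOrZero.partialIsometry (hΨ : IsInnerOrZero Ψ) (l : Fin n) :
    star (mulOp ((Ψ l).extend l)) * mulOp ((Ψ l).extend l) =
      (1 : HardySpace n →L[ℂ] HardySpace n) ∨
    mulOp ((Ψ l).extend l) = (0 : HardySpace n →L[ℂ] HardySpace n) := by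
  rcases hΨ l with h | h
  · exact Or.inl (h.star_mul_self l)
  · rw [h]; exact Or.inr (mulOp_zero_extend l)

/-- The projection onto `Ψ̃_l H²(𝔻ⁿ)`. -/
def axisProj (Ψ : Fin n → HInfty disc) (l : Fin n) : HardySpace n →L[ℂ] HardySpace n :=
  mulOp ((Ψ l).extend l) * star (mulOp ((Ψ l).extend l))

lemma IsInnerOrZero.isStarProjection_axisProj (hΨ : IsInnerOrZero Ψ) (l : Fin n) :
    IsStarProjection (axisProj Ψ l) := isStarProjection_mul_star (hΨ.partialIsometry l)

lemma IsInnerOrZero.axisSum_eq (hΨ : IsInnerOrZero Ψ) :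
    axisSum Ψ = ⨆ l, (axisProj Ψ l).range :=
  iSup_congr fun l => (range_mul_star (hΨ.partialIsometry l)).symm

/-- For i ≠ j the multipliers commute with each other and with each other's adjoints, as they
involve different variables. -/
lemma commute_axisProj (i j : Fin n) : Commute (axisProj Ψ i) (axisProj Ψ j) := by
  by_cases hij : i = j
  · rw [hij]
  · have h1 := commute_star_mulOp_extend (n := n) hij (Ψ i) (Ψ j)
    have h2 := (commute_star_mulOp_extend (n := n) (Ne.symm hij) (Ψ j) (Ψ i)).symm
    have h3 := commute_mulOp ((Ψ i).extend i) ((Ψ j).extend j)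
    exact (h3.mul_right h2).mul_left (h1.mul_right h3.star_star)

lemma commute_star_coordMul_axisProj {i l : Fin n} (hil : i ≠ l) :
    Commute (star (coordMul i)) (axisProj Ψ l) :=
  (commute_star_coordMul_mulOp_extend hil (Ψ l)).mul_right (commute_mulOp _ _).star_star

lemma IsInnerOrZero.isClosed_axisSum (hΨ : IsInnerOrZero Ψ) :
    IsClosed (axisSum Ψ : Set (HardySpace n)) := by
  rw [hΨ.axisSum_eq]
  simpa using isClosed_iSup_range_of_commute hΨ.isStarProjection_axisProj commute_axisProj
    Finset.univ

lemma coordMul_mem_axisSum (i : Fin n) {f : HardySpace n} (hf : f ∈ axisSum Ψ) :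
    coordMul i f ∈ axisSum Ψ := by
  have : axisSum Ψ ≤ (axisSum Ψ).comap (coordMul i).toLinearMap := by
    refine iSup_le fun l => ?_
    rintro _ ⟨u, rfl⟩
    refine Submodule.mem_iSup_of_mem l ⟨coordMul i u, ?_⟩
    exact congrArg (fun B : HardySpace n →L[ℂ] HardySpace n => B u)
      (commute_mulOp ((Ψ l).extend l) (HInfty.coord.extend i)).eq
  exact this hf

end AxisSum

/-! ### Such sums have doubly commuting complements -/

section Compression

variable {n : ℕ} {Q : ClosedSubmodule ℂ (HardySpace n)}

lemma coe_compression (i : Fin n) (f : Q.toSubmodule) :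
    (compression Q i f : HardySpace n) = Q.toSubmodule.starProjection (coordMul i (f : HardySpace n)) :=
  rfl

lemma IsQuotientModule.star_coordMul_mem (hQ : IsQuotientModule Q) (i : Fin n) {f : HardySpace n}
    (hf : f ∈ Q.toSubmodule) : star (coordMul i) f ∈ Q.toSubmodule := by
  rw [← Q.toSubmodule.orthogonal_orthogonal, Submodule.mem_orthogonal]
  intro u hu
  rw [ContinuousLinearMap.star_eq_adjoint, ContinuousLinearMap.adjoint_inner_right]
  exact Submodule.inner_left_of_mem_orthogonal hf (hQ i u hu)

/-- Q is invariant under M_i^*, so no projection is needed: C_i^* is a plain restriction. -/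
lemma IsQuotientModule.coe_adjoint_compression (hQ : IsQuotientModule Q) (i : Fin n)
    (f : Q.toSubmodule) :
    (ContinuousLinearMap.adjoint (compression Q i) f : HardySpace n) =
      star (coordMul i) (f : HardySpace n) := by
  have : ContinuousLinearMap.adjoint (compression Q i) f =
      ⟨star (coordMul i) (f : HardySpace n), hQ.star_coordMul_mem i f.2⟩ := by
    refine ext_inner_left ℂ fun g => ?_
    rw [ContinuousLinearMap.adjoint_inner_right, Submodule.coe_inner, Submodule.coe_inner,
      coe_compression, Submodule.inner_starProjection_left_eq_right,
      Submodule.starProjection_eq_self_iff.2 f.2]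
    exact (ContinuousLinearMap.adjoint_inner_right _ _ _).symm
  rw [this]

variable {Ψ : Fin n → HInfty disc}

lemma isQuotientModule_of_orthogonal_eq_axisSum (hQ : Qᗮ.toSubmodule = axisSum Ψ) :
    IsQuotientModule Q := by
  intro i f hf
  have hf' : f ∈ axisSum Ψ := hQ ▸ hf
  have := coordMul_mem_axisSum i hf'
  rw [← hQ] at this
  exact this

/-- A vector is orthogonal to a sum of ranges of projections exactly when every projection kills it.
-/
lemma mem_iff_axisProj_eq_zero (hΨ : IsInnerOrZero Ψ) (hQ : Qᗮ.toSubmodule = axisSum Ψ)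
    {f : HardySpace n} : f ∈ Q.toSubmodule ↔ ∀ l, axisProj Ψ l f = 0 := by
  have hself : ∀ l, ContinuousLinearMap.adjoint (axisProj Ψ l) = axisProj Ψ l := fun l =>
    (hΨ.isStarProjection_axisProj l).isSelfAdjoint.star_eq
  have hQ' : Q.toSubmoduleᗮ = ⨆ l, (axisProj Ψ l).range := by rw [← hΨ.axisSum_eq, ← hQ]; rfl
  rw [← Q.toSubmodule.orthogonal_orthogonal, hQ', ← Submodule.iInf_orthogonal, Submodule.mem_iInf]
  refine forall_congr' fun l => ?_
  rw [Submodule.mem_orthogonal]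
  constructor
  · intro h
    rw [← inner_self_eq_zero (𝕜 := ℂ), ← ContinuousLinearMap.adjoint_inner_left, hself]
    exact h _ ⟨axisProj Ψ l f, rfl⟩
  · rintro h _ ⟨u, rfl⟩
    rw [ContinuousLinearMap.coe_coe, ← ContinuousLinearMap.adjoint_inner_right, hself, h,
      inner_zero_right]

/-- The orthogonal complement of a sum of one-variable Beurling subspaces is doubly commuting. -/
theorem isDoublyCommuting_of_orthogonal_eq_axisSum (hΨ : IsInnerOrZero Ψ)
    (hQ : Qᗮ.toSubmodule = axisSum Ψ) : IsDoublyCommuting Q := by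
  have hq := isQuotientModule_of_orthogonal_eq_axisSum hQ
  have hidem : ∀ l f, axisProj Ψ l (axisProj Ψ l f) = axisProj Ψ l f := fun l f =>
    congrArg (fun B : HardySpace n →L[ℂ] HardySpace n => B f)
      (hΨ.isStarProjection_axisProj l).isIdempotentElem.eq
  have hself : ∀ l, ContinuousLinearMap.adjoint (axisProj Ψ l) = axisProj Ψ l := fun l =>
    (hΨ.isStarProjection_axisProj l).isSelfAdjoint.star_eq
  have happ : ∀ {A B : HardySpace n →L[ℂ] HardySpace n}, Commute A B → ∀ f, A (B f) = B (A f) :=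
    fun h f => congrArg (fun C : HardySpace n →L[ℂ] HardySpace n => C f) h.eq
  -- Since the R_l commute, 1 - R_i does not disturb the vanishing of the others, so g - R_i g
  -- already lies in Q; the removed part is orthogonal to Q.
  have hproj : ∀ i g, (∀ l, l ≠ i → axisProj Ψ l g = 0) →
      Q.toSubmodule.starProjection g = g - axisProj Ψ i g := by
    intro i g hg
    refine Submodule.eq_starProjection_of_mem_orthogonal ?_ ?_
    · rw [mem_iff_axisProj_eq_zero hΨ hQ]
      intro l
      by_cases hl : l = i
      · rw [hl, map_sub, hidem, sub_self]
      · rw [map_sub, hg l hl, happ (commute_axisProj l i), hg l hl, map_zero, sub_zero]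
    · rw [sub_sub_cancel, Submodule.mem_orthogonal]
      intro u hu
      rw [← ContinuousLinearMap.adjoint_inner_left, hself,
        (mem_iff_axisProj_eq_zero hΨ hQ).1 hu, inner_zero_left]
  have hvanish : ∀ i, ∀ f ∈ Q.toSubmodule, ∀ l, l ≠ i → axisProj Ψ l (coordMul i f) = 0 := by
    intro i f hf l hl
    have hc : Commute (axisProj Ψ l) (coordMul i : HardySpace n →L[ℂ] HardySpace n) := by
      have := (commute_star_coordMul_axisProj (Ψ := Ψ) hl.symm).star_star
      rw [star_star, (hΨ.isStarProjection_axisProj l).isSelfAdjoint.star_eq] at this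
      exact this.symm
    rw [happ hc, (mem_iff_axisProj_eq_zero hΨ hQ).1 hf, map_zero]
  -- Both sides become explicit on f in Q: (1 - R_i) M_i M_j^* f and M_j^* (1 - R_i) M_i f, and
  -- M_j^* commutes with M_i and R_i.
  intro i j hij
  ext1 f
  apply Subtype.ext
  change (compression Q i (ContinuousLinearMap.adjoint (compression Q j) f) : HardySpace n) =
    (ContinuousLinearMap.adjoint (compression Q j) (compression Q i f) : HardySpace n)
  rw [coe_compression, hq.coe_adjoint_compression, hq.coe_adjoint_compression, coe_compression,
    hproj i _ (hvanish i _ (hq.star_coordMul_mem j f.2)), hproj i _ (hvanish i _ f.2), map_sub,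
    happ (commute_star_coordMul_axisProj hij.ne'), happ (commute_star_coordMul hij.ne')]

end Compression

/-! ### Passing between selected indices and all coordinates -/

section Reindex

variable {n : ℕ}

lemma innerSum_eq_iSup {m : ℕ} (i : Fin m → Fin n) (Θ : Fin m → HInfty disc) :
    innerSum i Θ = ⨆ j, (mulOp ((Θ j).extend (i j))).range := by
  classical
  have : ∀ s : Finset (Fin m), ∑ j ∈ s, (mulOp ((Θ j).extend (i j)) :
      HardySpace n →L[ℂ] HardySpace n).range =
      ⨆ j ∈ s, (mulOp ((Θ j).extend (i j)) : HardySpace n →L[ℂ] HardySpace n).range := by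
    intro s
    induction s using Finset.induction_on with
    | empty => simp
    | insert a s ha ih => rw [Finset.sum_insert ha, Finset.iSup_insert, ih]; rfl
  rw [innerSum, this]; simp

lemma range_mulOp_zero_extend (l : Fin n) : (mulOp (HInfty.zero.extend l)).range = ⊥ := by
  rw [mulOp_zero_extend]; simp

/-- Pad the family with zero functions at the unused coordinates; injectivity of the index map makes
this consistent. -/
lemma exists_axisSum_eq_innerSum {m : ℕ} {i : Fin m → Fin n} {Θ : Fin m → HInfty disc}
    (hi : StrictMono i) (hΘ : ∀ j, IsInner (Θ j)) :
    ∃ Ψ : Fin n → HInfty disc, IsInnerOrZero Ψ ∧ innerSum i Θ = axisSum Ψ := by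
  classical
  set Ψ : Fin n → HInfty disc := Function.extend i Θ fun _ => HInfty.zero with hΨ
  have h1 : ∀ j, Ψ (i j) = Θ j := hi.injective.extend_apply _ _
  have h2 : ∀ l, (¬∃ j, i j = l) → Ψ l = HInfty.zero := fun l hl =>
    Function.extend_apply' _ _ _ hl
  refine ⟨Ψ, fun l => ?_, ?_⟩
  · by_cases hl : ∃ j, i j = l
    · obtain ⟨j, rfl⟩ := hl
      rw [h1]; exact Or.inl (hΘ j)
    · exact Or.inr (h2 l hl)
  · rw [innerSum_eq_iSup, axisSum]
    apply le_antisymm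
    · refine iSup_le fun j => ?_
      rw [← h1 j]
      exact le_iSup (fun l => (mulOp ((Ψ l).extend l)).range) (i j)
    · refine iSup_le fun l => ?_
      by_cases hl : ∃ j, i j = l
      · obtain ⟨j, rfl⟩ := hl
        rw [h1]
        exact le_iSup (fun j => (mulOp ((Θ j).extend (i j))).range) j
      · rw [h2 l hl, range_mulOp_zero_extend]; exact bot_le

/-- Keep the coordinates whose function is inner, listed in increasing order. A nonzero sum has at
least one of them, which gives 1 ≤ m. -/
lemma IsInnerOrZero.exists_innerSum_eq {Ψ : Fin n → HInfty disc} (hΨ : IsInnerOrZero Ψ)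
    (hne : axisSum Ψ ≠ ⊥) :
    ∃ m : ℕ, 1 ≤ m ∧ m ≤ n ∧ ∃ (i : Fin m → Fin n) (Θ : Fin m → HInfty disc),
      StrictMono i ∧ (∀ j, IsInner (Θ j)) ∧ axisSum Ψ = innerSum i Θ := by
  classical
  set s : Finset (Fin n) := Finset.univ.filter fun l => IsInner (Ψ l) with hs
  have hs0 : ∀ l, l ∉ s → Ψ l = HInfty.zero := fun l hl =>
    (hΨ l).resolve_left (by simpa [hs] using hl)
  have hpos : 1 ≤ s.card := by
    rw [Nat.one_le_iff_ne_zero, Ne, Finset.card_eq_zero]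
    intro h0
    refine hne (iSup_eq_bot.2 fun l => ?_)
    rw [hs0 l (by simp [h0]), range_mulOp_zero_extend]
  refine ⟨s.card, hpos, by simpa using s.card_le_univ, s.orderEmbOfFin rfl,
    fun j => Ψ (s.orderEmbOfFin rfl j), (s.orderEmbOfFin rfl).strictMono, fun j => ?_, ?_⟩
  · exact (Finset.mem_filter.1 (s.orderEmbOfFin_mem rfl j)).2
  · rw [innerSum_eq_iSup, axisSum]
    apply le_antisymm
    · refine iSup_le fun l => ?_
      by_cases hl : l ∈ s
      · have : l ∈ Set.range (s.orderEmbOfFin rfl) := by rw [Finset.range_orderEmbOfFin]; exact hl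
        obtain ⟨j, rfl⟩ := this
        exact le_iSup (fun j => (mulOp ((Ψ (s.orderEmbOfFin rfl j)).extend
          (s.orderEmbOfFin rfl j))).range) j
      · rw [hs0 l hl, range_mulOp_zero_extend]; exact bot_le
    · exact iSup_le fun j => le_iSup (fun l => (mulOp ((Ψ l).extend l)).range) _

end Reindex

/-! ### Factorization of the vacuum state -/

@[elab_as_elim]
lemma multiIndex_induction {ι : Type*} [Fintype ι] [DecidableEq ι] {P : (ι → ℕ) → Prop}
    (zero : P 0) (add : ∀ k i, P k → P (k + Pi.single i 1)) (k : ι → ℕ) : P k := by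
  induction hN : ∑ j, k j generalizing k with
  | zero =>
    have : k = 0 := by
      ext j
      exact (Finset.sum_eq_zero_iff.1 hN) j (Finset.mem_univ j)
    rwa [this]
  | succ N ih =>
    obtain ⟨j, -, hj⟩ : ∃ j ∈ Finset.univ, k j ≠ 0 := by
      by_contra! h
      rw [Finset.sum_eq_zero h] at hN
      omega
    obtain ⟨p, rfl⟩ : ∃ p : ι → ℕ, k = p + Pi.single j 1 := by
      refine ⟨k - Pi.single j 1, ?_⟩
      rw [tsub_add_cancel_of_le]
      intro m
      by_cases hm : m = j
      · subst hm; simp; omega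
      · simp [hm]
    refine add p j (ih p ?_)
    simp only [Pi.add_apply, Finset.sum_add_distrib, Finset.sum_pi_single', Finset.mem_univ,
      if_true] at hN
    omega

section Vacuum

lemma clm_apply_comm {K : Type*} [NormedAddCommGroup K] [InnerProductSpace ℂ K]
    {A B : K →L[ℂ] K} (h : Commute A B) (x : K) : A (B x) = B (A x) :=
  congrArg (fun T : K →L[ℂ] K => T x) h.eq

variable {K : Type*} [NormedAddCommGroup K] [InnerProductSpace ℂ K] [CompleteSpace K]

variable {C D : K →L[ℂ] K} {φ : K}

/-- If `D (1 - C C*)` is the rank one operator `φ ⊗ φ` and `D` commutes with `C` and `C*`, then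
`φ` is an eigenvector of `D`. -/
lemma exists_eigenvalue_of_rankOne (hφ : φ ≠ 0) (hDC : Commute D C) (hDC' : Commute D (star C))
    (hE : ∀ x, D (x - C (star C x)) = (inner ℂ φ x : ℂ) • φ) :
    ∃ μ : ℂ, μ ≠ 0 ∧ D φ = μ • φ := by
  have hφφ : (inner ℂ φ φ : ℂ) ≠ 0 := inner_self_ne_zero.2 hφ
  have hcomm : ∀ x, D (x - C (star C x)) = D x - C (star C (D x)) := fun x => by
    rw [map_sub, clm_apply_comm hDC, clm_apply_comm hDC']
  -- D commutes with 1 - C C^*, so D (φ ⊗ φ) and (φ ⊗ φ) D agree; apply both to φ.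
  have h1 : (inner ℂ φ φ : ℂ) • D φ = (inner ℂ φ (D φ) : ℂ) • φ := by
    rw [← map_smul, ← hE, ← hE, ← hcomm]
  have h2 : D φ = ((inner ℂ φ φ : ℂ)⁻¹ * inner ℂ φ (D φ)) • φ := by
    rw [mul_smul, ← h1, smul_smul, inv_mul_cancel₀ hφφ, one_smul]
  -- If D φ = 0 then (1 - C C^*) D φ = 0, whereas it equals ⟨φ, φ⟩ φ.
  refine ⟨_, fun h0 => ?_, h2⟩
  rw [h0, zero_smul] at h2
  have h3 := hE φ
  rw [hcomm, h2] at h3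
  simp only [map_zero, sub_zero] at h3
  exact (smul_ne_zero hφφ hφ) h3.symm

/-- The vector state of `φ` is multiplicative on products of an operator `A` commuting with `D`
and an operator `B` commuting with `A`, `C` and `C*`. -/
lemma inner_mul_of_rankOne (hφ : φ ≠ 0) (hDC : Commute D C) (hDC' : Commute D (star C))
    (hE : ∀ x, D (x - C (star C x)) = (inner ℂ φ x : ℂ) • φ) {A B : K →L[ℂ] K}
    (hDA : Commute D A) (hBA : Commute B A) (hBC : Commute B C) (hBC' : Commute B (star C)) :
    (inner ℂ φ (A (B φ)) : ℂ) * inner ℂ φ φ = inner ℂ φ (A φ) * inner ℂ φ (B φ) := by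
  obtain ⟨μ, hμ, hμφ⟩ := exists_eigenvalue_of_rankOne hφ hDC hDC' hE
  have hB : ∀ x, B x - C (star C (B x)) = B (x - C (star C x)) := fun x => by
    rw [map_sub, clm_apply_comm hBC, clm_apply_comm hBC']
  -- On A φ the operator D acts as the scalar μ, so the defect 1 - C C^* alone sends A φ to a
  -- multiple of φ.
  have hΔ : ∀ A : K →L[ℂ] K, Commute D A →
      μ • (A φ - C (star C (A φ))) = (inner ℂ φ (A φ) : ℂ) • φ := by
    intro A hA
    rw [← hE, map_sub, clm_apply_comm hDC, clm_apply_comm hDC', clm_apply_comm hA, hμφ]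
    simp only [map_smul, smul_sub]
  -- Moving B outside the defect expresses ⟨φ, A B φ⟩ through D B φ. The case A = 1 expresses ⟨φ, B
  -- φ⟩ through the same vector, and comparing the two gives multiplicativity.
  have h1 : μ • (inner ℂ φ (A (B φ)) : ℂ) • φ = (inner ℂ φ (A φ) : ℂ) • D (B φ) := by
    rw [← hE, ← clm_apply_comm hBA, hB, ← map_smul, ← map_smul, hΔ A hDA, map_smul, map_smul]
  have h2 : μ • (inner ℂ φ (B φ) : ℂ) • φ = (inner ℂ φ φ : ℂ) • D (B φ) := by
    have := hΔ 1 (Commute.one_right D)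
    simp only [one_apply_eq_self] at this
    rw [← hE, hB, ← map_smul, ← map_smul, this, map_smul, map_smul]
  have h3 : (μ * ((inner ℂ φ (A (B φ)) : ℂ) * inner ℂ φ φ)) • φ =
      (μ * ((inner ℂ φ (A φ) : ℂ) * inner ℂ φ (B φ))) • φ := by
    have e1 := congrArg (fun x => (inner ℂ φ φ : ℂ) • x) h1
    have e2 := congrArg (fun x => (inner ℂ φ (A φ) : ℂ) • x) h2
    simp only [smul_smul] at e1 e2
    have e3 : (inner ℂ φ φ : ℂ) * inner ℂ φ (A φ) = inner ℂ φ (A φ) * inner ℂ φ φ := mul_comm _ _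
    rw [e3, ← e2] at e1
    convert e1 using 2 <;> ring
  exact mul_left_cancel₀ hμ (smul_left_injective ℂ hφ h3)

variable {ι : Type*} [DecidableEq ι] {T : ι → K →L[ℂ] K} {B : (ι → ℕ) → K →L[ℂ] K}

/-- A monomial not involving T_i is a product of the other T_j, each of which doubly commutes with
T_i. -/
lemma commute_monomial_operator [Fintype ι] (hT : ∀ i j, i ≠ j → Commute (T i) (T j))
    (hT' : ∀ i j, i ≠ j → Commute (T i) (star (T j))) (hB0 : B 0 = 1)
    (hB : ∀ k i, B (k + Pi.single i 1) = T i * B k) {i : ι} (k : ι → ℕ) (hk : k i = 0) :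
    Commute (B k) (T i) ∧ Commute (B k) (star (T i)) := by
  induction k using multiIndex_induction with
  | zero => rw [hB0]; exact ⟨Commute.one_left _, Commute.one_left _⟩
  | add p j ih =>
    have hji : j ≠ i := by rintro rfl; simp at hk
    have := ih (by simpa using (Nat.add_eq_zero_iff.1 hk).1)
    rw [hB]
    exact ⟨(hT j i hji).mul_left this.1, (hT' j i hji).mul_left this.2⟩

/-- The Gram matrix of the vectors `B k φ` is a tensor product. -/
lemma inner_monomial_operator [Fintype ι] (hT : ∀ i j, i ≠ j → Commute (T i) (T j))
    (hT' : ∀ i j, i ≠ j → Commute (T i) (star (T j))) (hB0 : B 0 = 1)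
    (hB : ∀ k i, B (k + Pi.single i 1) = T i * B k) (hφ : φ ≠ 0) {E : ι → K →L[ℂ] K}
    (hE1 : ∀ i, Commute (E i) (T i)) (hE2 : ∀ i, Commute (E i) (star (T i)))
    (hE : ∀ i x, E i (x - T i (star (T i) x)) = (inner ℂ φ x : ℂ) • φ) (k l : ι → ℕ) :
    (inner ℂ (B k φ) (B l φ) : ℂ) = inner ℂ φ φ *
      ∏ i, (inner ℂ ((T i ^ k i) φ) ((T i ^ l i) φ) / inner ℂ φ φ : ℂ) := by
  have hφφ : (inner ℂ φ φ : ℂ) ≠ 0 := inner_self_ne_zero.2 hφ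
  have hpow : ∀ k i m, B (k + Pi.single i m) = T i ^ m * B k := by
    intro k i m
    induction m with
    | zero => simp
    | succ m ih => rw [Pi.single_add, ← add_assoc, hB, ih, pow_succ', mul_assoc]
  -- Induction on a set containing the supports of both exponents, so that one variable is split off
  -- at a time.
  suffices H : ∀ s : Finset ι, ∀ k l : ι → ℕ, (∀ i ∉ s, k i = 0) → (∀ i ∉ s, l i = 0) →
      (inner ℂ (B k φ) (B l φ) : ℂ) = inner ℂ φ φ *
        ∏ i ∈ s, (inner ℂ ((T i ^ k i) φ) ((T i ^ l i) φ) / inner ℂ φ φ : ℂ) from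
    H Finset.univ k l (by simp) (by simp)
  intro s
  induction s using Finset.induction_on with
  | empty =>
    intro k l hk hl
    have h1 : k = 0 := funext fun i => hk i (by simp)
    have h2 : l = 0 := funext fun i => hl i (by simp)
    simp [h1, h2, hB0]
  | insert a s ha ih =>
    intro k l hk hl
    have split : ∀ p : ι → ℕ, p = Function.update p a 0 + Pi.single a (p a) := by
      intro p; ext i
      by_cases hi : i = a
      · subst hi; simp
      · simp [hi]
    have hsupp : ∀ p : ι → ℕ, (∀ i ∉ insert a s, p i = 0) → ∀ i ∉ s, Function.update p a 0 i = 0 := by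
      intro p hp i hi
      by_cases hia : i = a
      · subst hia; simp
      · rw [Function.update_of_ne hia]; exact hp i (by simp [hia, hi])
    have ih' := ih _ _ (hsupp k hk) (hsupp l hl)
    set k' := Function.update k a 0 with hk'
    set l' := Function.update l a 0 with hl'
    have ck := commute_monomial_operator hT hT' hB0 hB (i := a) k' (by simp [hk'])
    have cl := commute_monomial_operator hT hT' hB0 hB (i := a) l' (by simp [hl'])
    have ck1 : Commute (star (B k')) (T a) := by simpa using ck.2.star_star
    have ck2 : Commute (star (B k')) (star (T a)) := ck.1.star_star
    -- A collects the operators in the variable a and B those in the remaining variables; A B is the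
    -- full Gram entry because all these factors commute.
    have key := inner_mul_of_rankOne hφ (hE1 a) (hE2 a) (hE a)
      (A := star (T a) ^ k a * T a ^ l a) (B := star (B k') * B l')
      (((hE2 a).pow_right _).mul_right ((hE1 a).pow_right _))
      (((ck2.mul_left cl.2).pow_right _).mul_right ((ck1.mul_left cl.1).pow_right _))
      (ck1.mul_left cl.1) (ck2.mul_left cl.2)
    have hadj : ∀ (X : K →L[ℂ] K) (x y : K), (inner ℂ x (star X y) : ℂ) = inner ℂ (X x) y := by
      intro X x y
      rw [ContinuousLinearMap.star_eq_adjoint, ContinuousLinearMap.adjoint_inner_right]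
    have e1 : (inner ℂ φ ((star (T a) ^ k a * T a ^ l a) ((star (B k') * B l') φ)) : ℂ) =
        inner ℂ (B k φ) (B l φ) := by
      have hc : Commute (star (T a) ^ k a * T a ^ l a) (star (B k') * B l') :=
        ((((ck2.mul_left cl.2).pow_right _).mul_right ((ck1.mul_left cl.1).pow_right _))).symm
      have hc2 : Commute (T a ^ l a) (B l') := (cl.1.pow_right _).symm
      have hc3 : Commute (star (T a) ^ k a) (star (B k')) := (ck2.pow_right _).symm
      have : star (T a) ^ k a * T a ^ l a * (star (B k') * B l') =
          star (T a ^ k a * B k') * (T a ^ l a * B l') := by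
        have hc4 : Commute (T a ^ l a) (star (B k')) := (ck1.pow_right _).symm
        rw [star_mul, star_pow, ← hc3.eq, mul_assoc, mul_assoc, ← mul_assoc (T a ^ l a), hc4.eq,
          mul_assoc]
      rw [← mul_apply_eq_comp, this, mul_apply_eq_comp, hadj, ← hpow, ← hpow, ← split, ← split]
    have e2 : (inner ℂ φ ((star (T a) ^ k a * T a ^ l a) φ) : ℂ) =
        inner ℂ ((T a ^ k a) φ) ((T a ^ l a) φ) := by
      rw [mul_apply_eq_comp, ← star_pow, hadj]
    have e3 : (inner ℂ φ ((star (B k') * B l') φ) : ℂ) = inner ℂ (B k' φ) (B l' φ) := by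
      rw [mul_apply_eq_comp, hadj]
    rw [e1, e2, e3, ih'] at key
    have hprod : ∏ i ∈ s, (inner ℂ ((T i ^ k' i) φ) ((T i ^ l' i) φ) / inner ℂ φ φ : ℂ) =
        ∏ i ∈ s, (inner ℂ ((T i ^ k i) φ) ((T i ^ l i) φ) / inner ℂ φ φ : ℂ) := by
      refine Finset.prod_congr rfl fun i hi => ?_
      have hia : i ≠ a := fun h => ha (h ▸ hi)
      rw [hk', hl', Function.update_of_ne hia, Function.update_of_ne hia]
    rw [hprod] at key
    rw [Finset.prod_insert ha]
    have hfield : ∀ a x p : ℂ, a ≠ 0 → x * (a * p) = a * (x / a * p) * a := by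
      intro a x p ha
      field_simp
    exact mul_right_cancel₀ hφφ (key.trans (hfield _ _ _ hφφ))

end Vacuum

/-! ### Projections onto functions independent of some variables -/

instance {n : ℕ} (s : Finset (Fin n)) : CompleteSpace (coordKer s) :=
  (isClosed_coordKer s).completeSpace_coe

lemma starProjection_coordKer_coordMul {n : ℕ} {s : Finset (Fin n)} {a : Fin n} (ha : a ∉ s)
    (f : HardySpace n) : (coordKer s).starProjection (star (coordMul a) f) =
      star (coordMul a) ((coordKer s).starProjection f) ∧
    (coordKer s).starProjection (coordMul a f) = coordMul a ((coordKer s).starProjection f) := by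
  have h1 : ∀ f ∈ coordKer s, coordMul a f ∈ coordKer s := fun f => coordMul_mem_coordKer ha
  have h2 : ∀ f ∈ coordKer s, star (coordMul a) f ∈ coordKer s := by
    intro f hf
    rw [mem_coordKer] at hf ⊢
    intro j hj
    rw [clm_apply_comm (commute_coordMul j a).star_star, hf j hj, map_zero]
  exact ⟨starProjection_comm_of_reducing h2 (by simpa using h1) f,
    starProjection_comm_of_reducing h1 h2 f⟩

/-- The kernel of M_a^* has projection 1 - M_a M_a^*, and M_a^* commutes with the projection for s
because a is not in s. -/
lemma starProjection_coordKer_insert {n : ℕ} {s : Finset (Fin n)} {a : Fin n} (ha : a ∉ s)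
    (f : HardySpace n) : (coordKer (insert a s)).starProjection f =
      (coordKer s).starProjection f -
        coordMul a ((coordKer s).starProjection (star (coordMul a) f)) := by
  have hiso : ∀ g : HardySpace n, star (coordMul a) (coordMul a g) = g := fun g => by
    rw [← mul_apply_eq_comp, star_coordMul_mul_coordMul, one_apply_eq_self]
  refine Submodule.eq_starProjection_of_mem_orthogonal ?_ ?_
  · rw [mem_coordKer]
    intro j hj
    rcases Finset.mem_insert.1 hj with rfl | hj
    · rw [map_sub, hiso, (starProjection_coordKer_coordMul ha f).1, sub_self]
    · exact mem_coordKer.1 ((coordKer s).sub_mem (Submodule.starProjection_apply_mem _ _)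
        (coordMul_mem_coordKer ha (Submodule.starProjection_apply_mem _ _))) j hj
  · rw [Submodule.mem_orthogonal]
    intro u hu
    rw [mem_coordKer] at hu
    have hus : u ∈ coordKer s := mem_coordKer.2 fun j hj => hu j (Finset.mem_insert_of_mem hj)
    rw [sub_sub_eq_add_sub, add_sub_right_comm, inner_add_right,
      Submodule.inner_right_of_mem_orthogonal hus (Submodule.sub_starProjection_mem_orthogonal f),
      ← ContinuousLinearMap.adjoint_inner_left, ← ContinuousLinearMap.star_eq_adjoint,
      hu a (Finset.mem_insert_self _ _), inner_zero_left, add_zero]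

lemma monomialBasis_zero_mem_coordKer {n : ℕ} (s : Finset (Fin n)) :
    monomialBasis n 0 ∈ coordKer s := by
  rw [mem_coordKer]
  intro j _
  rw [ContinuousLinearMap.star_eq_adjoint, adjoint_coordMul_monomialBasis,
    if_pos (Pi.zero_apply j)]

/-- A function independent of every variable is constant, so the projection has rank one. -/
lemma starProjection_coordKer_univ {n : ℕ} (f : HardySpace n) :
    (coordKer Finset.univ).starProjection f =
      (inner ℂ (monomialBasis n 0) f : ℂ) • monomialBasis n 0 := by
  refine Submodule.eq_starProjection_of_mem_orthogonal
    (Submodule.smul_mem _ _ (monomialBasis_zero_mem_coordKer _)) ?_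
  rw [Submodule.mem_orthogonal]
  intro u hu
  have hu0 : u = (inner ℂ (monomialBasis n 0) u : ℂ) • monomialBasis n 0 := by
    refine ext_inner_monomialBasis fun k => ?_
    induction k using multiIndex_induction with
    | zero => rw [inner_smul_right, inner_monomialBasis, if_pos rfl, mul_one]
    | add k i _ =>
      rw [inner_smul_right, inner_monomialBasis, if_neg, mul_zero, ← coordMul_monomialBasis,
        ← ContinuousLinearMap.adjoint_inner_right, ← ContinuousLinearMap.star_eq_adjoint,
        mem_coordKer.1 hu i (Finset.mem_univ i), inner_zero_right]
      intro h
      have := congrFun h i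
      simp at this
  rw [hu0, inner_smul_left, inner_sub_right, inner_smul_right, inner_monomialBasis, if_pos rfl]
  simp

/-! ### The Gram matrix of a doubly commuting quotient module -/

section Compress

variable {n : ℕ} (Q : ClosedSubmodule ℂ (HardySpace n))

/-- The compression of an operator to `Q`. -/
def compress (A : HardySpace n →L[ℂ] HardySpace n) : Q.toSubmodule →L[ℂ] Q.toSubmodule :=
  Q.toSubmodule.orthogonalProjectionOnto ∘L A ∘L Q.toSubmodule.subtypeL

/-- The projection to `Q` of the constant function `1`. -/
def vacuum : Q.toSubmodule := Q.toSubmodule.orthogonalProjectionOnto (monomialBasis n 0)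

variable {Q}

lemma coe_compress (A : HardySpace n →L[ℂ] HardySpace n) (f : Q.toSubmodule) :
    (compress Q A f : HardySpace n) = Q.toSubmodule.starProjection (A (f : HardySpace n)) := rfl

lemma coe_vacuum : (vacuum Q : HardySpace n) = Q.toSubmodule.starProjection (monomialBasis n 0) :=
  rfl

/-- The part of f removed by the inner projection stays in Qᗮ under A. This is what makes
compression multiplicative on multipliers. -/
lemma starProjection_apply_starProjection {A : HardySpace n →L[ℂ] HardySpace n}
    (hA : ∀ f ∈ Q.toSubmoduleᗮ, A f ∈ Q.toSubmoduleᗮ) (f : HardySpace n) :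
    Q.toSubmodule.starProjection (A (Q.toSubmodule.starProjection f)) =
      Q.toSubmodule.starProjection (A f) := by
  symm
  rw [← sub_eq_zero, ← map_sub, ← map_sub]
  exact (Submodule.starProjection_apply_eq_zero_iff _).2
    (hA _ (Submodule.sub_starProjection_mem_orthogonal f))

lemma IsQuotientModule.monoMul_mem (hQ : IsQuotientModule Q) (k : Fin n → ℕ) :
    ∀ f ∈ Q.toSubmoduleᗮ, monoMul k f ∈ Q.toSubmoduleᗮ := by
  induction k using multiIndex_induction with
  | zero => intro f hf; rwa [monoMul_zero, one_apply_eq_self]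
  | add k i ih =>
    intro f hf
    rw [add_comm, monoMul_add, monoMul_single, pow_one, mul_apply_eq_comp]
    exact hQ i _ (ih f hf)

lemma IsQuotientModule.compress_coordMul_mul (hQ : IsQuotientModule Q) (i : Fin n)
    (A : HardySpace n →L[ℂ] HardySpace n) :
    compress Q (coordMul i * A) = compression Q i * compress Q A := by
  ext1 f
  apply Subtype.ext
  rw [mul_apply_eq_comp, coe_compression, coe_compress, coe_compress,
    starProjection_apply_starProjection (fun f => hQ i f), mul_apply_eq_comp]

lemma IsQuotientModule.commute_compression (hQ : IsQuotientModule Q) (i j : Fin n) :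
    Commute (compression Q i) (compression Q j) := by
  have h1 := hQ.compress_coordMul_mul i (coordMul j)
  have h2 := hQ.compress_coordMul_mul j (coordMul i)
  rw [(commute_coordMul i j).eq, h2] at h1
  exact h1.symm

lemma IsDoublyCommuting.commute (hd : IsDoublyCommuting Q) {i j : Fin n} (hij : i ≠ j) :
    Commute (compression Q i) (star (compression Q j)) := by
  rcases lt_or_gt_of_ne hij with h | h
  · exact hd i j h
  · have h1 := congrArg ContinuousLinearMap.adjoint (hd j i h)
    rw [ContinuousLinearMap.adjoint_comp, ContinuousLinearMap.adjoint_comp,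
      ContinuousLinearMap.adjoint_adjoint] at h1
    exact h1

/-- Compression turns the recursion for the ambient projections into one in C_a and C_a^*: M_a on
the left compresses multiplicatively, and M_a^* on the right preserves Q. -/
lemma compress_starProjection_insert (hQ : IsQuotientModule Q) {s : Finset (Fin n)} {a : Fin n}
    (ha : a ∉ s) : compress Q (coordKer (insert a s)).starProjection =
      compress Q (coordKer s).starProjection -
        compression Q a * compress Q (coordKer s).starProjection * star (compression Q a) := by
  ext1 f
  apply Subtype.ext
  have e : ((compress Q (coordKer s).starProjection -
      compression Q a * compress Q (coordKer s).starProjection * star (compression Q a)) f :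
      HardySpace n) = (compress Q (coordKer s).starProjection f : HardySpace n) -
      (compression Q a (compress Q (coordKer s).starProjection
        (ContinuousLinearMap.adjoint (compression Q a) f)) : HardySpace n) := rfl
  rw [e, coe_compression, coe_compress, coe_compress, coe_compress,
    starProjection_apply_starProjection (fun f => hQ a f), hQ.coe_adjoint_compression,
    starProjection_coordKer_insert ha, map_sub]

/-- By the recursion the compressed projection is built from C_b and C_b^* with b in s, and double
commutation lets all of these pass C_a and C_a^*. -/
lemma commute_compress_starProjection (hQ : IsQuotientModule Q) (hd : IsDoublyCommuting Q)
    (s : Finset (Fin n)) {a : Fin n} (ha : a ∉ s) :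
    Commute (compress Q (coordKer s).starProjection) (compression Q a) ∧
    Commute (compress Q (coordKer s).starProjection) (star (compression Q a)) := by
  induction s using Finset.induction_on with
  | empty =>
    have : compress Q (coordKer ∅).starProjection = 1 := by
      ext1 f
      apply Subtype.ext
      have h0 : (f : HardySpace n) ∈ coordKer ∅ := by simp [mem_coordKer]
      rw [coe_compress, Submodule.starProjection_eq_self_iff.2 h0,
        Submodule.starProjection_eq_self_iff.2 f.2, one_apply_eq_self]
    rw [this]
    exact ⟨Commute.one_left _, Commute.one_left _⟩
  | insert b s hb ih =>
    have hba : b ≠ a := fun h => ha (h ▸ Finset.mem_insert_self _ _)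
    obtain ⟨h1, h2⟩ := ih fun h => ha (Finset.mem_insert_of_mem h)
    have h3 := hQ.commute_compression b a
    have h4 := hd.commute hba
    have h5 : Commute (star (compression Q b)) (compression Q a) := (hd.commute hba.symm).symm
    rw [compress_starProjection_insert hQ hb]
    exact ⟨h1.sub_left ((h3.mul_left h1).mul_left h5),
      h2.sub_left ((h4.mul_left h2).mul_left h3.star_star)⟩

lemma inner_vacuum (f : Q.toSubmodule) :
    inner ℂ (vacuum Q) f = inner ℂ (monomialBasis n 0) (f : HardySpace n) := by
  rw [Submodule.coe_inner, coe_vacuum, Submodule.inner_starProjection_left_eq_right,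
    Submodule.starProjection_eq_self_iff.2 f.2]

/-- Adding the last variable i gives the compression of the projection onto constants, which is φ ⊗
φ. In the recursion D - C_i D C_i^* the factor D moves to the left since it commutes with C_i. -/
lemma compress_starProjection_erase (hQ : IsQuotientModule Q) (hd : IsDoublyCommuting Q)
    (i : Fin n) (f : Q.toSubmodule) :
    compress Q (coordKer (Finset.univ.erase i)).starProjection
      (f - compression Q i (star (compression Q i) f)) = (inner ℂ (vacuum Q) f : ℂ) • vacuum Q := by
  have h1 : compress Q (coordKer Finset.univ).starProjection f =
      (inner ℂ (vacuum Q) f : ℂ) • vacuum Q := by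
    apply Subtype.ext
    rw [coe_compress, starProjection_coordKer_univ, map_smul, inner_vacuum, Submodule.coe_smul,
      coe_vacuum]
  rw [← h1, ← Finset.insert_erase (Finset.mem_univ i),
    compress_starProjection_insert hQ (Finset.notMem_erase i _), Finset.insert_erase
      (Finset.mem_univ i)]
  have hc := (commute_compress_starProjection hQ hd _ (Finset.notMem_erase i Finset.univ)).1
  rw [← hc.eq, map_sub]
  rfl

lemma compress_monoMul_vacuum (hQ : IsQuotientModule Q) (k : Fin n → ℕ) :
    (compress Q (monoMul k) (vacuum Q) : HardySpace n) =
      Q.toSubmodule.starProjection (monomialBasis n k) := by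
  rw [coe_compress, coe_vacuum, starProjection_apply_starProjection (hQ.monoMul_mem k),
    monoMul_monomialBasis, add_zero]

lemma compress_monoMul_zero : compress Q (monoMul 0) = 1 := by
  ext1 f
  apply Subtype.ext
  rw [coe_compress, monoMul_zero, one_apply_eq_self, one_apply_eq_self,
    Submodule.starProjection_eq_self_iff.2 f.2]

lemma IsQuotientModule.compress_monoMul_add_single (hQ : IsQuotientModule Q) (k : Fin n → ℕ)
    (i : Fin n) : compress Q (monoMul (k + Pi.single i 1)) =
      compression Q i * compress Q (monoMul k) := by
  rw [add_comm, monoMul_add, monoMul_single, pow_one, hQ.compress_coordMul_mul]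

lemma IsQuotientModule.compression_pow (hQ : IsQuotientModule Q) (i : Fin n) (m : ℕ) :
    compression Q i ^ m = compress Q (monoMul (Pi.single i m)) := by
  induction m with
  | zero => rw [Pi.single_zero, compress_monoMul_zero, pow_zero]
  | succ m ih => rw [Pi.single_add, hQ.compress_monoMul_add_single, ← ih, pow_succ']

/-- The vacuum is cyclic: the compressed monomials map it to the vectors P_Q z^k, which would all
vanish with it. -/
lemma vacuum_ne_zero (hQ : IsQuotientModule Q) (hne : Q ≠ ⊥) : vacuum Q ≠ 0 := by
  intro h0
  apply hne
  rw [eq_bot_iff]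
  intro f hf
  have hk : ∀ k, Q.toSubmodule.starProjection (monomialBasis n k) = 0 := fun k => by
    rw [← compress_monoMul_vacuum hQ, h0, map_zero]; rfl
  have : f = 0 := by
    refine ext_inner_monomialBasis fun k => ?_
    rw [← Submodule.starProjection_eq_self_iff.2 (show f ∈ Q.toSubmodule from hf),
      ← Submodule.inner_starProjection_left_eq_right, hk, inner_zero_left, inner_zero_right]
  rw [this]
  exact zero_mem (⊥ : ClosedSubmodule ℂ (HardySpace n))

/-- P_Q z^k is the compressed monomial applied to the vacuum, so the matrix of P_Q is a Gram matrix
to which the factorization applies. -/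
lemma inner_starProjection_monomialBasis (hQ : IsQuotientModule Q) (hd : IsDoublyCommuting Q)
    (hne : Q ≠ ⊥) (k l : Fin n → ℕ) :
    (inner ℂ (monomialBasis n k) (Q.toSubmodule.starProjection (monomialBasis n l)) : ℂ) =
      inner ℂ (vacuum Q) (vacuum Q) * ∏ i, (inner ℂ (monomialBasis n (Pi.single i (k i)))
        (Q.toSubmodule.starProjection (monomialBasis n (Pi.single i (l i)))) /
          inner ℂ (vacuum Q) (vacuum Q) : ℂ) := by
  have hmat : ∀ k l : Fin n → ℕ,
      (inner ℂ (compress Q (monoMul k) (vacuum Q)) (compress Q (monoMul l) (vacuum Q)) : ℂ) =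
      inner ℂ (monomialBasis n k) (Q.toSubmodule.starProjection (monomialBasis n l)) := by
    intro k l
    rw [Submodule.coe_inner, compress_monoMul_vacuum hQ, compress_monoMul_vacuum hQ,
      Submodule.inner_starProjection_left_eq_right, Submodule.starProjection_eq_self_iff.2
        (Submodule.starProjection_apply_mem _ _)]
  have := inner_monomial_operator (T := fun i => compression Q i)
    (B := fun k => compress Q (monoMul k)) (φ := vacuum Q)
    (E := fun i => compress Q (coordKer (Finset.univ.erase i)).starProjection)
    (fun i j _ => hQ.commute_compression i j) (fun i j h => hd.commute h)
    compress_monoMul_zero hQ.compress_monoMul_add_single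
    (vacuum_ne_zero hQ hne)
    (fun i => (commute_compress_starProjection hQ hd _ (Finset.notMem_erase i _)).1)
    (fun i => (commute_compress_starProjection hQ hd _ (Finset.notMem_erase i _)).2)
    (compress_starProjection_erase hQ hd) k l
  rw [← hmat, this]
  simp only [hQ.compression_pow, hmat]

end Compress

/-! ### Uniqueness from the one-variable parts -/

section Uniqueness

variable {n : ℕ} {Q Q' : ClosedSubmodule ℂ (HardySpace n)}

lemma monomialBasis_single_mem_coordKer (i : Fin n) (m : ℕ) :
    monomialBasis n (Pi.single i m) ∈ coordKer (Finset.univ.erase i) := by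
  rw [mem_coordKer]
  intro j hj
  have h0 : (Pi.single i m : Fin n → ℕ) j = 0 := by
    simp [Finset.ne_of_mem_erase hj]
  rw [ContinuousLinearMap.star_eq_adjoint, adjoint_coordMul_monomialBasis, if_pos h0]

/-- Up to a scalar, `P_E P_Q` is the projection of `E` onto `E ⊖ (Qᗮ ⊓ E)`, where `E` is the space
of functions of the coordinate `z_i`. -/
lemma exists_smul_starProjection_mem (hQ : IsQuotientModule Q) (hd : IsDoublyCommuting Q)
    (hne : Q ≠ ⊥) (i : Fin n) : ∃ ν : ℂ, ν ≠ 0 ∧ ∀ m,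
      monomialBasis n (Pi.single i m) - ν • (coordKer (Finset.univ.erase i)).starProjection
        (Q.toSubmodule.starProjection (monomialBasis n (Pi.single i m))) ∈
          Q.toSubmoduleᗮ ⊓ coordKer (Finset.univ.erase i) ∧
      ν • (coordKer (Finset.univ.erase i)).starProjection
        (Q.toSubmodule.starProjection (monomialBasis n (Pi.single i m))) ∈
          (Q.toSubmoduleᗮ ⊓ coordKer (Finset.univ.erase i))ᗮ := by
  have hc := commute_compress_starProjection hQ hd _ (Finset.notMem_erase i Finset.univ)
  obtain ⟨μ, hμ, hφ⟩ := exists_eigenvalue_of_rankOne (vacuum_ne_zero hQ hne) hc.1 hc.2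
    (compress_starProjection_erase hQ hd i)
  refine ⟨μ⁻¹, inv_ne_zero hμ, fun m => ⟨⟨?_, ?_⟩, ?_⟩⟩
  · have h1 := clm_apply_comm (hc.1.pow_right m) (vacuum Q)
    rw [hφ, map_smul, hQ.compression_pow] at h1
    have h2 := congrArg (Subtype.val : Q.toSubmodule → HardySpace n) h1
    rw [coe_compress, compress_monoMul_vacuum hQ, Submodule.coe_smul,
      compress_monoMul_vacuum hQ] at h2
    refine (Submodule.starProjection_apply_eq_zero_iff _).1 ?_
    rw [map_sub, map_smul, h2, inv_smul_smul₀ hμ, sub_self]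
  · exact Submodule.sub_mem _ (monomialBasis_single_mem_coordKer i m)
      (Submodule.smul_mem _ _ (Submodule.starProjection_apply_mem _ _))
  · refine Submodule.smul_mem _ _ ((Submodule.mem_orthogonal _ _).2 fun u hu => ?_)
    rw [← Submodule.inner_starProjection_left_eq_right,
      Submodule.starProjection_eq_self_iff.2 hu.2]
    exact Submodule.inner_left_of_mem_orthogonal (Submodule.starProjection_apply_mem _ _) hu.1

/-- A nonzero doubly commuting quotient module is determined by the functions of one variable
orthogonal to it. -/
theorem IsDoublyCommuting.eq_of_inf_coordKer_eq (hQ : IsQuotientModule Q)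
    (hd : IsDoublyCommuting Q) (hne : Q ≠ ⊥) (hQ' : IsQuotientModule Q')
    (hd' : IsDoublyCommuting Q') (hne' : Q' ≠ ⊥)
    (h : ∀ i, Q.toSubmoduleᗮ ⊓ coordKer (Finset.univ.erase i) =
      Q'.toSubmoduleᗮ ⊓ coordKer (Finset.univ.erase i)) : Q = Q' := by
  have h1 : ∀ i, ∃ a : ℂ, a ≠ 0 ∧ ∀ k l,
      (inner ℂ (monomialBasis n (Pi.single i k))
        (Q'.toSubmodule.starProjection (monomialBasis n (Pi.single i l))) : ℂ) =
      a * inner ℂ (monomialBasis n (Pi.single i k))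
        (Q.toSubmodule.starProjection (monomialBasis n (Pi.single i l))) := by
    intro i
    obtain ⟨ν, hν, h1⟩ := exists_smul_starProjection_mem hQ hd hne i
    obtain ⟨ν', hν', h2⟩ := exists_smul_starProjection_mem hQ' hd' hne' i
    refine ⟨ν'⁻¹ * ν, mul_ne_zero (inv_ne_zero hν') hν, fun k l => ?_⟩
    -- Both sides are the projection of z_i^l onto the complement of the common subspace of E_i:
    -- their difference lies in that subspace and is orthogonal to it.
    have h3 : ν • (coordKer (Finset.univ.erase i)).starProjection
        (Q.toSubmodule.starProjection (monomialBasis n (Pi.single i l))) =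
        ν' • (coordKer (Finset.univ.erase i)).starProjection
        (Q'.toSubmodule.starProjection (monomialBasis n (Pi.single i l))) := by
      have hm := Submodule.sub_mem _ (h1 l).1 ((h i).symm ▸ (h2 l).1)
      have ho := Submodule.sub_mem _ ((h i).symm ▸ (h2 l).2) (h1 l).2
      rw [sub_sub_sub_cancel_left] at hm
      have := inner_self_eq_zero.1 (Submodule.inner_right_of_mem_orthogonal hm ho)
      exact (sub_eq_zero.1 this).symm
    have h4 : ∀ g : HardySpace n, (inner ℂ (monomialBasis n (Pi.single i k))
        ((coordKer (Finset.univ.erase i)).starProjection g) : ℂ) =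
        inner ℂ (monomialBasis n (Pi.single i k)) g := fun g => by
      rw [← Submodule.inner_starProjection_left_eq_right,
        Submodule.starProjection_eq_self_iff.2 (monomialBasis_single_mem_coordKer i k)]
    have h5 := congrArg (fun g => (inner ℂ (monomialBasis n (Pi.single i k)) g : ℂ)) h3
    simp only [inner_smul_right, h4] at h5
    rw [mul_assoc, h5, inv_mul_cancel_left₀ hν']
  choose a ha h1 using h1
  have hφ : (inner ℂ (vacuum Q) (vacuum Q) : ℂ) ≠ 0 := inner_self_ne_zero.2 (vacuum_ne_zero hQ hne)
  have hφ' : (inner ℂ (vacuum Q') (vacuum Q') : ℂ) ≠ 0 :=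
    inner_self_ne_zero.2 (vacuum_ne_zero hQ' hne')
  obtain ⟨c, hc, h2⟩ : ∃ c : ℂ, c ≠ 0 ∧
      Q'.toSubmodule.starProjection = c • Q.toSubmodule.starProjection := by
    set x : ℂ := inner ℂ (vacuum Q) (vacuum Q) with hx
    set y : ℂ := inner ℂ (vacuum Q') (vacuum Q') with hy
    -- The normalizing constants of the two factorizations and the scalars a_i are collected in one
    -- nonzero factor. Its value is irrelevant: proportional projections have the same range.
    refine ⟨y * (∏ i, a i * x / y) / x, div_ne_zero (mul_ne_zero hφ' (Finset.prod_ne_zero_iff.2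
      fun i _ => div_ne_zero (mul_ne_zero (ha i) hφ) hφ')) hφ, clm_ext_monomial fun l =>
      ext_inner_monomialBasis fun k => ?_⟩
    rw [_root_.smul_apply, inner_smul_right,
      inner_starProjection_monomialBasis hQ' hd' hne', inner_starProjection_monomialBasis hQ hd hne,
      ← hx, ← hy, ← mul_assoc, div_mul_cancel₀ _ hφ, mul_assoc, ← Finset.prod_mul_distrib]
    congr 1
    refine Finset.prod_congr rfl fun i _ => ?_
    rw [h1]
    field_simp
  have h3 : ∀ f, Q'.toSubmodule.starProjection f = c • Q.toSubmodule.starProjection f := fun f => by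
    rw [h2, _root_.smul_apply]
  refine le_antisymm (fun f hf => ?_) fun f hf => ?_
  · have := h3 f
    rw [Submodule.starProjection_eq_self_iff.2 (show f ∈ Q.toSubmodule from hf)] at this
    exact (Submodule.smul_mem_iff Q'.toSubmodule hc).1
      (this ▸ Submodule.starProjection_apply_mem _ _)
  · have := h3 f
    rw [Submodule.starProjection_eq_self_iff.2 (show f ∈ Q'.toSubmodule from hf)] at this
    show f ∈ Q.toSubmodule
    rw [this]
    exact Submodule.smul_mem _ _ (Submodule.starProjection_apply_mem _ _)

end Uniqueness

/-! ### Inner functions representing a doubly commuting quotient module -/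

section Representation

variable {n : ℕ} {Q : ClosedSubmodule ℂ (HardySpace n)}

/-- The submodule Qᗮ contains φ z^k for every k, and these span a dense subspace of the range of
multiplication by φ. -/
lemma IsQuotientModule.range_mulOp_le (hQ : IsQuotientModule Q) {φ : HInfty (polydisc n)}
    (hφ : mulOp φ (monomialBasis n 0) ∈ Q.toSubmoduleᗮ) : (mulOp φ).range ≤ Q.toSubmoduleᗮ := by
  have h : ∀ k, mulOp φ (monomialBasis n k) ∈ Q.toSubmoduleᗮ := fun k => by
    have e : mulOp φ (monomialBasis n k) = monoMul k (mulOp φ (monomialBasis n 0)) := by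
      have hc : Commute (mulOp φ) (monoMul k) := commute_mulOp _ _
      rw [← clm_apply_comm hc, monoMul_monomialBasis, add_zero]
    rw [e]
    exact hQ.monoMul_mem k _ hφ
  have h0 : Q.toSubmodule.starProjection ∘L mulOp φ = 0 := clm_ext_monomial fun k =>
    (Submodule.starProjection_apply_eq_zero_iff _).2 (h k)
  rintro _ ⟨f, rfl⟩
  exact (Submodule.starProjection_apply_eq_zero_iff _).1
    (congrArg (fun A : HardySpace n →L[ℂ] HardySpace n => A f) h0)

/-- A doubly commuting quotient module is the orthogonal complement of a sum of ranges of inner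
functions of one coordinate each. -/
theorem IsDoublyCommuting.exists_orthogonal_eq_axisSum (hn : 1 ≤ n) (hQ : IsQuotientModule Q)
    (hd : IsDoublyCommuting Q) :
    ∃ Ψ : Fin n → HInfty disc, IsInnerOrZero Ψ ∧ Qᗮ.toSubmodule = axisSum Ψ := by
  -- Here the vacuum is zero and the uniqueness theorem is not available, but Qᗮ is the whole space,
  -- generated by the constant inner function 1; this uses n ≥ 1.
  rcases eq_or_ne Q ⊥ with rfl | hne
  · refine ⟨fun _ => HInfty.one, fun _ => Or.inl HInfty.isInner_one, ?_⟩
    rw [ClosedSubmodule.bot_orthogonal_eq_top]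
    symm
    refine eq_top_iff.2 fun f _ => Submodule.mem_iSup_of_mem ⟨0, hn⟩ ?_
    rw [mulOp_one_extend]
    exact ⟨f, rfl⟩
  have hex : ∀ l : Fin n, ∃ Θ : HInfty disc, (IsInner Θ ∨ Θ = HInfty.zero) ∧
      mulOp (Θ.extend l) (monomialBasis n 0) ∈ Q.toSubmoduleᗮ ∧
      Q.toSubmoduleᗮ ⊓ coordKer (Finset.univ.erase l) ≤ (mulOp (Θ.extend l)).range := by
    intro l
    by_cases hl : Q.toSubmoduleᗮ ⊓ coordKer (Finset.univ.erase l) = ⊥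
    · refine ⟨HInfty.zero, Or.inr rfl, ?_, hl ▸ bot_le⟩
      rw [mulOp_zero_extend]
      exact Submodule.zero_mem _
    · obtain ⟨Θ, h1, h2, h3⟩ := exists_inner_generator
        (Submodule.isClosed_orthogonal Q.toSubmodule) (hQ l) hl
      exact ⟨Θ, Or.inl h1, h2, h3⟩
  choose Ψ hΨ hmem hle using hex
  have hΨ' : IsInnerOrZero Ψ := hΨ
  have hsub : axisSum Ψ ≤ Q.toSubmoduleᗮ := iSup_le fun l => hQ.range_mulOp_le (hmem l)
  obtain ⟨S, hS⟩ : ∃ S : ClosedSubmodule ℂ (HardySpace n), S.toSubmodule = axisSum Ψ :=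
    ⟨⟨axisSum Ψ, hΨ'.isClosed_axisSum⟩, rfl⟩
  have hSS : Sᗮᗮ.toSubmodule = axisSum Ψ := by
    rw [S.orthogonal_orthogonal_eq, hS]
  have hQS : Q ≤ Sᗮ := fun f hf => (Submodule.mem_orthogonal' _ _).2 fun u hu =>
    Submodule.inner_right_of_mem_orthogonal hf (hsub (hS ▸ hu))
  -- The comparison module contains Q, so it is nonzero and uniqueness applies to it.
  have hne' : Sᗮ ≠ ⊥ := fun h => hne (eq_bot_iff.2 (h ▸ hQS))
  have := hd.eq_of_inf_coordKer_eq hQ hne (isQuotientModule_of_orthogonal_eq_axisSum hSS)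
    (isDoublyCommuting_of_orthogonal_eq_axisSum hΨ' hSS) hne' fun i => by
      have hSS' : Sᗮ.toSubmoduleᗮ = axisSum Ψ := hSS
      rw [hSS']
      -- Each Ψ_l was chosen to generate Qᗮ ∩ E_l, so the sum loses nothing on the axes, and it
      -- gains nothing because it lies inside Qᗮ.
      refine le_antisymm (le_inf ((hle i).trans ?_) inf_le_right) (inf_le_inf_right _ hsub)
      exact le_iSup (fun l => (mulOp ((Ψ l).extend l)).range) i
  exact ⟨Ψ, hΨ', by rw [this, hSS]⟩

lemma isDoublyCommuting_iff_exists_innerSum (hn : 1 ≤ n) (hQ : IsQuotientModule Q) (hne : Q ≠ ⊤) :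
    IsDoublyCommuting Q ↔
      ∃ m : ℕ, 1 ≤ m ∧ m ≤ n ∧ ∃ (i : Fin m → Fin n) (Θ : Fin m → HInfty disc),
        StrictMono i ∧ (∀ j, IsInner (Θ j)) ∧ Qᗮ.toSubmodule = innerSum i Θ := by
  constructor
  · intro hd
    obtain ⟨Ψ, hΨ, h⟩ := hd.exists_orthogonal_eq_axisSum hn hQ
    rw [h]
    -- A zero sum would make Q the whole space.
    refine hΨ.exists_innerSum_eq fun h0 => hne ?_
    have h1 : Qᗮ = ⊥ := ClosedSubmodule.toSubmodule_injective (h.trans h0)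
    rw [← Q.orthogonal_orthogonal_eq, h1, ClosedSubmodule.bot_orthogonal_eq_top]
  · rintro ⟨m, -, -, i, Θ, hi, hΘ, h⟩
    obtain ⟨Ψ, hΨ, h'⟩ := exists_axisSum_eq_innerSum hi hΘ
    exact isDoublyCommuting_of_orthogonal_eq_axisSum hΨ (h.trans h')

end Representation

end Polydisc

end

/-! ### The main theorem -/

theorem mainTheorem3 (n : ℕ) (hn : 1 ≤ n) :
    (∀ Q : ClosedSubmodule ℂ (HardySpace n), IsQuotientModule Q → Q ≠ ⊤ →
      (IsDoublyCommuting Q ↔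
        ∃ m : ℕ, 1 ≤ m ∧ m ≤ n ∧ ∃ (i : Fin m → Fin n) (Θ : Fin m → HInfty disc),
          StrictMono i ∧ (∀ j, IsInner (Θ j)) ∧ Qᗮ.toSubmodule = innerSum i Θ)) ∧
    (∀ S : ClosedSubmodule ℂ (HardySpace n), S ≠ ⊥ →
      (IsCoDoublyCommuting S ↔
        ∃ m : ℕ, 1 ≤ m ∧ m ≤ n ∧ ∃ (i : Fin m → Fin n) (Θ : Fin m → HInfty disc),
          StrictMono i ∧ (∀ j, IsInner (Θ j)) ∧ S.toSubmodule = innerSum i Θ)) ∧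
    (∀ (m : ℕ) (i : Fin m → Fin n) (Θ : Fin m → HInfty disc),
      StrictMono i → (∀ j, IsInner (Θ j)) →
        IsClosed (innerSum i Θ : Set (HardySpace n))) := by
  refine ⟨fun Q hQ hne => isDoublyCommuting_iff_exists_innerSum hn hQ hne, fun S hne => ?_,
    fun m i Θ hi hΘ => ?_⟩
  -- The submodule form is the quotient form for Sᗮ, since S is closed and Sᗮᗮ = S.
  · have hne' : Sᗮ ≠ ⊤ := fun h => hne (by
      rw [← S.orthogonal_orthogonal_eq, h, ClosedSubmodule.top_orthogonal_eq_bot])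
    constructor
    · rintro ⟨hQ, hd⟩
      have := (isDoublyCommuting_iff_exists_innerSum hn hQ hne').1 hd
      rwa [S.orthogonal_orthogonal_eq] at this
    · rintro ⟨m, -, -, i, Θ, hi, hΘ, h⟩
      obtain ⟨Ψ, hΨ, h'⟩ := exists_axisSum_eq_innerSum hi hΘ
      have hS : Sᗮᗮ.toSubmodule = axisSum Ψ := by rw [S.orthogonal_orthogonal_eq, h, h']
      exact ⟨isQuotientModule_of_orthogonal_eq_axisSum hS,
        isDoublyCommuting_of_orthogonal_eq_axisSum hΨ hS⟩
  · obtain ⟨Ψ, hΨ, h⟩ := exists_axisSum_eq_innerSum hi hΘ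
    rw [h]
    exact hΨ.isClosed_axisSum
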